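/- Let $k\ge 1$, $d\ge 1$, and let either $0<\beta<\min(k,2)$ or $k=1=\beta$. Let $W=(W_1,\dots,W_d)$ be a $\mathbb C^d$-valued space-time white noise on $\mathbb R\times\mathbb R^k$: the real and imaginary parts of $W_1,\dots,W_d$ are $2d$ independent real white noises based on Lebesgue measure. Let $$F(t,x,\tau,\xi)=\frac{e^{-i\xi\cdot x-i\tau t}}{2|\xi|}\left[\frac{1-e^{it(\tau+|\xi|)}}{\tau+|\xi|}-\frac{1-e^{it(\tau-|\xi|)}}{\tau-|\xi|}\right],$$ and set, for $(t,x)\in\mathbb R_+\times\mathbb R^k$ and real test functions $\varphi\in C_c^\infty(\mathbb R\times\mathbb R^k)$, $$v_j(t,x)=\int_{\mathbb R}\int_{\mathbb R^k}|\xi|^{(\beta-k)/2}F(t,x,\tau,\xi)\,W_j(d\tau,d\xi),\qquad \tilde W_j(\varphi)=\int_{\mathbb R}\int_{\mathbb R^k}|\xi|^{(\beta-k)/2}\,\mathcal F\varphi(\tau,\xi)\,W_j(d\tau,d\xi),$$ where $\mathcal F\varphi(\tau,\xi)=\int\!\!\int e^{-i(\tau s+\xi\cdot y)}\varphi(s,y)\,ds\,dy$.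 Then these Wiener integrals exist (the integrands are square integrable), and $v=(v_1,\dots,v_d)$ is a $\mathbb C^d$-valued mild solution of $$\frac{\partial^2}{\partial t^2}v_j=\Delta v_j+\dot{\tilde W}_j,\qquad v_j(0,\cdot)=0,\quad \frac{\partial}{\partial t}v_j(0,\cdot)=0,\qquad j=1,\dots,d,$$ that is, $v_j(0,x)=0$ a.s. and $$v_j(t,x)=\int_{\mathbb R}\int_{\mathbb R^k}1_{[0,t]}(s)\,S(t-s,x-y)\,\tilde W_j(ds,dy)\quad\text{a.s., for all }t\ge0,\ x\in\mathbb R^k,$$ where $S(t,\cdot)$, the fundamental solution of the wave equation on $\mathbb R^k$, is the tempered distribution with spatial Fourier transform $\sin(t|\xi|)/|\xi|$, and where the stochastic integral of a space-time distribution $\Phi$ is the $L^2$-limit of $\tilde W_j(\varphi_n)$ for real test functions $\varphi_n$ that converge to $\Phi$ as tempered distributions. Consequently, let $\hat W=(\hat W_1,\dots,\hat W_d)$ be a centered real Gaussian noise indexed by the real test functions with $$E\big(\hat W_\ell(\varphi)\hat W_j(\psi)\big)=\delta_{\ell,j}\int_{\mathbb R_+}dr\int_{\mathbb R^k}dy\int_{\mathbb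 R^k}dz\,\varphi(r,y)\,|y-z|^{-\beta}\,\psi(r,z)$$ (respectively $\delta_{\ell,j}\int_{\mathbb R_+}dr\int_{\mathbb R}dy\,\varphi(r,y)\psi(r,y)$ if $k=1=\beta$), and let $\hat v$ be a mild solution, in the same sense, of the same system with $\tilde W$ replaced by $\hat W$. Then the random fields $(\operatorname{Re} v(t,x))$ and $(\sqrt{\kappa}\,\hat v(t,x))$, $(t,x)\in\mathbb R_+\times\mathbb R^k$, have the same law (the same finite-dimensional distributions), where $\kappa=(2\pi)^2$ if $k=1=\beta$, and otherwise $$\kappa=\frac{(2\pi)^{k+1}\,\Gamma(\beta/2)}{\pi^{k/2}\,2^{k-\beta}\,\Gamma((k-\beta)/2)} .$$ -/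

import Mathlib

open MeasureTheory ProbabilityTheory Filter Topology
open scoped ENNReal NNReal SchwartzMap FourierTransform Laplacian

namespace StochasticWave

noncomputable section

/-- The spatial variable lives in `ℝᵏ` with its Euclidean norm; space-time is `ℝ × Space k`. -/
abbrev Space (k : ℕ) : Type := EuclideanSpace ℝ (Fin k)

/-- Real test functions on space-time: smooth with compact support. -/
def IsTestFunction {k : ℕ} (φ : ℝ × Space k → ℝ) : Prop :=
  ContDiff ℝ ((⊤ : ℕ∞) : WithTop ℕ∞) φ ∧ HasCompactSupport φ

/-! ### White noise and its Wiener integral -/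

/-- The Borel subsets of space-time of finite Lebesgue measure. -/
abbrev FiniteBorel (k : ℕ) : Type :=
  {A : Set (ℝ × Space k) // MeasurableSet A ∧ volume A ≠ ∞}

/-- Real part (`true`) or imaginary part (`false`) of a complex number. -/
def part (b : Bool) (z : ℂ) : ℝ := if b then z.re else z.im

/-- `W` is a `ℂᵈ`-valued space-time white noise based on Lebesgue measure: the `2 d` set functions
`Re W_j`, `Im W_j` are jointly Gaussian and centered, each has covariance
`(A, B) ↦ vol (A ∩ B)`, and distinct ones are uncorrelated (hence independent). -/
structure IsComplexWhiteNoise {k d : ℕ} {Ω : Type*} [MeasurableSpace Ω]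
    (W : Fin d → Set (ℝ × Space k) → Ω → ℂ) (P : Measure Ω) : Prop where
  gaussian : IsGaussianProcess
    (fun (i : FiniteBorel k × Fin d × Bool) ω => part i.2.2 (W i.2.1 i.1 ω)) P
  centered : ∀ (A : FiniteBorel k) (j : Fin d) (a : Bool), ∫ ω, part a (W j A ω) ∂P = 0
  covariance : ∀ (A B : FiniteBorel k) (j l : Fin d) (a b : Bool),
    ∫ ω, part a (W j A ω) * part b (W l B ω) ∂P =
      if j = l ∧ a = b then (volume ((A : Set (ℝ × Space k)) ∩ B)).toReal else 0

/-- The integral of a simple function `f = ∑ z • 1_{f = z}` against a scalar noise `W`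
(the value `z = 0` contributes `0`). -/
def simpleIntegral {k : ℕ} {Ω : Type*} (W : Set (ℝ × Space k) → Ω → ℂ)
    (f : SimpleFunc (ℝ × Space k) ℂ) (ω : Ω) : ℂ :=
  ∑ z ∈ f.range, z * W (f ⁻¹' {z}) ω

/-- `X` is (a version of) the Wiener integral `∫ h dW` of the square integrable function `h`:
the `L²(P)`-limit of the integrals of square integrable simple functions that tend to `h` in
`L²` of Lebesgue measure. -/
def IsWienerIntegral {k : ℕ} {Ω : Type*} [MeasurableSpace Ω]
    (W : Set (ℝ × Space k) → Ω → ℂ) (P : Measure Ω) (h : ℝ × Space k → ℂ) (X : Ω → ℂ) : Prop :=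
  MemLp h 2 volume ∧ MemLp X 2 P ∧
    ∃ f : ℕ → SimpleFunc (ℝ × Space k) ℂ,
      (∀ n, MemLp (f n) 2 volume) ∧
      Tendsto (fun n => eLpNorm (fun p => f n p - h p) 2 volume) atTop (𝓝 0) ∧
      Tendsto (fun n => eLpNorm (fun ω => simpleIntegral W (f n) ω - X ω) 2 P) atTop (𝓝 0)

open Classical in
/-- The Wiener integral `∫ h dW` (a fixed version of it; `0` if it does not exist). -/
def wienerIntegral {k : ℕ} {Ω : Type*} [MeasurableSpace Ω]
    (W : Set (ℝ × Space k) → Ω → ℂ) (P : Measure Ω) (h : ℝ × Space k → ℂ) : Ω → ℂ :=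
  if H : ∃ X : Ω → ℂ, IsWienerIntegral W P h X then H.choose else 0

/-! ### The harmonizable field and the noise that drives it -/

/-- The space-time Fourier transform `∫ e^{-i(τ s + ξ·y)} φ(s,y) ds dy`. -/
def fourierST {k : ℕ} (φ : ℝ × Space k → ℝ) (p : ℝ × Space k) : ℂ :=
  ∫ q : ℝ × Space k,
    Complex.exp (-Complex.I * ((p.1 * q.1 + inner ℝ p.2 q.2 : ℝ) : ℂ)) * (φ q : ℂ)

/-- The spectral weight `|ξ|^{(β-k)/2}`. -/
def weight {k : ℕ} (β : ℝ) (p : ℝ × Space k) : ℂ := ((‖p.2‖ ^ ((β - k) / 2) : ℝ) : ℂ)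

/-- The function `F(t,x,τ,ξ)`, with `p = (τ,ξ)`. -/
def waveF {k : ℕ} (t : ℝ) (x : Space k) (p : ℝ × Space k) : ℂ :=
  Complex.exp (-Complex.I * ((inner ℝ p.2 x : ℝ) : ℂ) - Complex.I * p.1 * t) / (2 * ‖p.2‖) *
    ((1 - Complex.exp (Complex.I * t * (p.1 + ‖p.2‖))) / (p.1 + ‖p.2‖)
      - (1 - Complex.exp (Complex.I * t * (p.1 - ‖p.2‖))) / (p.1 - ‖p.2‖))

/-- The field `v_j(t,x) = ∫∫ |ξ|^{(β-k)/2} F(t,x,τ,ξ) W_j(dτ,dξ)`. -/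
def harmonizableField {k d : ℕ} {Ω : Type*} [MeasurableSpace Ω] (β : ℝ)
    (W : Fin d → Set (ℝ × Space k) → Ω → ℂ) (P : Measure Ω)
    (t : ℝ) (x : Space k) (ω : Ω) (j : Fin d) : ℂ :=
  wienerIntegral (W j) P (fun p => weight β p * waveF t x p) ω

/-- The noise `W̃_j(φ) = ∫∫ |ξ|^{(β-k)/2} (𝓕_{s,y} φ)(τ,ξ) W_j(dτ,dξ)`. -/
def tildeNoise {k d : ℕ} {Ω : Type*} [MeasurableSpace Ω] (β : ℝ)
    (W : Fin d → Set (ℝ × Space k) → Ω → ℂ) (P : Measure Ω)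
    (j : Fin d) (φ : ℝ × Space k → ℝ) : Ω → ℂ :=
  wienerIntegral (W j) P (fun p => weight β p * fourierST φ p)

/-! ### The fundamental solution of the wave equation -/

/-- The pairing `⟨S(t), φ⟩` of the fundamental solution `S(t)` of the wave equation on `ℝᵏ`, the
tempered distribution with Fourier transform `sin(t|ξ|)/|ξ|` (here in the frequency variable
`ξ/(2π)` of `𝓕⁻`), with a function `φ` (in practice a Schwartz function). See
`waveKernel_spec`. -/
def waveKernel {k : ℕ} (t : ℝ) (φ : Space k → ℂ) : ℂ :=
  ∫ ξ : Space k, ((t * Real.sinc (2 * Real.pi * t * ‖ξ‖) : ℝ) : ℂ) * 𝓕⁻ φ ξ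

/-- The derivative in `t` of `waveKernel t φ`. -/
def waveKernelDeriv {k : ℕ} (t : ℝ) (φ : Space k → ℂ) : ℂ :=
  ∫ ξ : Space k, ((Real.cos (2 * Real.pi * t * ‖ξ‖) : ℝ) : ℂ) * 𝓕⁻ φ ξ

theorem fourierInv_laplacian {k : ℕ} (φ : 𝓢(Space k, ℂ)) (ξ : Space k) :
    𝓕⁻ ((Δ φ : 𝓢(Space k, ℂ)) : Space k → ℂ) ξ =
      -((2 * Real.pi * ‖ξ‖ : ℝ) : ℂ) ^ 2 * 𝓕⁻ (φ : Space k → ℂ) ξ := by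
  have h : 𝓕 (Δ φ : 𝓢(Space k, ℂ)) =
      -((2 * Real.pi) ^ 2 : ℝ) • SchwartzMap.smulLeftCLM ℂ (fun y : Space k => ‖y‖ ^ 2) (𝓕 φ) := by
    rw [SchwartzMap.laplacian_eq_fourierMultiplierCLM, SchwartzMap.fourierMultiplierCLM_apply,
      FourierTransform.fourier_smul, FourierTransform.fourier_fourierInv_eq]
  rw [Real.fourierInv_eq_fourier_neg, Real.fourierInv_eq_fourier_neg, ← SchwartzMap.fourier_coe,
    ← SchwartzMap.fourier_coe, h]
  simp only [_root_.smul_apply]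
  rw [SchwartzMap.smulLeftCLM_apply_apply (by fun_prop)]
  simp
  ring

theorem hasDerivAt_mul_sinc (r t : ℝ) :
    HasDerivAt (fun t => t * Real.sinc (2 * Real.pi * t * r)) (Real.cos (2 * Real.pi * t * r)) t := by
  by_cases hr : r = 0
  · subst hr; simpa using hasDerivAt_id' t
  · have hc : 2 * Real.pi * r ≠ 0 := by positivity
    have h1 : (fun t => t * Real.sinc (2 * Real.pi * t * r)) =
        fun t => Real.sin (2 * Real.pi * t * r) / (2 * Real.pi * r) := by
      funext s
      by_cases hs : s = 0
      · simp [hs]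
      · rw [Real.sinc_of_ne_zero (by positivity)]
        field_simp
    rw [h1]
    have h2 : HasDerivAt (fun t => 2 * Real.pi * t * r) (2 * Real.pi * r) t := by
      simpa using ((hasDerivAt_id t).const_mul (2 * Real.pi)).mul_const r
    have := (h2.sin).div_const (2 * Real.pi * r)
    rwa [mul_div_assoc, div_self hc, mul_one] at this

theorem mul_sinc_mul (r t : ℝ) :
    t * Real.sinc (2 * Real.pi * t * r) * (2 * Real.pi * r) ^ 2 =
      Real.sin (2 * Real.pi * t * r) * (2 * Real.pi * r) := by
  by_cases hr : 2 * Real.pi * t * r = 0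
  · have : t * (2 * Real.pi * r) = 0 := by linarith
    rw [hr]; simp only [Real.sinc_zero, Real.sin_zero]; linear_combination (2 * Real.pi * r) * this
  · rw [Real.sinc_of_ne_zero hr]
    have h1 : t ≠ 0 := by rintro rfl; simp at hr
    have h2 : r ≠ 0 := by rintro rfl; simp at hr
    field_simp

/-- `t ↦ S(t)` solves `∂²S/∂t² = Δ S`, `S(0) = 0`, `∂S/∂t(0) = δ₀` in the sense of tempered
distributions. -/
theorem waveKernel_spec {k : ℕ} (φ : 𝓢(Space k, ℂ)) :
    waveKernel 0 φ = 0 ∧ waveKernelDeriv 0 φ = φ 0 ∧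
    (∀ t, HasDerivAt (fun t => waveKernel t φ) (waveKernelDeriv t φ) t) ∧
    (∀ t, HasDerivAt (fun t => waveKernelDeriv t φ) (waveKernel t (Δ φ : 𝓢(Space k, ℂ))) t) := by
  have hF : (𝓕⁻ (fun y => φ y)) = (𝓕⁻ φ : 𝓢(Space k, ℂ)) := (SchwartzMap.fourierInv_coe φ).symm
  set g : 𝓢(Space k, ℂ) := 𝓕⁻ φ with hg
  have hgi : Integrable (fun ξ => ‖g ξ‖) := g.integrable.norm
  have hgi1 : Integrable (fun ξ => ‖ξ‖ * ‖g ξ‖) := by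
    simpa using g.integrable_pow_mul volume 1
  have hsm : ∀ c : ℝ, AEStronglyMeasurable (fun ξ : Space k =>
      ((c * Real.sinc (2 * Real.pi * c * ‖ξ‖) : ℝ) : ℂ) * g ξ) := fun c => by
    apply Continuous.aestronglyMeasurable
    have := Real.continuous_sinc
    have := g.continuous
    fun_prop
  have hcm : ∀ c : ℝ, AEStronglyMeasurable (fun ξ : Space k =>
      ((Real.cos (2 * Real.pi * c * ‖ξ‖) : ℝ) : ℂ) * g ξ) := fun c => by
    apply Continuous.aestronglyMeasurable
    have := g.continuous
    fun_prop
  refine ⟨by simp [waveKernel], ?_, fun t => ?_, fun t => ?_⟩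
  · have : φ = 𝓕 g := by simp [hg]
    conv_rhs => rw [this]
    simp only [waveKernelDeriv, hF]
    rw [SchwartzMap.fourier_coe, Real.fourier_eq]
    simp
  · simp only [waveKernel, waveKernelDeriv, hF]
    refine (hasDerivAt_integral_of_dominated_loc_of_deriv_le (s := Set.univ)
      (F := fun (c : ℝ) (ξ : Space k) => ((c * Real.sinc (2 * Real.pi * c * ‖ξ‖) : ℝ) : ℂ) * g ξ)
      (F' := fun (c : ℝ) (ξ : Space k) => ((Real.cos (2 * Real.pi * c * ‖ξ‖) : ℝ) : ℂ) * g ξ)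
      (bound := fun ξ => ‖g ξ‖) Filter.univ_mem (Eventually.of_forall hsm) ?_ (hcm t) ?_ hgi ?_).2
    · refine (hgi.const_mul |t|).mono' (hsm t) (Eventually.of_forall fun ξ => ?_)
      rw [norm_mul, Complex.norm_real, Real.norm_eq_abs, abs_mul]
      gcongr
      exact mul_le_of_le_one_right (abs_nonneg _) (Real.abs_sinc_le_one _)
    · refine Eventually.of_forall fun ξ c _ => ?_
      rw [norm_mul, Complex.norm_real, Real.norm_eq_abs]
      exact mul_le_of_le_one_left (norm_nonneg _) (Real.abs_cos_le_one _)
    · exact Eventually.of_forall fun ξ c _ => ((hasDerivAt_mul_sinc ‖ξ‖ c).ofReal_comp).mul_const _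
  · have hfl := fourierInv_laplacian φ
    rw [hF] at hfl
    simp only [waveKernel, waveKernelDeriv, hfl, hF]
    have key : ∀ (c : ℝ) (ξ : Space k),
        ((c * Real.sinc (2 * Real.pi * c * ‖ξ‖) : ℝ) : ℂ) *
          (-((2 * Real.pi * ‖ξ‖ : ℝ) : ℂ) ^ 2 * g ξ) =
        ((-Real.sin (2 * Real.pi * c * ‖ξ‖) * (2 * Real.pi * ‖ξ‖) : ℝ) : ℂ) * g ξ := by
      intro c ξ
      have := congrArg (fun r : ℝ => (r : ℂ)) (mul_sinc_mul ‖ξ‖ c)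
      push_cast at this ⊢
      linear_combination (-g ξ) * this
    simp only [key]
    refine (hasDerivAt_integral_of_dominated_loc_of_deriv_le (s := Set.univ)
      (F := fun (c : ℝ) (ξ : Space k) => ((Real.cos (2 * Real.pi * c * ‖ξ‖) : ℝ) : ℂ) * g ξ)
      (F' := fun (c : ℝ) (ξ : Space k) =>
        ((-Real.sin (2 * Real.pi * c * ‖ξ‖) * (2 * Real.pi * ‖ξ‖) : ℝ) : ℂ) * g ξ)
      (bound := fun ξ => 2 * Real.pi * (‖ξ‖ * ‖g ξ‖)) Filter.univ_mem
      (Eventually.of_forall hcm) ?_ ?_ ?_ (hgi1.const_mul _) ?_).2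
    · refine hgi.mono' (hcm t) (Eventually.of_forall fun ξ => ?_)
      rw [norm_mul, Complex.norm_real, Real.norm_eq_abs]
      exact mul_le_of_le_one_left (norm_nonneg _) (Real.abs_cos_le_one _)
    · apply Continuous.aestronglyMeasurable
      have := g.continuous
      fun_prop
    · refine Eventually.of_forall fun ξ c _ => ?_
      rw [norm_mul, Complex.norm_real, Real.norm_eq_abs, abs_mul, abs_neg,
        abs_of_nonneg (by positivity : 0 ≤ 2 * Real.pi * ‖ξ‖)]
      have := Real.abs_sin_le_one (2 * Real.pi * c * ‖ξ‖)
      calc _ ≤ 1 * (2 * Real.pi * ‖ξ‖) * ‖g ξ‖ := by gcongr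
        _ = _ := by ring
    · refine Eventually.of_forall fun ξ c _ => ?_
      have h2 : HasDerivAt (fun t => 2 * Real.pi * t * ‖ξ‖) (2 * Real.pi * ‖ξ‖) c := by
        simpa using ((hasDerivAt_id c).const_mul (2 * Real.pi)).mul_const ‖ξ‖
      exact (h2.cos.ofReal_comp).mul_const _

/-- The space-time distribution `(s,y) ↦ 1_{[0,t]}(s) S(t-s, x-y)`, acting on `ψ`. -/
def truncatedKernel {k : ℕ} (t : ℝ) (x : Space k) (ψ : 𝓢(ℝ × Space k, ℂ)) : ℂ :=
  ∫ s in (0 : ℝ)..t, waveKernel (t - s) (fun y => ψ (s, x - y))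

/-! ### Mild solutions -/

/-- `X` is (a version of) the stochastic integral of the space-time distribution `Φ` against the
noise `N`: there are test functions `φ n` that converge to `Φ` as tempered distributions
and whose images `N (φ n)` converge to `X` in `L²(P)`. (This is the closure of `N`, that is, its
isometric extension to the completion of the test functions for the norm `φ ↦ ‖N φ‖_{L²(P)}`.) -/
def IsNoiseIntegral {k : ℕ} {Ω 𝕜 : Type*} [MeasurableSpace Ω] [NormedAddCommGroup 𝕜]
    (N : (ℝ × Space k → ℝ) → Ω → 𝕜) (P : Measure Ω) (Φ : 𝓢(ℝ × Space k, ℂ) → ℂ)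
    (X : Ω → 𝕜) : Prop :=
  MemLp X 2 P ∧
    ∃ φ : ℕ → ℝ × Space k → ℝ,
      (∀ n, IsTestFunction (φ n)) ∧
      (∀ ψ : 𝓢(ℝ × Space k, ℂ),
        Tendsto (fun n => ∫ p, (φ n p : ℂ) * ψ p) atTop (𝓝 (Φ ψ))) ∧
      Tendsto (fun n => eLpNorm (fun ω => N (φ n) ω - X ω) 2 P) atTop (𝓝 0)

/-- `v` is a (mild) solution of the system `∂²v_j/∂t² = Δ v_j + Ṅ_j`, `j = 1, …, d`, with
vanishing initial conditions: `v_j(t,x) = ∫∫ 1_{[0,t]}(s) S(t-s,x-y) N_j(ds,dy)`. -/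
structure IsMildWaveSolution {k d : ℕ} {Ω 𝕜 : Type*} [MeasurableSpace Ω] [NormedAddCommGroup 𝕜]
    (N : Fin d → (ℝ × Space k → ℝ) → Ω → 𝕜) (P : Measure Ω)
    (v : ℝ → Space k → Ω → Fin d → 𝕜) : Prop where
  initial : ∀ x j, ∀ᵐ ω ∂P, v 0 x ω j = 0
  mild : ∀ t, 0 ≤ t → ∀ x j, IsNoiseIntegral (N j) P (truncatedKernel t x) (fun ω => v t x ω j)

/-! ### The real noise with Riesz (or white) spatial covariance -/

/-- The covariance functional: `∫_{ℝ₊} dr ∫ dy ∫ dz φ(r,y) |y-z|^{-β} ψ(r,z)`, except for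
`k = 1 = β`, where it is `∫_{ℝ₊} dr ∫ dy φ(r,y) ψ(r,y)`. -/
def noiseCovariance (k : ℕ) (β : ℝ) (φ ψ : ℝ × Space k → ℝ) : ℝ :=
  open Classical in
  if k = 1 ∧ β = 1 then ∫ r in Set.Ioi (0 : ℝ), ∫ y : Space k, φ (r, y) * ψ (r, y)
  else ∫ r in Set.Ioi (0 : ℝ), ∫ y : Space k, ∫ z : Space k,
    φ (r, y) * ‖y - z‖ ^ (-β) * ψ (r, z)

/-- `N` is the `ℝᵈ`-valued centered Gaussian noise, white in time, with i.i.d. components and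
spatial covariance `|x-y|^{-β}` (space-time white noise if `k = 1 = β`). -/
structure IsHomogeneousNoise {k d : ℕ} {Ω : Type*} [MeasurableSpace Ω] (β : ℝ)
    (N : Fin d → (ℝ × Space k → ℝ) → Ω → ℝ) (P : Measure Ω) : Prop where
  gaussian : IsGaussianProcess
    (fun (i : {φ : ℝ × Space k → ℝ // IsTestFunction φ} × Fin d) ω => N i.2 i.1 ω) P
  centered : ∀ φ, IsTestFunction φ → ∀ j, ∫ ω, N j φ ω ∂P = 0
  covariance : ∀ φ ψ, IsTestFunction φ → IsTestFunction ψ → ∀ j l,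
    ∫ ω, N j φ ω * N l ψ ω ∂P = if j = l then noiseCovariance k β φ ψ else 0

/-- The constant that relates the spectral density `|ξ|^{β-k}` to the covariance above under the
unnormalized Fourier transform: `(2π)^{k+1} / c`, where `c |ξ|^{β-k}` is the Fourier transform of
`|x|^{-β}`, and `(2π)²` in the white noise case `k = 1 = β`. -/
def spectralConstant (k : ℕ) (β : ℝ) : ℝ :=
  open Classical in
  if k = 1 ∧ β = 1 then (2 * Real.pi) ^ 2
  else (2 * Real.pi) ^ (k + 1) * Real.Gamma (β / 2) /
    (Real.pi ^ ((k : ℝ) / 2) * 2 ^ ((k : ℝ) - β) * Real.Gamma (((k : ℝ) - β) / 2))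

end

end StochasticWave

open StochasticWave

/-!
The proof compares everything on the Fourier side. Write `A φ (s, η)` for the Fourier transform of
`φ` in the space variable only (`spaceTransform`), and `G_{t,x}` for that of the wave kernel
`1_{(0,t]}(s) S(t-s, x-y)` (`kernelTransform`), which is `sin` of `(t-s)|ξ|` over `|ξ|` times a
character. The function `F(t,x,·)` is the Fourier transform in time of `G_{t,x}` almost everywhere
(`waveF_ae_eq`), and the space-time transform of `φ` is that of `A φ`. Plancherel in time, fibrewise
with the weight `|ξ|^{β-k}` (`eLpNorm_weight_mul_timeTransform`), therefore turns both the field and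
the noise `W̃` into isometric images of functions on `(s, η)`-space, in the weighted `L²` norm. There
`A φ` is square integrable for `β > 0` and `G_{t,x}` for `0 < β < 2`, because `G_{t,x}` decays like
`1/|η|`.

*The field is a mild solution.* It suffices to approximate `G_{t,x}` by `A φ` with real test
functions `φ`. The real-linear span of the `A φ` is dense in the Hermitian functions
(`exists_test_tendsto`): a function orthogonal to all of them vanishes
(`ae_eq_zero_of_forall_test`), since modulating a product test function in time and translating it
in space produces all the characters of space-time, and an integrable function is determined by its
Fourier transform. Convergence in the weighted norm implies convergence as tempered distributions,
by duality between the weights of the exponents `β` and `2k - β`, the point where `β ≤ k` enters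
(`tendsto_integral_truncatedKernel`).

*The real noise.* Its covariance is `c ∫_{s>0} ⟨A φ, A ψ⟩ |η|^{β-k}`
(`exists_hasSpectralCovariance`), by Parseval if `k = 1 = β`, and otherwise because the Fourier
transform of `|x|^{-β}` is a multiple of `|η|^{β-k}`, which is obtained by writing both powers as
superpositions of Gaussians (`integral_norm_rpow_mul_eq_integral_fourier`). Hence if the images of
`φ_n` under the noise converge, the functions `A φ_n` converge on positive times in the weighted
norm, and if moreover `φ_n` tends to the wave kernel as a distribution, the limit must be `G_{t,x}`
(`IsNoiseIntegral.exists_tendsto`). This determines the covariance of every mild solution.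

*Equality in law.* Both fields are limits in quadratic mean of centered Gaussian vectors, whose laws
are determined by their covariances (`IsCenteredGaussianLimit.identDistrib`). These are
`(2π)^{β+1} ⟨G, G'⟩` for the real part of `v` and `c ⟨G, G'⟩` for the solution `u` of the real system,
in the weighted inner product, and `κ c = (2π)^{β+1}`.
-/

namespace StochasticWave

noncomputable section

/-! ### Limits in quadratic mean of Gaussian vectors -/

/-- `L²` convergence of both factors gives convergence of the integrals of the inner products. -/
theorem tendsto_integral_inner_of_tendsto_eLpNorm {α E : Type*} (𝕜 : Type*) [RCLike 𝕜]
    [NormedAddCommGroup E] [InnerProductSpace 𝕜 E] [MeasurableSpace α]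
    {μ : Measure α} {f g : ℕ → α → E} {f' g' : α → E}
    (hf : ∀ n, MemLp (f n) 2 μ) (hg : ∀ n, MemLp (g n) 2 μ) (hf' : MemLp f' 2 μ)
    (hg' : MemLp g' 2 μ)
    (hff : Tendsto (fun n => eLpNorm (fun a => f n a - f' a) 2 μ) atTop (𝓝 0))
    (hgg : Tendsto (fun n => eLpNorm (fun a => g n a - g' a) 2 μ) atTop (𝓝 0)) :
    Tendsto (fun n => ∫ a, inner 𝕜 (f n a) (g n a) ∂μ) atTop
      (𝓝 (∫ a, inner 𝕜 (f' a) (g' a) ∂μ)) := by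
  have key : ∀ {u v : α → E} (hu : MemLp u 2 μ) (hv : MemLp v 2 μ),
      ∫ a, inner 𝕜 (u a) (v a) ∂μ = inner 𝕜 (hu.toLp u) (hv.toLp v) := by
    intro u v hu hv
    rw [L2.inner_def]
    refine integral_congr_ae ?_
    filter_upwards [hu.coeFn_toLp, hv.coeFn_toLp] with a h1 h2
    rw [h1, h2]
  simp only [fun n => key (hf n) (hg n), key hf' hg']
  exact ((Lp.tendsto_Lp_iff_tendsto_eLpNorm'' f hf f' hf').2 hff).inner
    ((Lp.tendsto_Lp_iff_tendsto_eLpNorm'' g hg g' hg').2 hgg)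

theorem integrable_inner_of_memLp {α E : Type*} (𝕜 : Type*) [RCLike 𝕜]
    [NormedAddCommGroup E] [InnerProductSpace 𝕜 E] [MeasurableSpace α]
    {μ : Measure α} {f g : α → E} (hf : MemLp f 2 μ) (hg : MemLp g 2 μ) :
    Integrable (fun a => inner 𝕜 (f a) (g a)) μ := by
  refine (L2.integrable_inner (𝕜 := 𝕜) (hf.toLp f) (hg.toLp g)).congr ?_
  filter_upwards [hf.coeFn_toLp, hg.coeFn_toLp] with a h1 h2
  rw [h1, h2]

/-- The random vector `X` is the limit in quadratic mean of centered Gaussian vectors. -/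
def IsCenteredGaussianLimit {ι Ω : Type*} [Fintype ι] [MeasurableSpace Ω] (X : ι → Ω → ℝ)
    (P : Measure Ω) : Prop :=
  (∀ i, MemLp (X i) 2 P) ∧ ∃ Y : ℕ → ι → Ω → ℝ,
    (∀ m, HasGaussianLaw (fun ω i => Y m i ω) P) ∧ (∀ m i, ∫ ω, Y m i ω ∂P = 0) ∧
    ∀ i, Tendsto (fun m => eLpNorm (fun ω => Y m i ω - X i ω) 2 P) atTop (𝓝 0)

theorem norm_exp_mul_I_sub_exp_mul_I_le (a b : ℝ) :
    ‖Complex.exp (a * Complex.I) - Complex.exp (b * Complex.I)‖ ≤ ‖a - b‖ := by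
  have h : Complex.exp (a * Complex.I) - Complex.exp (b * Complex.I) =
      Complex.exp (b * Complex.I) * (Complex.exp (Complex.I * (a - b : ℝ)) - 1) := by
    rw [mul_sub, ← Complex.exp_add, mul_one]
    congr 2
    push_cast
    ring
  rw [h, norm_mul, Complex.norm_exp_ofReal_mul_I, one_mul]
  exact Real.norm_exp_I_mul_ofReal_sub_one_le

/-- The characteristic function of a limit in quadratic mean of centered Gaussian variables. -/
theorem integral_exp_eq_of_tendsto_gaussian {Ω : Type*} [MeasurableSpace Ω] {P : Measure Ω}
    [IsProbabilityMeasure P] {Y : ℕ → Ω → ℝ} {X : Ω → ℝ} (hX : MemLp X 2 P)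
    (hY : ∀ m, HasGaussianLaw (Y m) P) (h0 : ∀ m, ∫ ω, Y m ω ∂P = 0)
    (h : Tendsto (fun m => eLpNorm (fun ω => Y m ω - X ω) 2 P) atTop (𝓝 0)) :
    ∫ ω, Complex.exp (X ω * Complex.I) ∂P =
      Complex.exp (-((∫ ω, X ω * X ω ∂P : ℝ) : ℂ) / 2) := by
  have hYm : ∀ m, MemLp (Y m) 2 P := fun m => (hY m).memLp_two
  have h1 : ∀ m, ∫ ω, Complex.exp (Y m ω * Complex.I) ∂P =
      Complex.exp (-((∫ ω, Y m ω * Y m ω ∂P : ℝ) : ℂ) / 2) := by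
    intro m
    have := (hY m).charFun_map_eq (1 : ℝ)
    rw [charFun_apply, integral_map (hY m).aemeasurable (by fun_prop)] at this
    have e : ∀ ω, inner ℝ (1 : ℝ) (Y m ω) = Y m ω := fun ω => by simp
    have e' : ∀ ω, inner ℝ (Y m ω) (1 : ℝ) = Y m ω := fun ω => by simp
    simp only [e, e', h0] at this
    rw [this, variance_of_integral_eq_zero (hY m).aemeasurable (h0 m)]
    simp [pow_two, neg_div]
  have h2 : Tendsto (fun m => ∫ ω, Y m ω * Y m ω ∂P) atTop (𝓝 (∫ ω, X ω * X ω ∂P)) := by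
    simpa [pow_two] using
      tendsto_integral_inner_of_tendsto_eLpNorm ℝ hYm hYm hX hX h h
  have h3 : Tendsto (fun m => Complex.exp (-((∫ ω, Y m ω * Y m ω ∂P : ℝ) : ℂ) / 2)) atTop
      (𝓝 (Complex.exp (-((∫ ω, X ω * X ω ∂P : ℝ) : ℂ) / 2))) := by
    have hc : Continuous fun r : ℝ => Complex.exp (-(r : ℂ) / 2) := by fun_prop
    exact (hc.tendsto _).comp h2
  have hb : ∀ Z : Ω → ℝ, AEStronglyMeasurable Z P →
      Integrable (fun ω => Complex.exp (Z ω * Complex.I)) P := fun Z hZ => by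
    refine Integrable.of_bound (C := 1) ?_ (Eventually.of_forall fun ω => ?_)
    · have hc : Continuous fun r : ℝ => Complex.exp (r * Complex.I) := by fun_prop
      exact hc.comp_aestronglyMeasurable hZ
    · rw [Complex.norm_exp_ofReal_mul_I]
  have h4 : Tendsto (fun m => ∫ ω, Complex.exp (Y m ω * Complex.I) ∂P) atTop
      (𝓝 (∫ ω, Complex.exp (X ω * Complex.I) ∂P)) := by
    refine tendsto_integral_of_L1 _ (hb _ hX.1).1 (Eventually.of_forall fun m => hb _ (hYm m).1) ?_
    refine tendsto_of_tendsto_of_tendsto_of_le_of_le tendsto_const_nhds h (fun _ => zero_le)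
      fun m => ?_
    calc _ ≤ ∫⁻ ω, ‖Y m ω - X ω‖ₑ ∂P := lintegral_mono fun ω => by
          rw [← ofReal_norm, ← ofReal_norm]
          exact ENNReal.ofReal_le_ofReal (norm_exp_mul_I_sub_exp_mul_I_le _ _)
      _ = eLpNorm (fun ω => Y m ω - X ω) 1 P := by rw [eLpNorm_one_eq_lintegral_enorm]
      _ ≤ _ := eLpNorm_le_eLpNorm_of_exponent_le (by norm_num) ((hYm m).1.sub hX.1)
  exact tendsto_nhds_unique h4 (by simpa only [h1] using h3)

theorem tendsto_eLpNorm_sum_const_mul {ι Ω : Type*} [Fintype ι] [MeasurableSpace Ω]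
    {P : Measure Ω} {Y : ℕ → ι → Ω → ℝ} {X : ι → Ω → ℝ} (hX : ∀ i, MemLp (X i) 2 P)
    (hY : ∀ m i, MemLp (Y m i) 2 P) (a : ι → ℝ)
    (h : ∀ i, Tendsto (fun m => eLpNorm (fun ω => Y m i ω - X i ω) 2 P) atTop (𝓝 0)) :
    Tendsto (fun m => eLpNorm (fun ω => (∑ i, a i * Y m i ω) - ∑ i, a i * X i ω) 2 P) atTop
      (𝓝 0) := by
  have hlim : Tendsto (fun m => ∑ i, ‖a i‖ₑ * eLpNorm (fun ω => Y m i ω - X i ω) 2 P) atTop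
      (𝓝 0) := by
    have := tendsto_finsetSum Finset.univ fun i _ =>
      ENNReal.Tendsto.const_mul (a := ‖a i‖ₑ) (h i) (Or.inr enorm_ne_top)
    simpa using this
  refine tendsto_of_tendsto_of_tendsto_of_le_of_le tendsto_const_nhds hlim (fun _ => zero_le)
    fun m => ?_
  have e : (fun ω => (∑ i, a i * Y m i ω) - ∑ i, a i * X i ω) =
      ∑ i, a i • fun ω => (Y m i ω - X i ω) := by
    ext ω
    simp [Finset.sum_apply, mul_sub]
  simp only [e]
  refine (eLpNorm_sum_le (fun i _ => ((hY m i).1.sub (hX i).1).const_smul (a i))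
    (by norm_num)).trans ?_
  exact Finset.sum_le_sum fun i _ => (eLpNorm_const_smul _ _ _ _).le

/-- The characteristic function of a limit of centered Gaussian vectors depends only on its second
moments. -/
theorem IsCenteredGaussianLimit.charFunDual_map {ι Ω : Type*} [Fintype ι] [DecidableEq ι]
    [MeasurableSpace Ω] {P : Measure Ω} [IsProbabilityMeasure P] {X : ι → Ω → ℝ}
    (h : IsCenteredGaussianLimit X P) (L : StrongDual ℝ (ι → ℝ)) :
    charFunDual (P.map fun ω i => X i ω) L =
      Complex.exp (-((∑ i, ∑ j, L (Pi.single i 1) * L (Pi.single j 1) *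
        ∫ ω, X i ω * X j ω ∂P : ℝ) : ℂ) / 2) := by
  obtain ⟨hX, Y, hY, hY0, hYX⟩ := h
  have hL : ∀ x : ι → ℝ, L x = ∑ i, L (Pi.single i 1) * x i := fun x => by
    conv_lhs => rw [← Finset.univ_sum_single x, map_sum]
    refine Finset.sum_congr rfl fun i _ => ?_
    have : (Pi.single i (x i) : ι → ℝ) = x i • Pi.single i 1 := by
      rw [← Pi.single_smul]; simp
    rw [this, map_smul, smul_eq_mul, mul_comm]
  have hYm : ∀ m i, MemLp (Y m i) 2 P := fun m i => ((hY m).eval i).memLp_two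
  rw [charFunDual_apply, integral_map
    (aemeasurable_pi_lambda _ fun i => (hX i).1.aemeasurable) (by fun_prop)]
  simp only [fun ω => hL (fun i => X i ω)]
  rw [integral_exp_eq_of_tendsto_gaussian (Y := fun m ω => ∑ i, L (Pi.single i 1) * Y m i ω)]
  · congr 4
    simp only [Finset.sum_mul_sum]
    have hint : ∀ i j, Integrable (fun ω => L (Pi.single i 1) * X i ω *
        (L (Pi.single j 1) * X j ω)) P := fun i j =>
      ((hX i).const_mul _).integrable_mul ((hX j).const_mul _)
    rw [integral_finsetSum _ fun i _ => integrable_finsetSum _ fun j _ => hint i j]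
    · refine Finset.sum_congr rfl fun i _ => ?_
      rw [integral_finsetSum _ fun j _ => hint i j]
      · refine Finset.sum_congr rfl fun j _ => ?_
        rw [← integral_const_mul]
        congr 1; ext ω; ring
  · exact memLp_finsetSum _ fun i _ => (hX i).const_mul _
  · intro m
    have := (hY m).map_fun L
    simpa only [fun ω => hL (fun i => Y m i ω)] using this
  · intro m
    rw [integral_finsetSum _ fun i _ =>
      ((hYm m i).integrable (by norm_num)).const_mul _]
    simp [integral_const_mul, hY0]
  · exact tendsto_eLpNorm_sum_const_mul hX hYm _ hYX

/-- Limits of centered Gaussian vectors with the same second moments have the same law. -/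
theorem IsCenteredGaussianLimit.identDistrib {ι Ω Ω' : Type*} [Fintype ι]
    [MeasurableSpace Ω] [MeasurableSpace Ω'] {P : Measure Ω} {P' : Measure Ω'}
    [IsProbabilityMeasure P] [IsProbabilityMeasure P'] {X : ι → Ω → ℝ} {X' : ι → Ω' → ℝ}
    (h : IsCenteredGaussianLimit X P) (h' : IsCenteredGaussianLimit X' P')
    (hc : ∀ i j, ∫ ω, X i ω * X j ω ∂P = ∫ ω, X' i ω * X' j ω ∂P') :
    IdentDistrib (fun ω i => X i ω) (fun ω i => X' i ω) P P' := by
  classical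
  refine ⟨aemeasurable_pi_lambda _ fun i => (h.1 i).1.aemeasurable,
    aemeasurable_pi_lambda _ fun i => (h'.1 i).1.aemeasurable, ?_⟩
  have := Measure.isProbabilityMeasure_map (μ := P)
    (aemeasurable_pi_lambda _ fun i => (h.1 i).1.aemeasurable)
  have := Measure.isProbabilityMeasure_map (μ := P')
    (aemeasurable_pi_lambda _ fun i => (h'.1 i).1.aemeasurable)
  refine Measure.ext_of_charFunDual ?_
  ext L
  rw [h.charFunDual_map, h'.charFunDual_map]
  simp only [hc]

/-! ### Sequences in `L²` -/

/-- If the increments of `f` are dominated by those of an `L²`-convergent sequence `g`, then `f`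
converges in `L²`. -/
theorem exists_tendsto_eLpNorm_of_dominated {α β E F : Type*} [NormedAddCommGroup E]
    [CompleteSpace E] [NormedAddCommGroup F] [MeasurableSpace α] [MeasurableSpace β]
    {μ : Measure α} {ν : Measure β} {f : ℕ → α → E} {g : ℕ → β → F} {g' : β → F}
    (hf : ∀ n, MemLp (f n) 2 μ) (hg : ∀ n, MemLp (g n) 2 ν) (hg' : MemLp g' 2 ν)
    (h : Tendsto (fun n => eLpNorm (fun b => g n b - g' b) 2 ν) atTop (𝓝 0)) (C : ℝ≥0)
    (hfg : ∀ n m, eLpNorm (fun a => f n a - f m a) 2 μ ≤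
      C * eLpNorm (fun b => g n b - g m b) 2 ν) :
    ∃ f' : α → E, MemLp f' 2 μ ∧
      Tendsto (fun n => eLpNorm (fun a => f n a - f' a) 2 μ) atTop (𝓝 0) := by
  have hG : CauchySeq fun n => (hg n).toLp (g n) :=
    ((Lp.tendsto_Lp_iff_tendsto_eLpNorm'' g hg g' hg').2 h).cauchySeq
  have hF : CauchySeq fun n => (hf n).toLp (f n) := by
    rw [EMetric.cauchySeq_iff] at hG ⊢
    intro ε hε
    obtain ⟨N, hN⟩ := hG (ε / (C + 1)) (ENNReal.div_pos hε.ne' (by finiteness))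
    refine ⟨N, fun m hm n hn => ?_⟩
    have h1 := hN m hm n hn
    rw [Lp.edist_toLp_toLp] at h1 ⊢
    rw [ENNReal.lt_div_iff_mul_lt (Or.inl (by positivity)) (Or.inl (by finiteness))] at h1
    refine lt_of_le_of_lt ((hfg m n).trans ?_) h1
    rw [mul_comm]
    exact mul_le_mul_right (by simp) _
  obtain ⟨L, hL⟩ := cauchySeq_tendsto_of_complete hF
  refine ⟨L, Lp.memLp L, ?_⟩
  refine (Lp.tendsto_Lp_iff_tendsto_eLpNorm'' f hf L (Lp.memLp L)).1 ?_
  rwa [Lp.toLp_coeFn]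

theorem exists_simpleFunc_tendsto_eLpNorm {α E : Type*} [NormedAddCommGroup E] [MeasurableSpace α]
    {μ : Measure α} {f : α → E} (hf : MemLp f 2 μ) :
    ∃ g : ℕ → SimpleFunc α E, (∀ n, MemLp (g n) 2 μ) ∧
      Tendsto (fun n => eLpNorm (fun a => g n a - f a) 2 μ) atTop (𝓝 0) := by
  have : ∀ n : ℕ, ∃ g : SimpleFunc α E, eLpNorm (f - ⇑g) 2 μ < ((n : ℝ≥0∞) + 1)⁻¹ ∧ MemLp g 2 μ :=
    fun n => hf.exists_simpleFunc_eLpNorm_sub_lt (by norm_num) (by simp)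
  choose g hg hg' using this
  refine ⟨g, hg', ?_⟩
  have h0 : Tendsto (fun n : ℕ => ((n : ℝ≥0∞) + 1)⁻¹) atTop (𝓝 0) := by
    have := (ENNReal.tendsto_inv_nat_nhds_zero).comp (tendsto_add_atTop_nat 1)
    refine this.congr fun n => by simp
  refine tendsto_of_tendsto_of_tendsto_of_le_of_le tendsto_const_nhds h0 (fun _ => zero_le)
    fun n => ?_
  have := (hg n).le
  rwa [eLpNorm_sub_comm] at this

theorem eLpNorm_two_sq_eq {α E : Type*} [NormedAddCommGroup E] [MeasurableSpace α]
    {μ : Measure α} {f : α → E} (hf : MemLp f 2 μ) :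
    eLpNorm f 2 μ ^ 2 = ENNReal.ofReal (∫ a, ‖f a‖ ^ 2 ∂μ) := by
  rw [← ENNReal.toReal_eq_toReal_iff' (by have := hf.2; finiteness) ENNReal.ofReal_ne_top,
    ENNReal.toReal_pow, ENNReal.toReal_ofReal (integral_nonneg fun _ => by positivity),
    hf.eLpNorm_eq_integral_rpow_norm (by norm_num) (by simp),
    ENNReal.toReal_ofReal (by positivity), ← Real.rpow_natCast, ← Real.rpow_mul
      (integral_nonneg fun _ => by positivity)]
  simp

theorem eLpNorm_sub_le_add_add {α E : Type*} [NormedAddCommGroup E] [MeasurableSpace α]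
    {μ : Measure α} {a b c d : α → E} (ha : MemLp a 2 μ) (hb : MemLp b 2 μ) (hc : MemLp c 2 μ)
    (hd : MemLp d 2 μ) :
    eLpNorm (fun x => a x - d x) 2 μ ≤ eLpNorm (fun x => b x - a x) 2 μ +
      (eLpNorm (fun x => b x - c x) 2 μ + eLpNorm (fun x => c x - d x) 2 μ) := by
  have e : (fun x => a x - d x) =
      (fun x => -(b x - a x)) + ((fun x => b x - c x) + fun x => c x - d x) := by
    ext x; simp
  rw [e]
  refine (eLpNorm_add_le (hb.sub ha).neg.1 ((hb.sub hc).add (hc.sub hd)).1 (by norm_num)).trans ?_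
  gcongr
  · exact (eLpNorm_neg (fun x => b x - a x) 2 μ).le
  · exact eLpNorm_add_le (hb.sub hc).1 (hc.sub hd).1 (by norm_num)

theorem tendsto_eLpNorm_re {Ω : Type*} [MeasurableSpace Ω] {P : Measure Ω} {f : ℕ → Ω → ℂ}
    {g : Ω → ℂ} (h : Tendsto (fun n => eLpNorm (fun ω => f n ω - g ω) 2 P) atTop (𝓝 0)) :
    Tendsto (fun n => eLpNorm (fun ω => (f n ω).re - (g ω).re) 2 P) atTop (𝓝 0) := by
  refine tendsto_of_tendsto_of_tendsto_of_le_of_le tendsto_const_nhds h (fun _ => zero_le)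
    fun n => eLpNorm_mono fun ω => ?_
  rw [← Complex.sub_re, Real.norm_eq_abs]
  exact Complex.abs_re_le_norm _

/-! ### Integrals of step functions against a complex white noise -/

/-- The coefficient of `part b w` in `Re (z w)`. -/
def partCoeff (z : ℂ) (b : Bool) : ℝ := if b then z.re else -z.im

theorem re_mul_eq_sum_part (z w : ℂ) : (z * w).re = ∑ b, partCoeff z b * part b w := by
  simp [partCoeff, part, sub_eq_add_neg]

/-- Finitely many finite linear combinations of the values of a Gaussian process form a Gaussian
vector. -/
theorem hasGaussianLaw_linear_combination {T Ω ι : Type*} [MeasurableSpace Ω] {P : Measure Ω}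
    {X : T → Ω → ℝ} (hX : IsGaussianProcess X P) [Fintype ι] {κ : ι → Type*}
    [∀ i, Fintype (κ i)] (a : ∀ i, κ i → ℝ) (τ : ∀ i, κ i → T) :
    HasGaussianLaw (fun ω i => ∑ s, a i s * X (τ i s) ω) P := by
  classical
  have h : IsGaussianProcess (fun i ω => ∑ s, a i s * X (τ i s) ω) P := by
    refine hX.of_isGaussianProcess fun i => ⟨Finset.univ.image (τ i),
      ∑ s, a i s • ContinuousLinearMap.proj ⟨τ i s, by simp⟩, fun ω => ?_⟩
    simp [Finset.restrict_def]
  have h2 := h.hasGaussianLaw Finset.univ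
  exact h2.map_fun (ContinuousLinearMap.pi fun i : ι =>
    ContinuousLinearMap.proj (R := ℝ) (φ := fun _ : (Finset.univ : Finset ι) => ℝ)
      ⟨i, Finset.mem_univ i⟩)

/-- The step function `∑ cᵢ 1_{Aᵢ}`. -/
def stepFun {k : ℕ} {ι : Type*} [Fintype ι] (c : ι → ℂ) (A : ι → FiniteBorel k)
    (p : ℝ × Space k) : ℂ :=
  ∑ i, (A i : Set (ℝ × Space k)).indicator (fun _ => c i) p

/-- The integral `∑ cᵢ W(Aᵢ)` of the step function `∑ cᵢ 1_{Aᵢ}`. -/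
def stepIntegral {k : ℕ} {Ω ι : Type*} [Fintype ι] (W : Set (ℝ × Space k) → Ω → ℂ) (c : ι → ℂ)
    (A : ι → FiniteBorel k) (ω : Ω) : ℂ :=
  ∑ i, c i * W (A i) ω

/-- A square integrable simple function is a step function over Borel sets of finite measure, with
the same integral: the fibre of `0`, which may have infinite measure, is replaced by `∅`. -/
theorem exists_stepFun_eq {k : ℕ} (Ω : Type*) (f : SimpleFunc (ℝ × Space k) ℂ)
    (hf : MemLp f 2 volume) :
    ∃ (c : f.range → ℂ) (A : f.range → FiniteBorel k), (∀ p, f p = stepFun c A p) ∧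
      ∀ (W : Set (ℝ × Space k) → Ω → ℂ) (ω : Ω),
        simpleIntegral W f ω = stepIntegral W c A ω := by
  classical
  have hfin : ∀ z : ℂ, z ≠ 0 → volume (f ⁻¹' {z}) ≠ ∞ := fun z hz =>
    (SimpleFunc.measure_preimage_lt_top_of_memLp (by norm_num) (by simp) f hf z hz).ne
  let A : f.range → FiniteBorel k := fun z =>
    if hz : (z : ℂ) = 0 then ⟨∅, MeasurableSet.empty, by simp⟩
    else ⟨f ⁻¹' {(z : ℂ)}, f.measurableSet_fiber _, hfin _ hz⟩
  refine ⟨fun z => z, A, fun p => ?_, fun W ω => ?_⟩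
  · rw [stepFun, Finset.sum_eq_single ⟨f p, f.mem_range_self p⟩]
    · by_cases h : f p = 0
      · simp [A, h]
      · simp [A, h]
    · rintro ⟨z, hz⟩ _ hne
      by_cases h : z = 0
      · simp [A, h]
      · have : f p ≠ z := fun e => hne (Subtype.ext e.symm)
        simp [A, h, this]
    · simp
  · rw [simpleIntegral, stepIntegral, ← Finset.sum_coe_sort f.range]
    refine Finset.sum_congr rfl fun z _ => ?_
    by_cases h : (z : ℂ) = 0
    · simp [h]
    · simp [A, h]

theorem re_stepIntegral {k : ℕ} {Ω ι : Type*} [Fintype ι]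
    (W : Set (ℝ × Space k) → Ω → ℂ) (c : ι → ℂ) (A : ι → FiniteBorel k) (ω : Ω) :
    (stepIntegral W c A ω).re = ∑ s : ι × Bool, partCoeff (c s.1) s.2 * part s.2 (W (A s.1) ω) := by
  simp only [stepIntegral, Complex.re_sum, re_mul_eq_sum_part, Fintype.sum_prod_type]

section WhiteNoise

variable {k d : ℕ} {Ω : Type*} [MeasurableSpace Ω] {P : Measure Ω}
  {W : Fin d → Set (ℝ × Space k) → Ω → ℂ}

theorem IsComplexWhiteNoise.memLp_part (hW : IsComplexWhiteNoise W P) (j : Fin d)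
    (A : FiniteBorel k) (b : Bool) : MemLp (fun ω => part b (W j A ω)) 2 P :=
  (hW.gaussian.hasGaussianLaw_eval (A, j, b)).memLp_two

theorem IsComplexWhiteNoise.memLp (hW : IsComplexWhiteNoise W P) (j : Fin d)
    (A : FiniteBorel k) : MemLp (W j A) 2 P :=
  memLp_re_im_iff.1 ⟨by simpa [part] using hW.memLp_part j A true,
    by simpa [part] using hW.memLp_part j A false⟩

theorem IsComplexWhiteNoise.memLp_stepIntegral (hW : IsComplexWhiteNoise W P) (j : Fin d)
    {ι : Type*} [Fintype ι] (c : ι → ℂ) (A : ι → FiniteBorel k) :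
    MemLp (stepIntegral (W j) c A) 2 P :=
  memLp_finsetSum _ fun i _ => (hW.memLp j (A i)).const_mul (c i)

theorem memLp_stepFun {ι : Type*} [Fintype ι] (c : ι → ℂ) (A : ι → FiniteBorel k) :
    MemLp (stepFun c A) 2 volume :=
  memLp_finsetSum _ fun i _ => memLp_indicator_const 2 (A i).2.1 _ (Or.inr (A i).2.2)

theorem integral_inner_stepFun {ι κ : Type*} [Fintype ι] [Fintype κ] (c : ι → ℂ)
    (A : ι → FiniteBorel k) (c' : κ → ℂ) (A' : κ → FiniteBorel k) :
    ∫ p, inner ℝ (stepFun c A p) (stepFun c' A' p) = ∑ i, ∑ m, inner ℝ (c i) (c' m) *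
      (volume ((A i : Set (ℝ × Space k)) ∩ A' m)).toReal := by
  have hint : ∀ i m, Integrable (fun p => inner ℝ
      ((A i : Set (ℝ × Space k)).indicator (fun _ => c i) p)
      ((A' m : Set (ℝ × Space k)).indicator (fun _ => c' m) p)) volume := fun i m =>
    integrable_inner_of_memLp ℝ (memLp_indicator_const 2 (A i).2.1 _ (Or.inr (A i).2.2))
      (memLp_indicator_const 2 (A' m).2.1 _ (Or.inr (A' m).2.2))
  simp only [stepFun, sum_inner]
  simp only [inner_sum]
  rw [integral_finsetSum _ fun i _ => integrable_finsetSum _ fun m _ => hint i m]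
  refine Finset.sum_congr rfl fun i _ => ?_
  rw [integral_finsetSum _ fun m _ => hint i m]
  refine Finset.sum_congr rfl fun m _ => ?_
  have : (fun p => inner ℝ ((A i : Set (ℝ × Space k)).indicator (fun _ => c i) p)
      ((A' m : Set (ℝ × Space k)).indicator (fun _ => c' m) p)) =
      ((A i : Set (ℝ × Space k)) ∩ A' m).indicator fun _ => inner ℝ (c i) (c' m) := by
    ext p
    by_cases h1 : p ∈ (A i : Set (ℝ × Space k)) <;> by_cases h2 : p ∈ (A' m : Set (ℝ × Space k)) <;>
      simp [Set.indicator, h1, h2]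
  rw [this, integral_indicator ((A i).2.1.inter (A' m).2.1), setIntegral_const]
  simp [Measure.real, mul_comm]

theorem IsComplexWhiteNoise.integral_re_mul_re_stepIntegral (hW : IsComplexWhiteNoise W P)
    (j l : Fin d) {ι κ : Type*} [Fintype ι] [Fintype κ] (c : ι → ℂ)
    (A : ι → FiniteBorel k) (c' : κ → ℂ) (A' : κ → FiniteBorel k) :
    ∫ ω, (stepIntegral (W j) c A ω).re * (stepIntegral (W l) c' A' ω).re ∂P =
      if j = l then ∫ p, inner ℝ (stepFun c A p) (stepFun c' A' p) else 0 := by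
  simp only [re_stepIntegral, Finset.sum_mul_sum]
  have hint : ∀ (s : ι × Bool) (s' : κ × Bool), Integrable (fun ω =>
      partCoeff (c s.1) s.2 * part s.2 (W j (A s.1) ω) *
        (partCoeff (c' s'.1) s'.2 * part s'.2 (W l (A' s'.1) ω))) P := fun s s' =>
    ((hW.memLp_part j (A s.1) s.2).const_mul _).integrable_mul
      ((hW.memLp_part l (A' s'.1) s'.2).const_mul _)
  rw [integral_finsetSum _ fun i _ => integrable_finsetSum _ fun m _ => hint i m]
  simp only [integral_finsetSum _ fun m _ => hint _ m]
  have hterm : ∀ (s : ι × Bool) (s' : κ × Bool), ∫ ω,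
      partCoeff (c s.1) s.2 * part s.2 (W j (A s.1) ω) *
        (partCoeff (c' s'.1) s'.2 * part s'.2 (W l (A' s'.1) ω)) ∂P =
      partCoeff (c s.1) s.2 * partCoeff (c' s'.1) s'.2 *
        if j = l ∧ s.2 = s'.2 then
          (volume ((A s.1 : Set (ℝ × Space k)) ∩ A' s'.1)).toReal else 0 := by
    intro s s'
    rw [← hW.covariance (A s.1) (A' s'.1) j l s.2 s'.2, ← integral_const_mul]
    congr 1; ext ω; ring
  simp only [hterm]
  by_cases hjl : j = l
  · simp only [hjl, true_and, if_true, integral_inner_stepFun, Fintype.sum_prod_type]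
    refine Finset.sum_congr rfl fun i _ => ?_
    simp only [Fintype.sum_bool, partCoeff, Complex.inner]
    rw [← Finset.sum_add_distrib]
    refine Finset.sum_congr rfl fun m _ => ?_
    simp
    ring
  · simp [hjl]

/-- The isometry for step functions. It follows from the covariance of the real parts, applied to
`c` and to `-i c`, whose integral has the imaginary part of the original one as its real part. -/
theorem IsComplexWhiteNoise.eLpNorm_stepIntegral (hW : IsComplexWhiteNoise W P) (j : Fin d)
    {ι : Type*} [Fintype ι] (c : ι → ℂ) (A : ι → FiniteBorel k) :
    eLpNorm (stepIntegral (W j) c A) 2 P = NNReal.sqrt 2 * eLpNorm (stepFun c A) 2 volume := by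
  have hI : ∀ ω, stepIntegral (W j) (fun i => -Complex.I * c i) A ω =
      -Complex.I * stepIntegral (W j) c A ω := fun ω => by
    simp only [stepIntegral, Finset.mul_sum, mul_assoc]
  have hS : ∀ p, stepFun (fun i => -Complex.I * c i) A p = -Complex.I * stepFun c A p := fun p => by
    simp only [stepFun, Finset.mul_sum]
    refine Finset.sum_congr rfl fun i _ => ?_
    by_cases hp : p ∈ (A i : Set (ℝ × Space k)) <;> simp [hp]
  have h1 := hW.integral_re_mul_re_stepIntegral j j c A c A
  have h2 := hW.integral_re_mul_re_stepIntegral j j (fun i => -Complex.I * c i) A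
    (fun i => -Complex.I * c i) A
  simp only [hI, hS, if_true] at h1 h2
  have hX := hW.memLp_stepIntegral j c A
  have key : ∫ ω, ‖stepIntegral (W j) c A ω‖ ^ 2 ∂P = 2 * ∫ p, ‖stepFun c A p‖ ^ 2 := by
    have e1 : ∀ ω, ‖stepIntegral (W j) c A ω‖ ^ 2 =
        (stepIntegral (W j) c A ω).re * (stepIntegral (W j) c A ω).re +
        (-Complex.I * stepIntegral (W j) c A ω).re * (-Complex.I * stepIntegral (W j) c A ω).re :=
      fun ω => by
        rw [Complex.sq_norm, Complex.normSq_apply]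
        simp
    have e2 : ∀ z : ℂ, inner ℝ (-Complex.I * z) (-Complex.I * z) = ‖z‖ ^ 2 := fun z => by
      rw [real_inner_self_eq_norm_sq]; simp
    simp only [e1]
    rw [integral_add, h1, h2]
    · simp only [e2, real_inner_self_eq_norm_sq]; ring
    · exact hX.re.integrable_mul hX.re
    · exact (hX.const_mul _).re.integrable_mul (hX.const_mul _).re
  have h3 : eLpNorm (stepIntegral (W j) c A) 2 P ^ 2 =
      (NNReal.sqrt 2 * eLpNorm (stepFun c A) 2 volume) ^ 2 := by
    rw [mul_pow, eLpNorm_two_sq_eq hX, eLpNorm_two_sq_eq (memLp_stepFun c A), key,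
      ENNReal.ofReal_mul (by norm_num), ← ENNReal.coe_pow, NNReal.sq_sqrt]
    simp
  exact (ENNReal.pow_right_strictMono two_ne_zero).injective h3

theorem IsComplexWhiteNoise.eLpNorm_stepIntegral_sub (hW : IsComplexWhiteNoise W P) (j : Fin d)
    {ι κ : Type*} [Fintype ι] [Fintype κ] (c : ι → ℂ) (A : ι → FiniteBorel k)
    (c' : κ → ℂ) (A' : κ → FiniteBorel k) :
    eLpNorm (fun ω => stepIntegral (W j) c A ω - stepIntegral (W j) c' A' ω) 2 P =
      NNReal.sqrt 2 * eLpNorm (fun p => stepFun c A p - stepFun c' A' p) 2 volume := by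
  have h1 : (fun ω => stepIntegral (W j) c A ω - stepIntegral (W j) c' A' ω) =
      stepIntegral (W j) (Sum.elim c fun i => -c' i) (Sum.elim A A') := by
    ext ω
    simp [stepIntegral, sub_eq_add_neg]
  have h2 : (fun p => stepFun c A p - stepFun c' A' p) =
      stepFun (Sum.elim c fun i => -c' i) (Sum.elim A A') := by
    ext p
    simp only [stepFun, sub_eq_add_neg, ← Finset.sum_neg_distrib, Fintype.sum_sum_type,
      Sum.elim_inl, Sum.elim_inr]
    congr 1
    refine Finset.sum_congr rfl fun i _ => ?_
    by_cases hp : p ∈ (A' i : Set (ℝ × Space k)) <;> simp [hp]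
  rw [h1, h2, hW.eLpNorm_stepIntegral]

/-! ### The Wiener integral -/

theorem IsComplexWhiteNoise.memLp_simpleIntegral (hW : IsComplexWhiteNoise W P) (j : Fin d)
    (f : SimpleFunc (ℝ × Space k) ℂ) (hf : MemLp f 2 volume) :
    MemLp (simpleIntegral (W j) f) 2 P := by
  obtain ⟨c, A, -, h⟩ := exists_stepFun_eq Ω f hf
  exact (funext (h (W j)) : simpleIntegral (W j) f = _) ▸ hW.memLp_stepIntegral j c A

theorem IsComplexWhiteNoise.eLpNorm_simpleIntegral_sub (hW : IsComplexWhiteNoise W P) (j : Fin d)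
    {f g : SimpleFunc (ℝ × Space k) ℂ} (hf : MemLp f 2 volume) (hg : MemLp g 2 volume) :
    eLpNorm (fun ω => simpleIntegral (W j) f ω - simpleIntegral (W j) g ω) 2 P =
      NNReal.sqrt 2 * eLpNorm (fun p => f p - g p) 2 volume := by
  obtain ⟨c, A, h1, h2⟩ := exists_stepFun_eq Ω f hf
  obtain ⟨c', A', h1', h2'⟩ := exists_stepFun_eq Ω g hg
  simp only [h1, h2, h1', h2']
  exact hW.eLpNorm_stepIntegral_sub j c A c' A'

theorem IsComplexWhiteNoise.exists_isWienerIntegral (hW : IsComplexWhiteNoise W P) (j : Fin d)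
    {h : ℝ × Space k → ℂ} (hh : MemLp h 2 volume) : ∃ X, IsWienerIntegral (W j) P h X := by
  obtain ⟨f, hf, hfh⟩ := exists_simpleFunc_tendsto_eLpNorm hh
  obtain ⟨X, hX, hXl⟩ := exists_tendsto_eLpNorm_of_dominated (μ := P)
    (fun n => hW.memLp_simpleIntegral j (f n) (hf n)) hf hh hfh (NNReal.sqrt 2)
    fun n m => (hW.eLpNorm_simpleIntegral_sub j (hf n) (hf m)).le
  exact ⟨X, hh, hX, f, hf, hfh, hXl⟩

theorem IsComplexWhiteNoise.isWienerIntegral_wienerIntegral (hW : IsComplexWhiteNoise W P)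
    (j : Fin d) {h : ℝ × Space k → ℂ} (hh : MemLp h 2 volume) :
    IsWienerIntegral (W j) P h (wienerIntegral (W j) P h) := by
  have H := hW.exists_isWienerIntegral j hh
  rw [wienerIntegral, dif_pos H]
  exact H.choose_spec

/-- The Wiener integral is Lipschitz in the integrand. With `h = h'` this says that it does not
depend on the approximating sequence, up to a null set. -/
theorem IsComplexWhiteNoise.eLpNorm_sub_le (hW : IsComplexWhiteNoise W P) (j : Fin d)
    {h h' : ℝ × Space k → ℂ} {X X' : Ω → ℂ} (hX : IsWienerIntegral (W j) P h X)
    (hX' : IsWienerIntegral (W j) P h' X') :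
    eLpNorm (fun ω => X ω - X' ω) 2 P ≤
      NNReal.sqrt 2 * eLpNorm (fun p => h p - h' p) 2 volume := by
  obtain ⟨hh, hX2, f, hf, hfh, hfX⟩ := hX
  obtain ⟨hh', hX2', g, hg, hgh, hgX⟩ := hX'
  have b : ∀ n, eLpNorm (fun ω => X ω - X' ω) 2 P ≤
      eLpNorm (fun ω => simpleIntegral (W j) (f n) ω - X ω) 2 P +
      (NNReal.sqrt 2 * (eLpNorm (fun p => f n p - h p) 2 volume +
        (eLpNorm (fun p => g n p - h' p) 2 volume + eLpNorm (fun p => h p - h' p) 2 volume)) +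
      eLpNorm (fun ω => simpleIntegral (W j) (g n) ω - X' ω) 2 P) := by
    intro n
    refine (eLpNorm_sub_le_add_add hX2 (hW.memLp_simpleIntegral j _ (hf n))
      (hW.memLp_simpleIntegral j _ (hg n)) hX2').trans ?_
    gcongr
    rw [hW.eLpNorm_simpleIntegral_sub j (hf n) (hg n)]
    gcongr
    refine (eLpNorm_sub_le_add_add (hf n) hh hh' (hg n)).trans ?_
    have s1 := eLpNorm_sub_comm h (f n) 2 volume
    have s2 := eLpNorm_sub_comm h' (g n) 2 volume
    simp only [Pi.sub_def] at s1 s2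
    rw [s1, s2]
    exact le_of_eq (by ring)
  refine ge_of_tendsto' (x := (atTop : Filter ℕ)) ?_ b
  have := hfX.add (((ENNReal.Tendsto.const_mul (a := (NNReal.sqrt 2 : ℝ≥0∞)) (hfh.add
    (hgh.add (tendsto_const_nhds (x := eLpNorm (fun p => h p - h' p) 2 volume))))
    (Or.inr ENNReal.coe_ne_top))).add hgX)
  simpa using this

/-- The covariance of the real parts of two Wiener integrals. -/
theorem IsComplexWhiteNoise.integral_re_mul_re (hW : IsComplexWhiteNoise W P) (j l : Fin d)
    {h h' : ℝ × Space k → ℂ} {X X' : Ω → ℂ} (hX : IsWienerIntegral (W j) P h X)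
    (hX' : IsWienerIntegral (W l) P h' X') :
    ∫ ω, (X ω).re * (X' ω).re ∂P = if j = l then ∫ p, inner ℝ (h p) (h' p) else 0 := by
  obtain ⟨hh, hX2, f, hf, hfh, hfX⟩ := hX
  obtain ⟨hh', hX2', g, hg, hgh, hgX⟩ := hX'
  have h1 := tendsto_integral_inner_of_tendsto_eLpNorm ℝ
    (fun n => (hW.memLp_simpleIntegral j _ (hf n)).re)
    (fun n => (hW.memLp_simpleIntegral l _ (hg n)).re) hX2.re hX2'.re
    (tendsto_eLpNorm_re hfX) (tendsto_eLpNorm_re hgX)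
  have h2 := tendsto_integral_inner_of_tendsto_eLpNorm ℝ hf hg hh hh' hfh hgh
  have h3 : ∀ n, ∫ ω, inner ℝ (RCLike.re (simpleIntegral (W j) (f n) ω))
      (RCLike.re (simpleIntegral (W l) (g n) ω)) ∂P =
        if j = l then ∫ p, inner ℝ (f n p) (g n p) else 0 := by
    intro n
    obtain ⟨c, A, h1, h2⟩ := exists_stepFun_eq Ω (f n) (hf n)
    obtain ⟨c', A', h1', h2'⟩ := exists_stepFun_eq Ω (g n) (hg n)
    simp only [h1, h2, h1', h2']
    rw [← hW.integral_re_mul_re_stepIntegral j l c A c' A']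
    simp [mul_comm]
  simp only [h3] at h1
  have h4 : Tendsto (fun n => if j = l then ∫ p, inner ℝ (f n p) (g n p) else 0) atTop
      (𝓝 (if j = l then ∫ p, inner ℝ (h p) (h' p) else 0)) := by
    split_ifs
    · exact h2
    · exact tendsto_const_nhds
  rw [← tendsto_nhds_unique h1 h4]
  simp [mul_comm]

/-- The real parts of finitely many Wiener integrals form a limit of centered Gaussian vectors. -/
theorem IsComplexWhiteNoise.isCenteredGaussianLimit_re [IsProbabilityMeasure P]
    (hW : IsComplexWhiteNoise W P)
    {ι : Type*} [Fintype ι] (j : ι → Fin d) {h : ι → ℝ × Space k → ℂ} {X : ι → Ω → ℂ}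
    (hX : ∀ i, IsWienerIntegral (W (j i)) P (h i) (X i)) :
    IsCenteredGaussianLimit (fun i ω => (X i ω).re) P := by
  choose hh hX2 f hf hfh hfX using hX
  refine ⟨fun i => (hX2 i).re, fun m i ω => (simpleIntegral (W (j i)) (f i m) ω).re, fun m => ?_,
    fun m i => ?_, fun i => tendsto_eLpNorm_re (hfX i)⟩
  · choose c A h1 h2 using fun i => exists_stepFun_eq Ω (f i m) (hf i m)
    simp only [h2, re_stepIntegral]
    exact hasGaussianLaw_linear_combination hW.gaussian (κ := fun i => (f i m).range × Bool)
      (fun i s => partCoeff (c i s.1) s.2) (fun i s => (A i s.1, j i, s.2))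
  · obtain ⟨c, A, h1, h2⟩ := exists_stepFun_eq Ω (f i m) (hf i m)
    simp only [h2, re_stepIntegral]
    rw [integral_finsetSum _ fun s _ =>
      ((hW.memLp_part (j i) (A s.1) s.2).integrable (by norm_num)).const_mul _]
    simp [integral_const_mul, hW.centered]

end WhiteNoise

/-! ### Fourier transforms of integrable functions -/

section Fourier

variable {V : Type*} [NormedAddCommGroup V] [InnerProductSpace ℝ V] [FiniteDimensional ℝ V]
  [MeasurableSpace V] [BorelSpace V]

theorem continuous_fourier_of_integrable {f : V → ℂ} (hf : Integrable f) : Continuous (𝓕 f) :=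
  VectorFourier.fourierIntegral_continuous Real.continuous_fourierChar
    (innerSL ℝ).continuous₂ hf

theorem integral_fourier_mul_eq_of_integrable {f g : V → ℂ} (hf : Integrable f)
    (hg : Integrable g) : ∫ ξ, 𝓕 f ξ * g ξ = ∫ x, f x * 𝓕 g x := by
  simpa using! VectorFourier.integral_fourierIntegral_smul_eq_flip (L := innerₗ V)
    Real.continuous_fourierChar continuous_inner hf hg

/-- On `L¹ ∩ L²` the Fourier integral agrees with the `L²` Fourier transform. -/
theorem coeFn_fourier_toLp_ae_eq {f : V → ℂ} (hf : Integrable f) (hf2 : MemLp f 2) :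
    (𝓕 (hf2.toLp f) : Lp ℂ 2 (volume : Measure V)) =ᵐ[volume] 𝓕 f := by
  refine ae_eq_of_integral_contDiff_smul_eq
    ((Lp.memLp _).locallyIntegrable (by norm_num))
    (continuous_fourier_of_integrable hf).locallyIntegrable fun g hg hgc => ?_
  have hg₁ : HasCompactSupport (Complex.ofRealCLM ∘ g) := hgc.comp_left rfl
  have hg₂ : ContDiff ℝ ((⊤ : ℕ∞) : WithTop ℕ∞) (Complex.ofRealCLM ∘ g) := by fun_prop
  set G : 𝓢(V, ℂ) := hg₁.toSchwartzMap hg₂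
  have h1 := congrArg (fun T => T G) (Lp.fourier_toTemperedDistribution_eq (hf2.toLp f))
  simp only [TemperedDistribution.fourier_apply, Lp.toTemperedDistribution_apply] at h1
  calc _ = ∫ x, G x • (𝓕 (hf2.toLp f) : Lp ℂ 2 (volume : Measure V)) x := by simp [G]
    _ = ∫ x, 𝓕 G x • hf2.toLp f x := h1.symm
    _ = ∫ x, 𝓕 (G : V → ℂ) x * f x := by
      refine integral_congr_ae ?_
      filter_upwards [hf2.coeFn_toLp] with x hx
      rw [hx, SchwartzMap.fourier_coe, smul_eq_mul]
    _ = ∫ x, G x * 𝓕 f x := integral_fourier_mul_eq_of_integrable G.integrable hf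
    _ = _ := by simp [G]

/-- Plancherel's theorem for the Fourier integral on `L¹ ∩ L²`. -/
theorem eLpNorm_fourier_eq_of_integrable {f : V → ℂ} (hf : Integrable f) (hf2 : MemLp f 2) :
    eLpNorm (𝓕 f) 2 = eLpNorm f 2 := by
  rw [← eLpNorm_congr_ae (coeFn_fourier_toLp_ae_eq hf hf2), ← Lp.enorm_def,
    ← eLpNorm_congr_ae hf2.coeFn_toLp, ← Lp.enorm_def, ← ofReal_norm, ← ofReal_norm,
    Lp.norm_fourier_eq]

/-- Parseval's formula for the Fourier integral on `L¹ ∩ L²`. -/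
theorem integral_inner_fourier_eq_of_integrable {f g : V → ℂ} (hf : Integrable f)
    (hf2 : MemLp f 2) (hg : Integrable g) (hg2 : MemLp g 2) :
    ∫ ξ, inner ℂ (𝓕 f ξ) (𝓕 g ξ) = ∫ x, inner ℂ (f x) (g x) := by
  have h := Lp.inner_fourier_eq (hf2.toLp f) (hg2.toLp g)
  rw [L2.inner_def, L2.inner_def] at h
  convert h using 1
  · refine integral_congr_ae ?_
    filter_upwards [coeFn_fourier_toLp_ae_eq hf hf2, coeFn_fourier_toLp_ae_eq hg hg2] with x h1 h2
    rw [h1, h2]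
  · refine integral_congr_ae ?_
    filter_upwards [hf2.coeFn_toLp, hg2.coeFn_toLp] with x h1 h2
    rw [h1, h2]

end Fourier

/-! ### Injectivity of the Fourier transform of integrable functions -/

section Injectivity

variable {V : Type*} [NormedAddCommGroup V] [NormedSpace ℝ V] [CompleteSpace V]
  [SecondCountableTopology V] [MeasurableSpace V] [BorelSpace V] {μ : Measure V}

/-- The real case: the finite measures with the positive and the negative part of `g` as densities
have the same characteristic function. -/
theorem ae_eq_zero_of_forall_integral_mul_exp_real {g : V → ℝ} (hg : Integrable g μ)
    (h : ∀ L : StrongDual ℝ V, ∫ v, (g v : ℂ) * Complex.exp (L v * Complex.I) ∂μ = 0) :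
    g =ᵐ[μ] 0 := by
  have hfin : ∀ {u : V → ℝ}, Integrable u μ →
      IsFiniteMeasure (μ.withDensity fun v => ENNReal.ofReal (u v)) := fun {u} hu =>
    isFiniteMeasure_withDensity_ofReal hu.2
  have hneg : Integrable (fun v => -g v) μ := hg.neg
  have hP := hfin hg
  have hP' := hfin hneg
  have hexp : ∀ L : StrongDual ℝ V, Continuous fun v => Complex.exp (L v * Complex.I) :=
    fun L => by fun_prop
  have hint : ∀ (L : StrongDual ℝ V) {u : V → ℝ}, Integrable u μ →
      Integrable (fun v => ((max (u v) 0 : ℝ) : ℂ) * Complex.exp (L v * Complex.I)) μ := by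
    intro L u hu
    refine (hu.pos_part.ofReal (𝕜 := ℂ)).mul_bdd (c := 1) (hexp L).aestronglyMeasurable
      (Eventually.of_forall fun v => ?_)
    rw [Complex.norm_exp_ofReal_mul_I]
  have hchar : ∀ (L : StrongDual ℝ V) {u : V → ℝ}, Integrable u μ →
      ∫ v, Complex.exp (L v * Complex.I) ∂(μ.withDensity fun v => ENNReal.ofReal (u v)) =
      ∫ v, ((max (u v) 0 : ℝ) : ℂ) * Complex.exp (L v * Complex.I) ∂μ := by
    intro L u hu
    rw [integral_withDensity_eq_integral_toReal_smul₀ (by have := hu.1.aemeasurable; fun_prop)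
      (by simp)]
    refine integral_congr_ae (Eventually.of_forall fun v => ?_)
    simp [ENNReal.toReal_ofReal']
  have heq : μ.withDensity (fun v => ENNReal.ofReal (g v)) =
      μ.withDensity fun v => ENNReal.ofReal (-g v) := by
    refine Measure.ext_of_charFunDual ?_
    ext L
    rw [charFunDual_apply, charFunDual_apply, hchar L hg, hchar L hneg, ← sub_eq_zero,
      ← integral_sub (hint L hg) (hint L hneg), ← h L]
    refine integral_congr_ae (Eventually.of_forall fun v => ?_)
    simp only
    rw [← sub_mul, ← Complex.ofReal_sub]
    congr 3
    rcases le_total (g v) 0 with hv | hv <;> simp [hv]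
  have h2 := (withDensity_eq_iff (by have := hg.1.aemeasurable; fun_prop)
    (by have := hg.1.aemeasurable; fun_prop) hg.lintegral_lt_top.ne).1 heq
  filter_upwards [h2] with v hv
  rcases le_total (g v) 0 with h0 | h0
  · rw [ENNReal.ofReal_of_nonpos h0, eq_comm, ENNReal.ofReal_eq_zero] at hv
    exact le_antisymm h0 (by simpa using hv)
  · rw [ENNReal.ofReal_of_nonpos (p := -g v) (by linarith), ENNReal.ofReal_eq_zero] at hv
    exact le_antisymm hv h0

/-- An integrable function whose Fourier transform vanishes is zero almost everywhere. -/
theorem ae_eq_zero_of_forall_integral_mul_exp {f : V → ℂ} (hf : Integrable f μ)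
    (h : ∀ L : StrongDual ℝ V, ∫ v, f v * Complex.exp (L v * Complex.I) ∂μ = 0) :
    f =ᵐ[μ] 0 := by
  have hint : ∀ (L : StrongDual ℝ V) {u : V → ℂ}, Integrable u μ →
      Integrable (fun v => u v * Complex.exp (L v * Complex.I)) μ := by
    intro L u hu
    refine hu.mul_bdd (c := 1) (by fun_prop)
      (Eventually.of_forall fun v => ?_)
    rw [Complex.norm_exp_ofReal_mul_I]
  have hf' : Integrable (fun v => (starRingEnd ℂ) (f v)) μ :=
    (LinearIsometryEquiv.integrable_comp_iff Complex.conjLIE).2 hf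
  have hconj : ∀ L : StrongDual ℝ V,
      ∫ v, (starRingEnd ℂ) (f v) * Complex.exp (L v * Complex.I) ∂μ = 0 := by
    intro L
    have := congrArg (starRingEnd ℂ) (h (-L))
    rw [← integral_conj, map_zero] at this
    rw [← this]
    refine integral_congr_ae (Eventually.of_forall fun v => ?_)
    simp [← Complex.exp_conj]
  have hre : (fun v => (f v).re) =ᵐ[μ] 0 := by
    refine ae_eq_zero_of_forall_integral_mul_exp_real hf.re fun L => ?_
    have : ∀ v, ((f v).re : ℂ) * Complex.exp (L v * Complex.I) = 2⁻¹ *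
        (f v * Complex.exp (L v * Complex.I) +
          (starRingEnd ℂ) (f v) * Complex.exp (L v * Complex.I)) := fun v => by
      rw [Complex.re_eq_add_conj]; ring
    simp only [this]
    rw [integral_const_mul, integral_add (hint L hf) (hint L hf'), h, hconj]
    simp
  have him : (fun v => (f v).im) =ᵐ[μ] 0 := by
    refine ae_eq_zero_of_forall_integral_mul_exp_real hf.im fun L => ?_
    have : ∀ v, ((f v).im : ℂ) * Complex.exp (L v * Complex.I) = (2 * Complex.I)⁻¹ *
        (f v * Complex.exp (L v * Complex.I) -
          (starRingEnd ℂ) (f v) * Complex.exp (L v * Complex.I)) := fun v => by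
      rw [Complex.im_eq_sub_conj]; ring
    simp only [this]
    rw [integral_const_mul, integral_sub (hint L hf) (hint L hf'), h, hconj]
    simp
  filter_upwards [hre, him] with v h1 h2
  exact Complex.ext h1 h2

end Injectivity

/-! ### The Fourier transform in the space variable -/

section SpaceTransform

variable {k : ℕ}

/-- The Fourier transform in the space variable, `(s, η) ↦ ∫ e^{-2πi⟨y, η⟩} ψ(s, y) dy`. -/
def spaceTransform (ψ : ℝ × Space k → ℂ) (p : ℝ × Space k) : ℂ :=
  𝓕 (fun y => ψ (p.1, y)) p.2

theorem norm_iteratedFDeriv_slice_le (ψ : 𝓢(ℝ × Space k, ℂ)) (s : ℝ) (n : ℕ) (y : Space k) :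
    ‖iteratedFDeriv ℝ n (fun y => ψ (s, y)) y‖ ≤ ‖iteratedFDeriv ℝ n ψ (s, y)‖ := by
  let g : Space k →L[ℝ] ℝ × Space k := ContinuousLinearMap.inr ℝ ℝ (Space k)
  have hf : ContDiff ℝ ((⊤ : ℕ∞) : WithTop ℕ∞) (fun q => ψ ((s, 0) + q)) :=
    (ψ.smooth ⊤).comp (by fun_prop)
  have e : (fun y => ψ (s, y)) = (fun q => ψ ((s, 0) + q)) ∘ g := by
    ext y; simp [g]
  rw [e, g.iteratedFDeriv_comp_right hf y (by exact_mod_cast le_top), iteratedFDeriv_comp_add_left]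
  have hs : ((s, 0) + g y : ℝ × Space k) = (s, y) := by simp [g]
  rw [hs]
  refine (ContinuousMultilinearMap.norm_compContinuousLinearMap_le _ _).trans ?_
  have hg : ‖g‖ ≤ 1 := ContinuousLinearMap.norm_inr_le_one ℝ ℝ (Space k)
  exact mul_le_of_le_one_right (norm_nonneg _) (Finset.prod_le_one (fun _ _ => norm_nonneg _)
    fun _ _ => hg)

/-- The Schwartz seminorms of the slices of `ψ` are integrable in time: two extra powers of the norm
of `(s, y)` pay for the factor `(1 + s²)⁻¹`. -/
theorem norm_pow_mul_iteratedFDeriv_slice_le (ψ : 𝓢(ℝ × Space k, ℂ)) (s : ℝ) (a n : ℕ)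
    (y : Space k) :
    ‖y‖ ^ a * ‖iteratedFDeriv ℝ n (fun y => ψ (s, y)) y‖ ≤
      (SchwartzMap.seminorm ℂ a n ψ + SchwartzMap.seminorm ℂ (a + 2) n ψ) * (1 + s ^ 2)⁻¹ := by
  rw [← div_eq_mul_inv, le_div_iff₀ (by positivity)]
  have h1 := SchwartzMap.le_seminorm ℂ a n ψ (s, y)
  have h2 := SchwartzMap.le_seminorm ℂ (a + 2) n ψ (s, y)
  have hy : ‖y‖ ≤ ‖(s, y)‖ := norm_snd_le (s, y)
  have hs : s ^ 2 ≤ ‖(s, y)‖ ^ 2 := by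
    have : ‖s‖ ≤ ‖(s, y)‖ := norm_fst_le (s, y)
    rw [← sq_abs, ← Real.norm_eq_abs]
    gcongr
  calc _ ≤ ‖(s, y)‖ ^ a * ‖iteratedFDeriv ℝ n ψ (s, y)‖ * (1 + ‖(s, y)‖ ^ 2) := by
        gcongr
        exact norm_iteratedFDeriv_slice_le ψ s n y
    _ = ‖(s, y)‖ ^ a * ‖iteratedFDeriv ℝ n ψ (s, y)‖ +
        ‖(s, y)‖ ^ (a + 2) * ‖iteratedFDeriv ℝ n ψ (s, y)‖ := by ring
    _ ≤ _ := add_le_add h1 h2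

/-- The Schwartz function `y ↦ ψ(s, y)`. -/
def slice (ψ : 𝓢(ℝ × Space k, ℂ)) (s : ℝ) : 𝓢(Space k, ℂ) where
  toFun y := ψ (s, y)
  smooth' := (ψ.smooth ⊤).comp (by fun_prop)
  decay' a n := ⟨_, norm_pow_mul_iteratedFDeriv_slice_le ψ s a n⟩

@[simp]
theorem slice_apply (ψ : 𝓢(ℝ × Space k, ℂ)) (s : ℝ) (y : Space k) : slice ψ s y = ψ (s, y) := rfl

theorem spaceTransform_eq_fourier_slice (ψ : 𝓢(ℝ × Space k, ℂ)) (p : ℝ × Space k) :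
    spaceTransform ψ p = 𝓕 (slice ψ p.1) p.2 := rfl

/-- The space transform of a Schwartz function decays rapidly in `η`, locally uniformly in `s`,
with quadratic decay in `s`. -/
theorem exists_norm_spaceTransform_le (ψ : 𝓢(ℝ × Space k, ℂ)) (m : ℕ) :
    ∃ C : ℝ, 0 ≤ C ∧ ∀ p : ℝ × Space k,
      ‖spaceTransform ψ p‖ ≤ C * ((1 + p.1 ^ 2)⁻¹ * ((1 + ‖p.2‖) ^ m)⁻¹) := by
  let Q : Seminorm ℂ 𝓢(Space k, ℂ) :=
    (Finset.Iic (m, 0)).sup fun i => SchwartzMap.seminorm ℂ i.1 i.2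
  let q : Seminorm ℂ 𝓢(Space k, ℂ) :=
    Q.comp (FourierTransform.fourierCLM ℂ 𝓢(Space k, ℂ)).toLinearMap
  have hw := schwartz_withSeminorms ℂ (Space k) ℂ
  have hq : Continuous q := by
    have h1 : Continuous Q := by
      refine Seminorm.continuous_of_le (q := ∑ i ∈ Finset.Iic (m, 0),
        (SchwartzMap.seminorm ℂ i.1 i.2 : Seminorm ℂ 𝓢(Space k, ℂ))) ?_
        (Seminorm.finset_sup_le_sum _ _)
      rw [show ⇑(∑ i ∈ Finset.Iic (m, 0),
        (SchwartzMap.seminorm ℂ i.1 i.2 : Seminorm ℂ 𝓢(Space k, ℂ))) =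
        fun f => ∑ i ∈ Finset.Iic (m, 0), SchwartzMap.seminorm ℂ i.1 i.2 f by
          ext f
          rw [_root_.sum_apply]]
      exact continuous_finsetSum _ fun i _ => hw.continuous_seminorm i
    exact h1.comp (FourierTransform.fourierCLM ℂ 𝓢(Space k, ℂ)).continuous
  obtain ⟨S, C, -, hC⟩ := Seminorm.bound_of_continuous hw q hq
  let D : ℝ := ∑ i ∈ S, (SchwartzMap.seminorm ℂ i.1 i.2 ψ + SchwartzMap.seminorm ℂ (i.1 + 2) i.2 ψ)
  have hD : ∀ i ∈ S,
      SchwartzMap.seminorm ℂ i.1 i.2 ψ + SchwartzMap.seminorm ℂ (i.1 + 2) i.2 ψ ≤ D :=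
    fun i hi => Finset.single_le_sum (f := fun i : ℕ × ℕ =>
      SchwartzMap.seminorm ℂ i.1 i.2 ψ + SchwartzMap.seminorm ℂ (i.1 + 2) i.2 ψ)
      (fun i _ => by positivity) hi
  have hD0 : 0 ≤ D := Finset.sum_nonneg fun i _ => by positivity
  refine ⟨2 ^ m * (C * D), by positivity, fun p => ?_⟩
  have h1 := SchwartzMap.one_add_le_sup_seminorm_apply (𝕜 := ℂ) (m := (m, 0)) le_rfl le_rfl
    (𝓕 (slice ψ p.1)) p.2
  rw [norm_iteratedFDeriv_zero] at h1
  have h2 := hC (slice ψ p.1)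
  have h3 : (S.sup (schwartzSeminormFamily ℂ (Space k) ℂ)) (slice ψ p.1) ≤ D * (1 + p.1 ^ 2)⁻¹ := by
    refine Seminorm.finset_sup_apply_le (by positivity) fun i hi => ?_
    refine SchwartzMap.seminorm_le_bound ℂ i.1 i.2 _ (by positivity) fun y => ?_
    refine (norm_pow_mul_iteratedFDeriv_slice_le ψ p.1 i.1 i.2 y).trans ?_
    gcongr
    exact hD i hi
  have h4 : Q (𝓕 (slice ψ p.1)) ≤ C * (D * (1 + p.1 ^ 2)⁻¹) := by
    refine h2.trans ?_
    rw [_root_.smul_apply, NNReal.smul_def, smul_eq_mul]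
    gcongr
  rw [spaceTransform_eq_fourier_slice]
  have h5 : (1 + ‖p.2‖) ^ m * ‖𝓕 (slice ψ p.1) p.2‖ ≤ 2 ^ m * (C * (D * (1 + p.1 ^ 2)⁻¹)) :=
    h1.trans (by gcongr)
  have h6 : (0 : ℝ) < (1 + ‖p.2‖) ^ m := by positivity
  calc _ = ((1 + ‖p.2‖) ^ m)⁻¹ * ((1 + ‖p.2‖) ^ m * ‖𝓕 (slice ψ p.1) p.2‖) := by
        field_simp
    _ ≤ ((1 + ‖p.2‖) ^ m)⁻¹ * (2 ^ m * (C * (D * (1 + p.1 ^ 2)⁻¹))) := by gcongr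
    _ = _ := by ring

theorem stronglyMeasurable_spaceTransform {ψ : ℝ × Space k → ℂ} (hψ : Continuous ψ) :
    StronglyMeasurable (spaceTransform ψ) := by
  unfold spaceTransform
  simp only [Real.fourier_eq']
  refine StronglyMeasurable.integral_prod_right (f := fun (p : ℝ × Space k) (y : Space k) =>
    Complex.exp (((-2 * Real.pi * inner ℝ y p.2 : ℝ) : ℂ) * Complex.I) • ψ (p.1, y)) ?_
  exact Continuous.stronglyMeasurable (by fun_prop)

/-! ### Weighted square integrability -/

theorem measurable_weight (γ : ℝ) : Measurable (weight γ : ℝ × Space k → ℂ) := by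
  unfold weight
  fun_prop

theorem norm_weight (γ : ℝ) (p : ℝ × Space k) : ‖weight γ p‖ = ‖p.2‖ ^ ((γ - k) / 2) := by
  rw [weight, Complex.norm_real, Real.norm_of_nonneg (by positivity)]

theorem sq_norm_weight (γ : ℝ) (p : ℝ × Space k) : ‖weight γ p‖ ^ 2 = ‖p.2‖ ^ (γ - k) := by
  rw [norm_weight, ← Real.rpow_natCast, ← Real.rpow_mul (norm_nonneg _)]
  congr 1
  push_cast
  ring

/-- Integrability in polar coordinates: `γ > 0` makes the weight integrable at the origin,
`a > γ` at infinity. -/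
theorem integrable_norm_rpow_mul_one_add_norm_rpow (hk : 1 ≤ k) {γ a : ℝ} (hγ : 0 < γ)
    (ha : γ < a) :
    Integrable (fun η : Space k => ‖η‖ ^ (γ - k) * (1 + ‖η‖) ^ (-a)) := by
  have : Nonempty (Fin k) := ⟨⟨0, hk⟩⟩
  rw [integrable_fun_norm_addHaar volume (f := fun r => r ^ (γ - k) * (1 + r) ^ (-a))]
  have hdim : Module.finrank ℝ (Space k) = k := by simp
  rw [hdim]
  have hm : AEStronglyMeasurable (fun y : ℝ => y ^ (k - 1) • (y ^ (γ - k) * (1 + y) ^ (-a)))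
      (volume.restrict (Set.Ioi 0)) := by
    apply Measurable.aestronglyMeasurable
    fun_prop
  have heq : ∀ y : ℝ, 0 < y → ‖y ^ (k - 1) • (y ^ (γ - k) * (1 + y) ^ (-a))‖ =
      y ^ (γ - 1) * (1 + y) ^ (-a) := fun y hy => by
    rw [Real.norm_of_nonneg (by positivity), smul_eq_mul, ← mul_assoc, ← Real.rpow_natCast,
      ← Real.rpow_add hy]
    congr 2
    push_cast [hk]
    ring
  rw [← Set.Ioc_union_Ioi_eq_Ioi zero_le_one]
  refine IntegrableOn.union ?_ ?_
  · have h1 : IntegrableOn (fun y : ℝ => y ^ (γ - 1)) (Set.Ioc 0 1) := by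
      rw [← intervalIntegrable_iff_integrableOn_Ioc_of_le zero_le_one]
      exact intervalIntegral.intervalIntegrable_rpow' (by linarith)
    refine Integrable.mono' h1 (hm.mono_measure
      (Measure.restrict_mono Set.Ioc_subset_Ioi_self le_rfl)) ?_
    filter_upwards [ae_restrict_mem measurableSet_Ioc] with y hy
    rw [heq y hy.1]
    refine mul_le_of_le_one_right (Real.rpow_nonneg hy.1.le _) ?_
    exact Real.rpow_le_one_of_one_le_of_nonpos (by linarith [hy.1]) (by linarith)
  · have h1 : IntegrableOn (fun y : ℝ => y ^ (γ - 1 - a)) (Set.Ioi 1) :=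
      integrableOn_Ioi_rpow_of_lt (by linarith) zero_lt_one
    refine Integrable.mono' h1 (hm.mono_measure
      (Measure.restrict_mono (Set.Ioi_subset_Ioi zero_le_one) le_rfl)) ?_
    filter_upwards [ae_restrict_mem measurableSet_Ioi] with y hy
    have hy1 : (1 : ℝ) < y := hy
    rw [heq y (by linarith), sub_eq_add_neg (γ - 1) a, Real.rpow_add (by linarith)]
    gcongr ?_ * ?_
    exact Real.rpow_le_rpow_of_nonpos (by linarith) (by linarith) (by linarith)

/-- A sufficient condition for weighted square integrability on space-time. -/
theorem memLp_weight_mul (hk : 1 ≤ k) {γ : ℝ} (hγ : 0 < γ) {a : ℝ} (ha : γ < 2 * a)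
    {H : ℝ × Space k → ℂ} (hH : AEStronglyMeasurable H) {b : ℝ → ℝ} (hb : MemLp b 2)
    (h : ∀ p, ‖H p‖ ≤ b p.1 * (1 + ‖p.2‖) ^ (-a)) :
    MemLp (fun p => weight γ p * H p) 2 := by
  have hm : AEStronglyMeasurable (fun p : ℝ × Space k => weight γ p * H p) volume :=
    (measurable_weight γ).aestronglyMeasurable.mul hH
  rw [memLp_two_iff_integrable_sq_norm hm]
  have h1 : Integrable (fun p : ℝ × Space k =>
      b p.1 ^ 2 * (‖p.2‖ ^ (γ - k) * (1 + ‖p.2‖) ^ (-(2 * a)))) :=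
    Integrable.mul_prod hb.integrable_sq (integrable_norm_rpow_mul_one_add_norm_rpow hk hγ ha)
  refine h1.mono' (hm.norm.pow 2) (Eventually.of_forall fun p => ?_)
  rw [Real.norm_of_nonneg (by positivity), norm_mul, mul_pow, sq_norm_weight]
  have h2 : ‖H p‖ ^ 2 ≤ (b p.1 * (1 + ‖p.2‖) ^ (-a)) ^ 2 := by
    gcongr
    exact h p
  calc _ ≤ ‖p.2‖ ^ (γ - k) * (b p.1 * (1 + ‖p.2‖) ^ (-a)) ^ 2 := by gcongr
    _ = b p.1 ^ 2 * (‖p.2‖ ^ (γ - k) * ((1 + ‖p.2‖) ^ (-a)) ^ 2) := by ring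
    _ = _ := by
      rw [← Real.rpow_natCast ((1 + ‖p.2‖) ^ (-a)), ← Real.rpow_mul (by positivity)]
      congr 3
      push_cast
      ring

theorem memLp_inv_one_add_sq (C : ℝ) : MemLp (fun s : ℝ => C * (1 + s ^ 2)⁻¹) 2 := by
  refine MemLp.const_mul ?_ C
  have hc : Continuous fun s : ℝ => (1 + s ^ 2)⁻¹ :=
    Continuous.inv₀ (by fun_prop) fun s => by positivity
  rw [memLp_two_iff_integrable_sq hc.aestronglyMeasurable]
  refine integrable_inv_one_add_sq.mono' (hc.pow 2).aestronglyMeasurable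
    (Eventually.of_forall fun s => ?_)
  rw [Real.norm_of_nonneg (by positivity)]
  have h1 : (1 + s ^ 2)⁻¹ ≤ 1 := inv_le_one_of_one_le₀ (by nlinarith [sq_nonneg s])
  have h0 : 0 ≤ (1 + s ^ 2)⁻¹ := by positivity
  nlinarith

theorem memLp_weight_mul_spaceTransform (hk : 1 ≤ k) {γ : ℝ} (hγ : 0 < γ)
    (ψ : 𝓢(ℝ × Space k, ℂ)) : MemLp (fun p => weight γ p * spaceTransform ψ p) 2 := by
  obtain ⟨m, hm⟩ := exists_nat_gt γ
  obtain ⟨C, hC, h⟩ := exists_norm_spaceTransform_le ψ m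
  refine memLp_weight_mul hk hγ (a := m) (by linarith)
    (stronglyMeasurable_spaceTransform ψ.continuous).aestronglyMeasurable
    (memLp_inv_one_add_sq C) fun p => (h p).trans (le_of_eq ?_)
  rw [Real.rpow_neg (by positivity), Real.rpow_natCast]
  ring

end SpaceTransform

/-! ### The Fourier transform in the time variable -/

section TimeTransform

variable {k : ℕ}

instance : (volume : Measure (ℝ × Space k)).IsAddHaarMeasure := by
  rw [Measure.volume_eq_prod]
  infer_instance

/-- Measurable functions on space-time that are bounded and vanish outside a bounded set of
times. -/
structure IsTimeBounded (H : ℝ × Space k → ℂ) : Prop where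
  measurable : Measurable H
  bound : ∃ R C : ℝ, ∀ p, ‖H p‖ ≤ (Set.Icc (-R) R).indicator (fun _ => C) p.1

theorem IsTimeBounded.add {H H' : ℝ × Space k → ℂ} (h : IsTimeBounded H) (h' : IsTimeBounded H') :
    IsTimeBounded fun p => H p + H' p := by
  obtain ⟨R, C, hb⟩ := h.bound
  obtain ⟨R', C', hb'⟩ := h'.bound
  refine ⟨h.measurable.add h'.measurable, max R R', |C| + |C'|, fun p => ?_⟩
  have key : ∀ {S D : ℝ} {z : ℂ}, S ≤ max R R' →
      ‖z‖ ≤ (Set.Icc (-S) S).indicator (fun _ => D) p.1 →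
      ‖z‖ ≤ (Set.Icc (-max R R') (max R R')).indicator (fun _ => |D|) p.1 := by
    intro S D z hS hz
    by_cases hp : p.1 ∈ Set.Icc (-S) S
    · have hp' : p.1 ∈ Set.Icc (-max R R') (max R R') :=
        ⟨(neg_le_neg hS).trans hp.1, hp.2.trans hS⟩
      rw [Set.indicator_of_mem hp] at hz
      rw [Set.indicator_of_mem hp']
      exact hz.trans (le_abs_self D)
    · rw [Set.indicator_of_notMem hp] at hz
      exact hz.trans (Set.indicator_nonneg (fun _ _ => abs_nonneg D) _)
  have h1 := key (le_max_left _ _) (hb p)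
  have h2 := key (le_max_right _ _) (hb' p)
  refine (norm_add_le _ _).trans ((add_le_add h1 h2).trans (le_of_eq ?_))
  by_cases hp : p.1 ∈ Set.Icc (-max R R') (max R R') <;> simp [hp]

theorem IsTimeBounded.const_mul {H : ℝ × Space k → ℂ} (h : IsTimeBounded H) (c : ℂ) :
    IsTimeBounded fun p => c * H p := by
  obtain ⟨R, C, hb⟩ := h.bound
  refine ⟨h.measurable.const_mul c, R, ‖c‖ * C, fun p => ?_⟩
  rw [norm_mul]
  refine (mul_le_mul_of_nonneg_left (hb p) (norm_nonneg c)).trans (le_of_eq ?_)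
  by_cases hp : p.1 ∈ Set.Icc (-R) R <;> simp [hp]

theorem IsTimeBounded.sub {H H' : ℝ × Space k → ℂ} (h : IsTimeBounded H) (h' : IsTimeBounded H') :
    IsTimeBounded fun p => H p - H' p := by
  simpa [sub_eq_add_neg] using h.add (h'.const_mul (-1))

theorem IsTimeBounded.memLp {H : ℝ × Space k → ℂ} (h : IsTimeBounded H) (η : Space k)
    (q : ℝ≥0∞) : MemLp (fun s => H (s, η)) q := by
  obtain ⟨R, C, hb⟩ := h.bound
  refine MemLp.mono' (g := (Set.Icc (-R) R).indicator fun _ => C)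
    (memLp_indicator_const q measurableSet_Icc C (Or.inr (by simp)))
    (h.measurable.comp (by fun_prop)).aestronglyMeasurable
    (Eventually.of_forall fun s => hb (s, η))

theorem IsTimeBounded.integrable {H : ℝ × Space k → ℂ} (h : IsTimeBounded H) (η : Space k) :
    Integrable (fun s => H (s, η)) :=
  memLp_one_iff_integrable.1 (h.memLp η 1)

/-- The (unnormalized) Fourier transform in time, in the angular frequencies `(τ, ξ)`. -/
def timeTransform (H : ℝ × Space k → ℂ) (p : ℝ × Space k) : ℂ :=
  𝓕 (fun s => H (s, (2 * Real.pi)⁻¹ • p.2)) ((2 * Real.pi)⁻¹ * p.1)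

theorem timeTransform_eq_integral (H : ℝ × Space k → ℂ) (p : ℝ × Space k) :
    timeTransform H p =
      ∫ s, Complex.exp (-Complex.I * (p.1 * s : ℝ)) * H (s, (2 * Real.pi)⁻¹ • p.2) := by
  rw [timeTransform, Real.fourier_eq']
  refine integral_congr_ae (Eventually.of_forall fun s => ?_)
  simp only [smul_eq_mul, RCLike.inner_apply, conj_trivial]
  congr 2
  push_cast
  have : (Real.pi : ℂ) ≠ 0 := by exact_mod_cast Real.pi_ne_zero
  field_simp

theorem timeTransform_add {H H' : ℝ × Space k → ℂ} (h : IsTimeBounded H) (h' : IsTimeBounded H')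
    (p : ℝ × Space k) :
    timeTransform (fun p => H p + H' p) p = timeTransform H p + timeTransform H' p := by
  have hint : ∀ {H : ℝ × Space k → ℂ}, IsTimeBounded H → Integrable fun s : ℝ =>
      Complex.exp (-Complex.I * (p.1 * s : ℝ)) * H (s, (2 * Real.pi)⁻¹ • p.2) := fun h => by
    refine (h.integrable _).bdd_mul (c := 1) (by fun_prop) (Eventually.of_forall fun s => ?_)
    rw [Complex.norm_exp]
    simp
  simp only [timeTransform_eq_integral, mul_add]
  exact integral_add (hint h) (hint h')

theorem timeTransform_const_mul (H : ℝ × Space k → ℂ) (c : ℂ) (p : ℝ × Space k) :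
    timeTransform (fun p => c * H p) p = c * timeTransform H p := by
  simp only [timeTransform_eq_integral, ← integral_const_mul]
  congr 1; ext s; ring

theorem timeTransform_sub {H H' : ℝ × Space k → ℂ} (h : IsTimeBounded H) (h' : IsTimeBounded H')
    (p : ℝ × Space k) :
    timeTransform (fun p => H p - H' p) p = timeTransform H p - timeTransform H' p := by
  have := timeTransform_add h (h'.const_mul (-1)) p
  rw [timeTransform_const_mul] at this
  simpa [sub_eq_add_neg] using this

theorem eLpNorm_two_sq_eq_lintegral {α E : Type*} [NormedAddCommGroup E] [MeasurableSpace α]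
    {μ : Measure α} (f : α → E) : eLpNorm f 2 μ ^ 2 = ∫⁻ a, ‖f a‖ₑ ^ 2 ∂μ := by
  have := eLpNorm_nnreal_pow_eq_lintegral (f := f) (μ := μ) (p := 2) (by norm_num)
  simpa using this

theorem measurable_fourier_time {H : ℝ × Space k → ℂ} (h : IsTimeBounded H) :
    Measurable fun p : ℝ × Space k => 𝓕 (fun s => H (s, p.2)) p.1 := by
  simp only [Real.fourier_eq']
  refine (StronglyMeasurable.integral_prod_right (f := fun (p : ℝ × Space k) (s : ℝ) =>
    Complex.exp (((-2 * Real.pi * inner ℝ s p.1 : ℝ) : ℂ) * Complex.I) • H (s, p.2)) ?_).measurable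
  have := h.measurable
  apply Measurable.stronglyMeasurable
  unfold Function.uncurry
  fun_prop

theorem measurable_timeTransform {H : ℝ × Space k → ℂ} (h : IsTimeBounded H) :
    Measurable (timeTransform H) :=
  (measurable_fourier_time h).comp (f := fun p : ℝ × Space k =>
    ((2 * Real.pi)⁻¹ * p.1, (2 * Real.pi)⁻¹ • p.2)) (by fun_prop)

/-- Plancherel's theorem in the time variable, with the weight `|ξ|^{β-k}`. The passage to angular
frequencies contributes `(2π)^{β-k}` through the weight and `(2π)^{k+1}` through the Jacobian. -/
theorem eLpNorm_weight_mul_timeTransform (β : ℝ) {H : ℝ × Space k → ℂ} (h : IsTimeBounded H) :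
    eLpNorm (fun p => weight β p * timeTransform H p) 2 ^ 2 =
      ENNReal.ofReal ((2 * Real.pi) ^ (β + 1)) *
        eLpNorm (fun p => weight β p * H p) 2 ^ 2 := by
  let r : ℝ := (2 * Real.pi)⁻¹
  have hr : 0 < r := by positivity
  let g : ℝ × Space k → ℝ≥0∞ := fun p => ‖weight β p * 𝓕 (fun s => H (s, p.2)) p.1‖ₑ ^ 2
  have hg : Measurable g :=
    (((measurable_weight β).mul (measurable_fourier_time h)).enorm).pow_const 2
  have hw : ∀ p : ℝ × Space k, ‖weight β p‖ₑ ^ 2 =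
      ENNReal.ofReal ((2 * Real.pi) ^ (β - k)) * ‖weight β (r • p)‖ₑ ^ 2 := fun p => by
    rw [← ofReal_norm, ← ofReal_norm, ← ENNReal.ofReal_pow (norm_nonneg _),
      ← ENNReal.ofReal_pow (norm_nonneg _), sq_norm_weight, sq_norm_weight,
      ← ENNReal.ofReal_mul (by positivity), Prod.smul_snd, norm_smul, Real.norm_of_nonneg hr.le,
      Real.mul_rpow hr.le (norm_nonneg _), ← mul_assoc, ← Real.mul_rpow (by positivity) hr.le,
      mul_inv_cancel₀ (by positivity), Real.one_rpow, one_mul]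
  have h1 : ∀ p, ‖weight β p * timeTransform H p‖ₑ ^ 2 =
      ENNReal.ofReal ((2 * Real.pi) ^ (β - k)) * g (r • p) := fun p => by
    simp only [g, enorm_mul, mul_pow]
    rw [hw p, mul_assoc]
    rfl
  have hscale : ∫⁻ p, g (r • p) = ENNReal.ofReal ((2 * Real.pi) ^ ((k : ℝ) + 1)) * ∫⁻ p, g p := by
    have := lintegral_map (μ := volume) hg (measurable_const_smul r : Measurable (r • · :
      ℝ × Space k → ℝ × Space k))
    rw [← this, Measure.map_addHaar_smul volume hr.ne', lintegral_smul_measure, smul_eq_mul]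
    congr 2
    rw [abs_of_pos (by positivity)]
    have hd : Module.finrank ℝ (ℝ × Space k) = k + 1 := by simp [add_comm]
    rw [hd, ← inv_pow, inv_inv, ← Real.rpow_natCast]
    push_cast
    rfl
  have hpl : ∫⁻ p, g p = ∫⁻ p, ‖weight β p * H p‖ₑ ^ 2 := by
    have hm2 : Measurable fun p => ‖weight β p * H p‖ₑ ^ 2 :=
      ((measurable_weight β).mul h.measurable).enorm.pow_const 2
    rw [Measure.volume_eq_prod, lintegral_prod_symm _ hg.aemeasurable,
      lintegral_prod_symm _ hm2.aemeasurable]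
    refine lintegral_congr fun η => ?_
    have hw' : ∀ s : ℝ, weight β (s, η) = weight β ((0 : ℝ), η) := fun s => rfl
    simp only [g, enorm_mul, mul_pow, hw']
    have hη : Measurable fun s => H (s, η) := h.measurable.comp (by fun_prop)
    have hη' : Measurable fun τ => 𝓕 (fun s => H (s, η)) τ :=
      (measurable_fourier_time h).comp (f := fun τ : ℝ => (τ, η)) (by fun_prop)
    rw [lintegral_const_mul _ (hη'.enorm.pow_const 2), lintegral_const_mul _ (hη.enorm.pow_const 2),
      ← eLpNorm_two_sq_eq_lintegral, ← eLpNorm_two_sq_eq_lintegral,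
      ← eLpNorm_fourier_eq_of_integrable (h.integrable η) (h.memLp η 2)]
  rw [eLpNorm_two_sq_eq_lintegral, eLpNorm_two_sq_eq_lintegral]
  simp only [h1]
  rw [lintegral_const_mul (f := fun p => g (r • p)) _ (hg.comp (measurable_const_smul r)),
    hscale, hpl, ← mul_assoc, ← ENNReal.ofReal_mul (by positivity), ← Real.rpow_add (by positivity)]
  congr 3
  ring

theorem memLp_weight_mul_timeTransform (β : ℝ) {H : ℝ × Space k → ℂ} (h : IsTimeBounded H)
    (hH : MemLp (fun p => weight β p * H p) 2) :
    MemLp (fun p => weight β p * timeTransform H p) 2 := by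
  refine ⟨((measurable_weight β).mul (measurable_timeTransform h)).aestronglyMeasurable, ?_⟩
  have h1 := eLpNorm_weight_mul_timeTransform β h
  have h2 : eLpNorm (fun p => weight β p * timeTransform H p) 2 ^ 2 < ∞ := by
    rw [h1]
    have := hH.2
    exact ENNReal.mul_lt_top ENNReal.ofReal_lt_top (by finiteness)
  exact (ENNReal.pow_lt_top_iff.1 h2).resolve_right (by norm_num)

/-! ### Test functions and the wave kernel in Fourier variables -/

/-- A test function as a complex Schwartz function. -/
def IsTestFunction.toSchwartz {φ : ℝ × Space k → ℝ} (hφ : IsTestFunction φ) :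
    𝓢(ℝ × Space k, ℂ) :=
  HasCompactSupport.toSchwartzMap (f := fun p => (φ p : ℂ)) (hφ.2.comp_left Complex.ofReal_zero)
    (Complex.ofRealCLM.contDiff.comp hφ.1)

@[simp]
theorem IsTestFunction.toSchwartz_apply {φ : ℝ × Space k → ℝ} (hφ : IsTestFunction φ)
    (p : ℝ × Space k) : hφ.toSchwartz p = (φ p : ℂ) := rfl

theorem IsTestFunction.isTimeBounded {φ : ℝ × Space k → ℝ} (hφ : IsTestFunction φ) :
    IsTimeBounded (spaceTransform fun p => (φ p : ℂ)) := by
  refine ⟨(stronglyMeasurable_spaceTransform hφ.toSchwartz.continuous).measurable, ?_⟩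
  obtain ⟨C, hC, h⟩ := exists_norm_spaceTransform_le hφ.toSchwartz 0
  obtain ⟨R, hR⟩ := hφ.2.isCompact.isBounded.subset_closedBall 0
  refine ⟨R, C, fun p => ?_⟩
  by_cases hp : p.1 ∈ Set.Icc (-R) R
  · rw [Set.indicator_of_mem hp]
    refine (h p).trans (mul_le_of_le_one_right hC ?_)
    rw [pow_zero, inv_one, mul_one]
    exact inv_le_one_of_one_le₀ (by nlinarith [sq_nonneg p.1])
  · rw [Set.indicator_of_notMem hp]
    have h0 : ∀ y, φ (p.1, y) = 0 := fun y => by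
      by_contra hne
      have hmem := hR (subset_tsupport _ hne)
      rw [mem_closedBall_zero_iff] at hmem
      have h1 : |p.1| ≤ R := (norm_fst_le (p.1, y)).trans hmem
      exact hp (abs_le.1 h1)
    simp [spaceTransform, h0, Real.fourier_eq]

theorem IsTestFunction.memLp_weight_mul {φ : ℝ × Space k → ℝ} (hφ : IsTestFunction φ)
    (hk : 1 ≤ k) {γ : ℝ} (hγ : 0 < γ) :
    MemLp (fun p => weight γ p * spaceTransform (fun p => (φ p : ℂ)) p) 2 :=
  memLp_weight_mul_spaceTransform hk hγ hφ.toSchwartz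

/-- The space-time transform is the transform in space followed by the one in time. -/
theorem fourierST_eq_timeTransform {φ : ℝ × Space k → ℝ} (hφ : IsTestFunction φ)
    (p : ℝ × Space k) :
    fourierST φ p = timeTransform (spaceTransform fun p => (φ p : ℂ)) p := by
  have hint : Integrable (fun q : ℝ × Space k =>
      Complex.exp (-Complex.I * ((p.1 * q.1 + inner ℝ p.2 q.2 : ℝ) : ℂ)) * (φ q : ℂ)) := by
    refine hφ.toSchwartz.integrable.bdd_mul (c := 1) (by fun_prop)
      (Eventually.of_forall fun s => ?_)
    rw [Complex.norm_exp]
    simp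
  rw [fourierST, Measure.volume_eq_prod, integral_prod _ hint, timeTransform_eq_integral]
  refine integral_congr_ae (Eventually.of_forall fun s => ?_)
  simp only [spaceTransform, Real.fourier_eq']
  rw [← integral_const_mul]
  refine integral_congr_ae (Eventually.of_forall fun y => ?_)
  simp only [smul_eq_mul, ← mul_assoc, ← Complex.exp_add]
  congr 2
  rw [inner_smul_right, real_inner_comm]
  push_cast
  have : (Real.pi : ℂ) ≠ 0 := by exact_mod_cast Real.pi_ne_zero
  field_simp
  ring

/-- The Fourier transform in space of the kernel `(s, y) ↦ 1_{(0,t]}(s) S(t-s, x-y)`. It is written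
with `sinc`, so that it is also meaningful at `η = 0`. -/
def kernelTransform (t : ℝ) (x : Space k) (p : ℝ × Space k) : ℂ :=
  (Set.Ioc 0 t).indicator (fun s =>
    (((t - s) * Real.sinc (2 * Real.pi * (t - s) * ‖p.2‖) : ℝ) : ℂ) *
      Complex.exp ((-2 * Real.pi * inner ℝ x p.2 : ℝ) * Complex.I)) p.1

theorem measurable_kernelTransform (t : ℝ) (x : Space k) : Measurable (kernelTransform t x) := by
  have e : kernelTransform t x = (Prod.fst ⁻¹' Set.Ioc 0 t).indicator fun p : ℝ × Space k =>
      (((t - p.1) * Real.sinc (2 * Real.pi * (t - p.1) * ‖p.2‖) : ℝ) : ℂ) *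
      Complex.exp ((-2 * Real.pi * inner ℝ x p.2 : ℝ) * Complex.I) := by
    ext p; rfl
  rw [e]
  refine Measurable.indicator ?_ (measurable_fst measurableSet_Ioc)
  have := Real.continuous_sinc
  exact Continuous.measurable (by fun_prop)

/-- The kernel transform decays like `1/|η|`; this is what restricts its weighted square
integrability to `β < 2`. -/
theorem norm_kernelTransform_le (t : ℝ) (x : Space k) (p : ℝ × Space k) :
    ‖kernelTransform t x p‖ ≤
      (Set.Icc (-t) t).indicator (fun _ => 1 + t) p.1 * (1 + ‖p.2‖) ^ (-1 : ℝ) := by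
  rw [kernelTransform]
  by_cases hp : p.1 ∈ Set.Ioc 0 t
  · have hp' : p.1 ∈ Set.Icc (-t) t := ⟨by linarith [hp.1, hp.2], hp.2⟩
    rw [Set.indicator_of_mem hp, Set.indicator_of_mem hp', norm_mul,
      Complex.norm_exp_ofReal_mul_I, mul_one, Complex.norm_real, Real.norm_eq_abs,
      Real.rpow_neg_one, ← div_eq_mul_inv, le_div_iff₀ (by positivity)]
    set u := t - p.1 with hu
    have hu0 : 0 ≤ u := by linarith [hp.2]
    have hut : u ≤ t := by linarith [hp.1]
    have h1 : |u * Real.sinc (2 * Real.pi * u * ‖p.2‖)| ≤ u := by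
      rw [abs_mul, abs_of_nonneg hu0]
      exact mul_le_of_le_one_right hu0 (Real.abs_sinc_le_one _)
    have h2 : |u * Real.sinc (2 * Real.pi * u * ‖p.2‖)| * ‖p.2‖ ≤ 1 := by
      have h3 := mul_sinc_mul ‖p.2‖ u
      by_cases h0 : ‖p.2‖ = 0
      · simp [h0]
      · have h4 : u * Real.sinc (2 * Real.pi * u * ‖p.2‖) * (2 * Real.pi * ‖p.2‖) =
            Real.sin (2 * Real.pi * u * ‖p.2‖) := by
          have : 2 * Real.pi * ‖p.2‖ ≠ 0 := by positivity
          apply mul_right_cancel₀ this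
          rw [← h3]; ring
        have h5 := Real.abs_sin_le_one (2 * Real.pi * u * ‖p.2‖)
        rw [← h4, abs_mul, abs_of_nonneg (by positivity : 0 ≤ 2 * Real.pi * ‖p.2‖)] at h5
        have h6 : 0 ≤ |u * Real.sinc (2 * Real.pi * u * ‖p.2‖)| * ‖p.2‖ := by positivity
        have h7 : (1 : ℝ) ≤ 2 * Real.pi := by linarith [Real.pi_gt_three]
        nlinarith
    linarith
  · rw [Set.indicator_of_notMem hp, norm_zero]
    refine mul_nonneg (Set.indicator_nonneg (fun s hs => ?_) _) (by positivity)
    linarith [hs.1, hs.2]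

theorem isTimeBounded_kernelTransform (t : ℝ) (x : Space k) :
    IsTimeBounded (kernelTransform t x) := by
  refine ⟨measurable_kernelTransform t x, t, 1 + t,
    fun p => (norm_kernelTransform_le t x p).trans ?_⟩
  refine mul_le_of_le_one_right (Set.indicator_nonneg (fun s hs => by linarith [hs.1, hs.2]) _) ?_
  exact Real.rpow_le_one_of_one_le_of_nonpos (by linarith [norm_nonneg p.2]) (by norm_num)

theorem memLp_weight_mul_kernelTransform (hk : 1 ≤ k) {β : ℝ} (hβ : 0 < β) (hβ2 : β < 2) (t : ℝ)
    (x : Space k) : MemLp (fun p => weight β p * kernelTransform t x p) 2 :=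
  memLp_weight_mul hk hβ (a := 1) (by linarith)
    (measurable_kernelTransform t x).aestronglyMeasurable
    (memLp_indicator_const 2 measurableSet_Icc (1 + t) (Or.inr (by simp)))
    (norm_kernelTransform_le t x)

end TimeTransform

/-! ### The field in Fourier variables -/

section WaveField

variable {k : ℕ}

/-- Off the light cone, the function `F(t,x,·)` is the transform in time of the spatial transform of
the wave kernel: integrate the two exponentials that make up the sine. -/
theorem waveF_eq_timeTransform {t : ℝ} (ht : 0 ≤ t) (x : Space k) {p : ℝ × Space k}
    (h0 : p.2 ≠ 0) (h1 : p.1 + ‖p.2‖ ≠ 0) (h2 : p.1 - ‖p.2‖ ≠ 0) :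
    waveF t x p = timeTransform (kernelTransform t x) p := by
  obtain ⟨τ, ξ⟩ := p
  simp only at h0 h1 h2
  set r : ℝ := ‖ξ‖ with hr
  have hr0 : r ≠ 0 := norm_ne_zero_iff.2 h0
  set E : ℂ := Complex.exp (-Complex.I * (inner ℝ ξ x : ℝ)) with hE
  have hpi : (Real.pi : ℂ) ≠ 0 := by exact_mod_cast Real.pi_ne_zero
  have hker : ∀ s : ℝ, Complex.exp (-Complex.I * (τ * s : ℝ)) *
      kernelTransform t x (s, (2 * Real.pi)⁻¹ • ξ) = (Set.Ioc 0 t).indicator (fun s : ℝ =>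
        E / (2 * Complex.I * r) *
          (Complex.exp (Complex.I * r * t) * Complex.exp (-Complex.I * (τ + r) * s) -
            Complex.exp (-Complex.I * r * t) * Complex.exp (-Complex.I * (τ - r) * s))) s := by
    intro s
    rw [kernelTransform]
    by_cases hs : s ∈ Set.Ioc 0 t
    · rw [Set.indicator_of_mem hs, Set.indicator_of_mem hs]
      have e1 : ((-2 * Real.pi * inner ℝ x ((2 * Real.pi)⁻¹ • ξ) : ℝ) : ℂ) * Complex.I =
          -Complex.I * (inner ℝ ξ x : ℝ) := by
        rw [inner_smul_right, real_inner_comm]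
        push_cast
        field_simp
      have e2 : ‖(2 * Real.pi)⁻¹ • ξ‖ = (2 * Real.pi)⁻¹ * r := by
        rw [norm_smul, Real.norm_of_nonneg (by positivity)]
      have e3 : (((t - s) * Real.sinc (2 * Real.pi * (t - s) * ((2 * Real.pi)⁻¹ * r)) : ℝ) : ℂ) =
          Complex.sin ((t - s) * r) / r := by
        have a1 : 2 * Real.pi * (t - s) * ((2 * Real.pi)⁻¹ * r) = (t - s) * r := by
          have := Real.pi_ne_zero
          field_simp
        rw [a1]
        by_cases hts : t - s = 0
        · have : (t : ℂ) - s = 0 := by exact_mod_cast hts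
          simp [hts, this]
        · rw [Real.sinc_of_ne_zero (mul_ne_zero hts hr0)]
          have : (t : ℂ) - s ≠ 0 := by exact_mod_cast hts
          have : (r : ℂ) ≠ 0 := by exact_mod_cast hr0
          push_cast
          field_simp
      have hrc : (r : ℂ) ≠ 0 := by exact_mod_cast hr0
      simp only [e1, e2, e3]
      have f1 : Complex.exp (Complex.I * r * t) * Complex.exp (-Complex.I * (τ + r) * s) =
          Complex.exp (-Complex.I * (τ * s)) * Complex.exp ((t - s) * r * Complex.I) := by
        rw [← Complex.exp_add, ← Complex.exp_add]; congr 1; ring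
      have f2 : Complex.exp (-Complex.I * r * t) * Complex.exp (-Complex.I * (τ - r) * s) =
          Complex.exp (-Complex.I * (τ * s)) * Complex.exp (-((t - s) * r) * Complex.I) := by
        rw [← Complex.exp_add, ← Complex.exp_add]; congr 1; ring
      rw [f1, f2, Complex.sin, ← hE]
      push_cast
      generalize Complex.exp ((t - s) * r * Complex.I) = A
      generalize Complex.exp (-((t - s) * r) * Complex.I) = B
      generalize Complex.exp (-Complex.I * (τ * s)) = D
      field_simp
      linear_combination D * E * (B - A) * Complex.I_sq
    · rw [Set.indicator_of_notMem hs, Set.indicator_of_notMem hs, mul_zero]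
  rw [timeTransform_eq_integral]
  simp only [hker]
  rw [integral_indicator measurableSet_Ioc, ← intervalIntegral.integral_of_le ht,
    intervalIntegral.integral_const_mul, intervalIntegral.integral_sub
      (Continuous.intervalIntegrable (by fun_prop) _ _)
      (Continuous.intervalIntegrable (by fun_prop) _ _),
    intervalIntegral.integral_const_mul, intervalIntegral.integral_const_mul]
  have h1c : (τ : ℂ) + r ≠ 0 := by exact_mod_cast h1
  have h2c : (τ : ℂ) - r ≠ 0 := by exact_mod_cast h2
  have hrc : (r : ℂ) ≠ 0 := by exact_mod_cast hr0
  rw [integral_exp_mul_complex (mul_ne_zero (neg_ne_zero.2 Complex.I_ne_zero) h1c),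
    integral_exp_mul_complex (mul_ne_zero (neg_ne_zero.2 Complex.I_ne_zero) h2c)]
  have g1 : Complex.exp (Complex.I * r * t) * Complex.exp (-Complex.I * (τ + r) * t) =
      Complex.exp (-Complex.I * τ * t) := by
    rw [← Complex.exp_add]; congr 1; ring
  have g2 : Complex.exp (-Complex.I * r * t) * Complex.exp (-Complex.I * (τ - r) * t) =
      Complex.exp (-Complex.I * τ * t) := by
    rw [← Complex.exp_add]; congr 1; ring
  have g3 : Complex.exp (-Complex.I * τ * t) * Complex.exp (Complex.I * t * (τ + r)) =
      Complex.exp (Complex.I * r * t) := by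
    rw [← Complex.exp_add]; congr 1; ring
  have g4 : Complex.exp (-Complex.I * τ * t) * Complex.exp (Complex.I * t * (τ - r)) =
      Complex.exp (-Complex.I * r * t) := by
    rw [← Complex.exp_add]; congr 1; ring
  have g5 : Complex.exp (-Complex.I * (inner ℝ ξ x : ℝ) - Complex.I * τ * t) =
      E * Complex.exp (-Complex.I * τ * t) := by
    rw [hE, ← Complex.exp_add]; congr 1; ring
  rw [waveF]
  simp only [g5, ← hr]
  simp only [Complex.ofReal_zero, mul_zero, Complex.exp_zero]
  have hI : Complex.I * Complex.I = -1 := Complex.I_mul_I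
  calc _ = E / (2 * r) * ((Complex.exp (-Complex.I * τ * t) - Complex.exp (-Complex.I * τ * t) *
          Complex.exp (Complex.I * t * (τ + r))) / (τ + r) -
        (Complex.exp (-Complex.I * τ * t) - Complex.exp (-Complex.I * τ * t) *
          Complex.exp (Complex.I * t * (τ - r))) / (τ - r)) := by
        field_simp
    _ = E / (2 * r) * ((Complex.exp (-Complex.I * τ * t) - Complex.exp (Complex.I * r * t)) /
          (τ + r) - (Complex.exp (-Complex.I * τ * t) - Complex.exp (-Complex.I * r * t)) /
          (τ - r)) := by rw [g3, g4]
    _ = E / (2 * Complex.I * r) * (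
        (Complex.exp (Complex.I * r * t) * Complex.exp (-Complex.I * (τ + r) * t) -
          Complex.exp (Complex.I * r * t)) / (-Complex.I * (τ + r)) -
        (Complex.exp (-Complex.I * r * t) * Complex.exp (-Complex.I * (τ - r) * t) -
          Complex.exp (-Complex.I * r * t)) / (-Complex.I * (τ - r))) := by
        rw [g1, g2]
        have hne : Complex.I ≠ 0 := Complex.I_ne_zero
        have hs : ∀ a b : ℂ, b ≠ 0 → a / (-Complex.I * b) = Complex.I * (a / b) := fun a b hb => by
          field_simp
          rw [Complex.I_sq]; ring
        rw [hs _ _ h1c, hs _ _ h2c]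
        field_simp
    _ = _ := by
        ring

theorem ae_snd_ne_zero (hk : 1 ≤ k) : ∀ᵐ p : ℝ × Space k, p.2 ≠ 0 := by
  have : Nonempty (Fin k) := ⟨⟨0, hk⟩⟩
  exact Measure.quasiMeasurePreserving_snd.ae (Measure.ae_ne volume (0 : Space k))

/-- The light cone is a null set. -/
theorem waveF_ae_eq (hk : 1 ≤ k) {t : ℝ} (ht : 0 ≤ t) (x : Space k) :
    waveF t x =ᵐ[volume] timeTransform (kernelTransform t x) := by
  have key : ∀ c : ℝ, ∀ᵐ p : ℝ × Space k, p.1 + c * ‖p.2‖ ≠ 0 := by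
    intro c
    have hm : MeasurableSet {q : Space k × ℝ | q.2 + c * ‖q.1‖ ≠ 0} :=
      (measurableSet_eq_fun (by fun_prop) (by fun_prop)).compl
    have h : ∀ᵐ q ∂((volume : Measure (Space k)).prod (volume : Measure ℝ)),
        q.2 + c * ‖q.1‖ ≠ 0 := by
      refine (Measure.ae_prod_iff_ae_ae hm).2 (Eventually.of_forall fun ξ => ?_)
      filter_upwards [Measure.ae_ne volume (-(c * ‖ξ‖))] with τ hτ h0
      exact hτ (eq_neg_of_add_eq_zero_left h0)
    exact Measure.measurePreserving_swap.quasiMeasurePreserving.ae h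
  filter_upwards [ae_snd_ne_zero hk, key 1, key (-1)] with p h0 h1 h2
  exact waveF_eq_timeTransform ht x h0 (by simpa using h1) (by simpa [sub_eq_add_neg] using h2)

theorem memLp_weight_mul_waveF (hk : 1 ≤ k) {β : ℝ} (hβ : 0 < β) (hβ2 : β < 2) {t : ℝ}
    (ht : 0 ≤ t) (x : Space k) : MemLp (fun p => weight β p * waveF t x p) 2 := by
  refine (memLp_weight_mul_timeTransform β (isTimeBounded_kernelTransform t x)
    (memLp_weight_mul_kernelTransform hk hβ hβ2 t x)).ae_eq ?_
  filter_upwards [waveF_ae_eq hk ht x] with p hp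
  rw [hp]

theorem memLp_weight_mul_fourierST (hk : 1 ≤ k) {β : ℝ} (hβ : 0 < β) {φ : ℝ × Space k → ℝ}
    (hφ : IsTestFunction φ) : MemLp (fun p => weight β p * fourierST φ p) 2 := by
  simp only [fourierST_eq_timeTransform hφ]
  exact memLp_weight_mul_timeTransform β hφ.isTimeBounded (hφ.memLp_weight_mul hk hβ)

/-! ### Pairings with Schwartz functions -/

/-- The weights of the exponents `γ` and `2k - γ` are inverse to each other; they put functions in
dual weighted `L²` spaces. -/
theorem weight_mul_weight (γ : ℝ) {p : ℝ × Space k} (hp : p.2 ≠ 0) :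
    weight γ p * weight (2 * k - γ) p = 1 := by
  have h : 0 < ‖p.2‖ := norm_pos_iff.2 hp
  rw [weight, weight, ← Complex.ofReal_mul, ← Real.rpow_add h]
  have : (γ - k) / 2 + (2 * k - γ - k) / 2 = 0 := by ring
  rw [this, Real.rpow_zero, Complex.ofReal_one]

/-- The reflection `(s, η) ↦ (s, -η)`. -/
def spaceReflection (p : ℝ × Space k) : ℝ × Space k := (p.1, -p.2)

theorem measurePreserving_spaceReflection :
    MeasurePreserving (spaceReflection : ℝ × Space k → ℝ × Space k) volume volume :=
  (MeasurePreserving.id (volume : Measure ℝ)).prod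
    (Measure.measurePreserving_neg (volume : Measure (Space k)))

theorem weight_spaceReflection (γ : ℝ) (p : ℝ × Space k) :
    weight γ (spaceReflection p) = weight γ p := by
  simp [weight, spaceReflection]

theorem memLp_weight_mul_spaceTransform_reflection (hk : 1 ≤ k) {γ : ℝ} (hγ : 0 < γ)
    (ψ : 𝓢(ℝ × Space k, ℂ)) :
    MemLp (fun p => weight γ p * spaceTransform ψ (spaceReflection p)) 2 := by
  have := (memLp_weight_mul_spaceTransform hk hγ ψ).comp_measurePreserving
    measurePreserving_spaceReflection
  simpa only [Function.comp_def, weight_spaceReflection] using this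

theorem integrable_mul_spaceTransform_reflection (hk : 1 ≤ k) {γ : ℝ} (hγk : γ ≤ k)
    {H : ℝ × Space k → ℂ} (hH : MemLp (fun p => weight γ p * H p) 2) (ψ : 𝓢(ℝ × Space k, ℂ)) :
    Integrable fun p => H p * spaceTransform ψ (spaceReflection p) := by
  have hk0 : (1 : ℝ) ≤ k := by exact_mod_cast hk
  refine (hH.integrable_mul (memLp_weight_mul_spaceTransform_reflection hk
    (γ := 2 * k - γ) (by linarith) ψ)).congr ?_
  filter_upwards [ae_snd_ne_zero hk] with p hp
  simp only [Pi.mul_apply]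
  linear_combination H p * spaceTransform ψ (spaceReflection p) * weight_mul_weight γ hp

theorem integral_weighted_pairing (hk : 1 ≤ k) (γ : ℝ) (H K : ℝ × Space k → ℂ) :
    ∫ p, (weight γ p * H p) * (weight (2 * k - γ) p * K p) = ∫ p, H p * K p := by
  refine integral_congr_ae ?_
  filter_upwards [ae_snd_ne_zero hk] with p hp
  linear_combination H p * K p * weight_mul_weight γ hp

/-- The pairing of a test function and a Schwartz function, in Fourier variables. -/
theorem integral_mul_eq_integral_spaceTransform (hk : 1 ≤ k) {φ : ℝ × Space k → ℝ}
    (hφ : IsTestFunction φ) (ψ : 𝓢(ℝ × Space k, ℂ)) :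
    ∫ p, (φ p : ℂ) * ψ p = ∫ p, spaceTransform (fun p => (φ p : ℂ)) p *
      spaceTransform ψ (spaceReflection p) := by
  have hk0 : (0 : ℝ) < k := by exact_mod_cast hk
  have h1 : Integrable fun p : ℝ × Space k => (φ p : ℂ) * ψ p := by
    refine ψ.integrable.bdd_mul (c := SchwartzMap.seminorm ℂ 0 0 hφ.toSchwartz)
      hφ.toSchwartz.continuous.aestronglyMeasurable (Eventually.of_forall fun p => ?_)
    exact SchwartzMap.norm_le_seminorm ℂ hφ.toSchwartz p
  have h2 := integrable_mul_spaceTransform_reflection hk le_rfl (hφ.memLp_weight_mul hk hk0) ψ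
  rw [Measure.volume_eq_prod] at h1 h2 ⊢
  rw [integral_prod _ h1, integral_prod _ h2]
  refine integral_congr_ae (Eventually.of_forall fun s => ?_)
  have h3 := SchwartzMap.integral_fourier_mul_eq (slice hφ.toSchwartz s) (𝓕⁻ (slice ψ s))
  rw [FourierTransform.fourier_fourierInv_eq] at h3
  calc ∫ y, (φ (s, y) : ℂ) * ψ (s, y) = ∫ y, slice hφ.toSchwartz s y * slice ψ s y := rfl
    _ = _ := h3.symm
    _ = _ := by
      refine integral_congr_ae (Eventually.of_forall fun η => ?_)
      simp only [SchwartzMap.fourierInv_coe, Real.fourierInv_eq_fourier_neg]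
      rfl

/-- The wave kernel paired with a Schwartz function, in Fourier variables. -/
theorem truncatedKernel_eq_integral (hk : 1 ≤ k) {t : ℝ} (ht : 0 ≤ t) (x : Space k)
    (ψ : 𝓢(ℝ × Space k, ℂ)) :
    truncatedKernel t x ψ =
      ∫ p, kernelTransform t x p * spaceTransform ψ (spaceReflection p) := by
  have h2 := integrable_mul_spaceTransform_reflection hk (γ := 1) (by exact_mod_cast hk)
    (memLp_weight_mul_kernelTransform hk one_pos one_lt_two t x) ψ
  rw [Measure.volume_eq_prod] at h2 ⊢
  rw [integral_prod _ h2, truncatedKernel, intervalIntegral.integral_of_le ht,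
    ← integral_indicator measurableSet_Ioc]
  refine integral_congr_ae (Eventually.of_forall fun s => ?_)
  by_cases hs : s ∈ Set.Ioc 0 t
  · simp only [Set.indicator_of_mem hs, waveKernel, kernelTransform]
    rw [← integral_neg_eq_self]
    refine integral_congr_ae (Eventually.of_forall fun η => ?_)
    have h4 : 𝓕⁻ (fun y => ψ (s, x - y)) (-η) =
        Complex.exp ((-2 * Real.pi * inner ℝ x η : ℝ) * Complex.I) *
          𝓕 (fun y => ψ (s, y)) (-η) := by
      rw [Real.fourierInv_eq', Real.fourier_eq', ← integral_sub_left_eq_self _ volume x,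
        ← integral_const_mul]
      refine integral_congr_ae (Eventually.of_forall fun y => ?_)
      simp only [smul_eq_mul, sub_sub_cancel, ← mul_assoc, ← Complex.exp_add]
      congr 2
      rw [inner_sub_left, inner_neg_right, inner_neg_right]
      push_cast
      ring
    simp only [norm_neg, h4, mul_assoc]
    rfl
  · simp [Set.indicator_of_notMem hs, kernelTransform]

theorem tendsto_integral_mul_of_tendsto_eLpNorm {α : Type*} [MeasurableSpace α] {μ : Measure α}
    {f : ℕ → α → ℂ} {f' g : α → ℂ} (hf : ∀ n, MemLp (f n) 2 μ) (hf' : MemLp f' 2 μ)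
    (hg : MemLp g 2 μ) (h : Tendsto (fun n => eLpNorm (fun a => f n a - f' a) 2 μ) atTop (𝓝 0)) :
    Tendsto (fun n => ∫ a, f n a * g a ∂μ) atTop (𝓝 (∫ a, f' a * g a ∂μ)) := by
  have hg' : MemLp (fun a => (starRingEnd ℂ) (g a)) 2 μ := hg.star
  have := tendsto_integral_inner_of_tendsto_eLpNorm ℂ (fun _ => hg') hf hg' hf'
    (by simp) h
  simpa using this

/-- Weighted `L²` convergence in Fourier variables implies convergence to the wave kernel as
tempered distributions. -/
theorem tendsto_integral_truncatedKernel (hk : 1 ≤ k) {β : ℝ} (hβ : 0 < β) (hβ2 : β < 2)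
    (hβk : β ≤ k) {t : ℝ} (ht : 0 ≤ t) (x : Space k) {φ : ℕ → ℝ × Space k → ℝ}
    (hφ : ∀ n, IsTestFunction (φ n))
    (h : Tendsto (fun n => eLpNorm (fun p => weight β p * spaceTransform (fun p => (φ n p : ℂ)) p -
      weight β p * kernelTransform t x p) 2) atTop (𝓝 0)) (ψ : 𝓢(ℝ × Space k, ℂ)) :
    Tendsto (fun n => ∫ p, (φ n p : ℂ) * ψ p) atTop (𝓝 (truncatedKernel t x ψ)) := by
  have hk0 : (1 : ℝ) ≤ k := by exact_mod_cast hk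
  have := tendsto_integral_mul_of_tendsto_eLpNorm (fun n => (hφ n).memLp_weight_mul hk hβ)
    (memLp_weight_mul_kernelTransform hk hβ hβ2 t x)
    (memLp_weight_mul_spaceTransform_reflection hk (γ := 2 * k - β) (by linarith) ψ) h
  simp only [integral_weighted_pairing hk] at this
  rw [truncatedKernel_eq_integral hk ht]
  simpa only [fun n => integral_mul_eq_integral_spaceTransform hk (hφ n) ψ] using this

end WaveField

/-! ### Completeness of the space transforms of test functions -/

section Completeness

variable {k : ℕ}

theorem isTestFunction_mul {a : ℝ → ℝ} {b : Space k → ℝ} (ha : ContDiff ℝ ((⊤ : ℕ∞) : WithTop ℕ∞) a)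
    (hb : ContDiff ℝ ((⊤ : ℕ∞) : WithTop ℕ∞) b) (ha' : HasCompactSupport a)
    (hb' : HasCompactSupport b) : IsTestFunction fun p : ℝ × Space k => a p.1 * b p.2 := by
  refine ⟨(ha.comp contDiff_fst).mul (hb.comp contDiff_snd), ?_⟩
  refine HasCompactSupport.of_support_subset_isCompact (ha'.isCompact.prod hb'.isCompact)
    fun p hp => ?_
  rw [Function.mem_support] at hp
  exact ⟨subset_tsupport _ (left_ne_zero_of_mul hp), subset_tsupport _ (right_ne_zero_of_mul hp)⟩

/-- Translations in space become modulations in frequency. -/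
theorem spaceTransform_mul_translate (a : ℝ → ℝ) (b : Space k → ℝ) (z : Space k)
    (p : ℝ × Space k) :
    spaceTransform (fun q => ((a q.1 * b (q.2 - z) : ℝ) : ℂ)) p =
      a p.1 * (Complex.exp ((-2 * Real.pi * inner ℝ z p.2 : ℝ) * Complex.I) *
        𝓕 (fun y => (b y : ℂ)) p.2) := by
  simp only [spaceTransform, Real.fourier_eq']
  rw [← integral_add_right_eq_self _ z, ← integral_const_mul, ← integral_const_mul]
  refine integral_congr_ae (Eventually.of_forall fun y => ?_)
  simp only [smul_eq_mul, add_sub_cancel_right, inner_add_left]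
  have : Complex.exp (((-2 * Real.pi * (inner ℝ y p.2 + inner ℝ z p.2) : ℝ) : ℂ) * Complex.I) =
      Complex.exp (((-2 * Real.pi * inner ℝ z p.2 : ℝ) : ℂ) * Complex.I) *
      Complex.exp (((-2 * Real.pi * inner ℝ y p.2 : ℝ) : ℂ) * Complex.I) := by
    rw [← Complex.exp_add]; congr 1; push_cast; ring
  rw [this]
  push_cast
  ring

theorem exists_bump_of_pos (k : ℕ) {r : ℝ} (hr : 0 < r) :
    ∃ b : Space k → ℝ, ContDiff ℝ ((⊤ : ℕ∞) : WithTop ℕ∞) b ∧ HasCompactSupport b ∧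
      (∀ y, 0 ≤ b y) ∧ b 0 = 1 ∧ ∀ y, b y ≠ 0 → ‖y‖ < r := by
  obtain ⟨b, rfl⟩ : ∃ b : ContDiffBump (0 : Space k), b.rOut = r :=
    ⟨⟨r / 2, r, by positivity, by linarith⟩, rfl⟩
  refine ⟨b, b.contDiff, b.hasCompactSupport, fun _ => b.nonneg,
    b.one_of_mem_closedBall (by simpa using b.rIn_pos.le), fun y hy => ?_⟩
  have : y ∈ Function.support b := hy
  rw [b.support_eq] at this
  simpa using this

/-- A bump function on space whose Fourier transform does not vanish on a given ball. -/
theorem exists_bump_fourier_ne_zero (k n : ℕ) :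
    ∃ b : Space k → ℝ, ContDiff ℝ ((⊤ : ℕ∞) : WithTop ℕ∞) b ∧ HasCompactSupport b ∧
      ∀ η : Space k, ‖η‖ < n + 1 → 𝓕 (fun y => (b y : ℂ)) η ≠ 0 := by
  obtain ⟨b, hbs, hbc, hbn, hb0, hbr⟩ :=
    exists_bump_of_pos k (r := 1 / (4 * (n + 1))) (by positivity)
  have hcont : Continuous b := hbs.continuous
  refine ⟨b, hbs, hbc, fun η hη h0 => ?_⟩
  have hint : Integrable fun y : Space k =>
      Complex.exp (((-2 * Real.pi * inner ℝ y η : ℝ) : ℂ) * Complex.I) • (b y : ℂ) := by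
    have hb : Integrable fun y : Space k => (b y : ℂ) :=
      (hcont.integrable_of_hasCompactSupport hbc).ofReal
    simp only [smul_eq_mul]
    refine hb.bdd_mul (c := 1) (Continuous.aestronglyMeasurable (by fun_prop))
      (Eventually.of_forall fun y => ?_)
    rw [Complex.norm_exp_ofReal_mul_I]
  have h1 : ∫ y, Real.cos (2 * Real.pi * inner ℝ y η) * b y = 0 := by
    have := congrArg Complex.re h0
    rw [Real.fourier_eq', ← RCLike.re_eq_complex_re, ← integral_re hint] at this
    rw [RCLike.re_eq_complex_re, Complex.zero_re] at this
    rw [← this]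
    refine integral_congr_ae (Eventually.of_forall fun y => ?_)
    simp only [smul_eq_mul]
    rw [Complex.re_mul_ofReal, Complex.exp_ofReal_mul_I_re, neg_mul, neg_mul, Real.cos_neg]
  have hcos : ∀ y, b y ≠ 0 → 0 < Real.cos (2 * Real.pi * inner ℝ y η) := by
    intro y hy
    have hy1 := hbr y hy
    have h2 : |inner ℝ y η| < 1 / 4 := by
      refine (abs_real_inner_le_norm y η).trans_lt ?_
      have : ‖y‖ * ‖η‖ < 1 / (4 * (n + 1)) * (n + 1) :=
        mul_lt_mul'' hy1 hη (norm_nonneg _) (norm_nonneg _)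
      calc _ < _ := this
        _ = 1 / 4 := by field_simp
    have h3 := abs_lt.1 h2
    have := Real.pi_pos
    apply Real.cos_pos_of_mem_Ioo
    constructor <;> nlinarith
  have hnn : ∀ y, 0 ≤ Real.cos (2 * Real.pi * inner ℝ y η) * b y := fun y => by
    by_cases hy : b y = 0
    · simp [hy]
    · exact mul_nonneg (hcos y hy).le (hbn y)
  refine absurd h1 (ne_of_gt ?_)
  refine Continuous.integral_pos_of_hasCompactSupport_nonneg_nonzero (x := 0) ?_ ?_ hnn ?_
  · fun_prop
  · exact hbc.mul_left
  · simp [hb0]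

/-- An `L²` function orthogonal to the weighted space transforms of all test functions that vanish
at times outside the open set `U` is zero at times in `U`. -/
theorem ae_eq_zero_of_forall_test (hk : 1 ≤ k) {γ : ℝ} (hγ : 0 < γ) {U : Set ℝ} (hU : IsOpen U)
    {h : ℝ × Space k → ℂ} (hh : MemLp h 2)
    (H : ∀ φ : ℝ × Space k → ℝ, IsTestFunction φ → (∀ p, p.1 ∉ U → φ p = 0) →
      ∫ p, h p * (weight γ p * spaceTransform (fun p => (φ p : ℂ)) p) = 0) :
    ∀ᵐ p : ℝ × Space k, p.1 ∈ U → h p = 0 := by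
  -- localizing functions in time and in frequency
  choose b hb hbc hb0 using exists_bump_fourier_ne_zero k
  have hA : ∀ n : ℕ, ∃ a : ℝ → ℝ, Function.support a = U ∩ Metric.ball 0 n ∧
      ContDiff ℝ ((⊤ : ℕ∞) : WithTop ℕ∞) a := fun n => by
    obtain ⟨a, h1, h2, -⟩ := (hU.inter Metric.isOpen_ball).exists_contDiff_support_eq
      (s := U ∩ Metric.ball 0 n)
    exact ⟨a, h1, h2⟩
  choose a ha0 ha using hA
  have hac : ∀ n, HasCompactSupport (a n) := fun n => by
    refine HasCompactSupport.of_support_subset_isCompact (isCompact_closedBall (0 : ℝ) n) ?_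
    rw [ha0]
    exact Set.inter_subset_right.trans Metric.ball_subset_closedBall
  have key : ∀ n m, ∀ᵐ p : ℝ × Space k,
      h p * (weight γ p * spaceTransform (fun q => ((a n q.1 * b m q.2 : ℝ) : ℂ)) p) = 0 := by
    intro n m
    have htest := isTestFunction_mul (ha n) (hb m) (hac n) (hbc m)
    have hint : Integrable fun p : ℝ × Space k =>
        h p * (weight γ p * spaceTransform (fun q => ((a n q.1 * b m q.2 : ℝ) : ℂ)) p) :=
      hh.integrable_mul (htest.memLp_weight_mul hk hγ)
    refine ae_eq_zero_of_forall_integral_mul_exp hint fun L => ?_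
    let σ : ℝ := L (1, 0)
    let v : Space k := (InnerProductSpace.toDual ℝ (Space k)).symm
      (L.comp (ContinuousLinearMap.inr ℝ ℝ (Space k)))
    let z : Space k := -(2 * Real.pi)⁻¹ • v
    have hL : ∀ p : ℝ × Space k, L p = σ * p.1 + inner ℝ v p.2 := fun p => by
      have e : p = p.1 • ((1 : ℝ), (0 : Space k)) + ContinuousLinearMap.inr ℝ ℝ (Space k) p.2 := by
        ext <;> simp
      conv_lhs => rw [e, map_add, map_smul]
      rw [InnerProductSpace.toDual_symm_apply]
      simp [σ, mul_comm]
    have hz : ∀ η : Space k, -2 * Real.pi * inner ℝ z η = inner ℝ v η := fun η => by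
      simp only [z, inner_smul_left, conj_trivial]
      have := Real.pi_ne_zero
      field_simp
    -- modulations in frequency are translations in space, those in time are multiplications
    have hmod : ∀ c : ℝ → ℝ, ContDiff ℝ ((⊤ : ℕ∞) : WithTop ℕ∞) c → ∫ p : ℝ × Space k,
        h p * (weight γ p * (((a n p.1 * c p.1 : ℝ) : ℂ) *
          (Complex.exp ((inner ℝ v p.2 : ℝ) * Complex.I) * 𝓕 (fun y => (b m y : ℂ)) p.2))) = 0 ∧
        Integrable fun p : ℝ × Space k =>
          h p * (weight γ p * (((a n p.1 * c p.1 : ℝ) : ℂ) *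
          (Complex.exp ((inner ℝ v p.2 : ℝ) * Complex.I) * 𝓕 (fun y => (b m y : ℂ)) p.2)))  := by
      intro c hc
      have ht := isTestFunction_mul (a := fun s => a n s * c s) (b := fun y => b m (y - z))
        ((ha n).mul hc) ((hb m).comp (by fun_prop)) (hac n).mul_right
        ((hbc m).comp_homeomorph (Homeomorph.subRight z))
      have h1 := H _ ht fun p hp => by
        have : a n p.1 = 0 := by
          by_contra hne
          have : p.1 ∈ Function.support (a n) := hne
          rw [ha0] at this
          exact hp this.1
        simp [this]
      have h2 := hh.integrable_mul (ht.memLp_weight_mul hk hγ)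
      have e : ∀ p : ℝ × Space k,
          spaceTransform (fun q => ((a n q.1 * c q.1 * b m (q.2 - z) : ℝ) : ℂ)) p =
          ((a n p.1 * c p.1 : ℝ) : ℂ) *
          (Complex.exp ((inner ℝ v p.2 : ℝ) * Complex.I) * 𝓕 (fun y => (b m y : ℂ)) p.2) :=
        fun p => by
          rw [← hz]
          exact spaceTransform_mul_translate (fun s => a n s * c s) (b m) z p
      simp only [e] at h1
      refine ⟨h1, h2.congr (Eventually.of_forall fun p => ?_)⟩
      simp only [Pi.mul_apply, e]
    obtain ⟨c1, c2⟩ := hmod (fun s => Real.cos (σ * s)) (by fun_prop)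
    obtain ⟨s1, s2⟩ := hmod (fun s => Real.sin (σ * s)) (by fun_prop)
    have hsplit : ∀ p : ℝ × Space k,
        h p * (weight γ p * spaceTransform (fun q => ((a n q.1 * b m q.2 : ℝ) : ℂ)) p) *
          Complex.exp (L p * Complex.I) =
        h p * (weight γ p * (((a n p.1 * Real.cos (σ * p.1) : ℝ) : ℂ) *
          (Complex.exp ((inner ℝ v p.2 : ℝ) * Complex.I) * 𝓕 (fun y => (b m y : ℂ)) p.2))) +
        Complex.I * (h p * (weight γ p * (((a n p.1 * Real.sin (σ * p.1) : ℝ) : ℂ) *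
          (Complex.exp ((inner ℝ v p.2 : ℝ) * Complex.I) * 𝓕 (fun y => (b m y : ℂ)) p.2)))) := by
      intro p
      have e0 := spaceTransform_mul_translate (a n) (b m) 0 p
      simp only [sub_zero, inner_zero_left, mul_zero, Complex.ofReal_zero, zero_mul,
        Complex.exp_zero, one_mul] at e0
      have e1 : Complex.exp (L p * Complex.I) = (Complex.cos (σ * p.1) +
          Complex.sin (σ * p.1) * Complex.I) * Complex.exp ((inner ℝ v p.2 : ℝ) * Complex.I) := by
        rw [← Complex.exp_mul_I, ← Complex.exp_add, hL]
        congr 1; push_cast; ring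
      rw [e0, e1]
      push_cast
      ring
    simp only [hsplit]
    rw [integral_add c2 (s2.const_mul _), integral_const_mul, c1, s1]
    simp
  have hall : ∀ᵐ p : ℝ × Space k, ∀ n m,
      h p * (weight γ p * spaceTransform (fun q => ((a n q.1 * b m q.2 : ℝ) : ℂ)) p) = 0 := by
    rw [ae_all_iff]; intro n; rw [ae_all_iff]; exact key n
  filter_upwards [hall, ae_snd_ne_zero hk] with p hp hp0 hpU
  obtain ⟨n, hn⟩ := exists_nat_gt ‖p.1‖
  obtain ⟨m, hm⟩ := exists_nat_gt ‖p.2‖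
  have h1 := hp n m
  have e0 := spaceTransform_mul_translate (a n) (b m) 0 p
  simp only [sub_zero, inner_zero_left, mul_zero, Complex.ofReal_zero, zero_mul,
    Complex.exp_zero, one_mul] at e0
  rw [e0] at h1
  have h2 : a n p.1 ≠ 0 := by
    have : p.1 ∈ Function.support (a n) := by
      rw [ha0]; exact ⟨hpU, by simpa using hn⟩
    exact this
  have h3 := hb0 m p.2 (by linarith)
  have h4 : weight γ p ≠ 0 := by
    rw [← norm_ne_zero_iff, norm_weight]
    have := norm_pos_iff.2 hp0
    positivity
  rcases mul_eq_zero.1 h1 with h5 | h5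
  · exact h5
  · exact absurd h5 (mul_ne_zero h4 (mul_ne_zero (by exact_mod_cast h2) h3))

end Completeness

/-! ### Approximation by test functions -/

section Density

variable {k : ℕ}

theorem IsTestFunction.add {φ ψ : ℝ × Space k → ℝ} (hφ : IsTestFunction φ) (hψ : IsTestFunction ψ) :
    IsTestFunction fun p => φ p + ψ p :=
  ⟨hφ.1.add hψ.1, hφ.2.add hψ.2⟩

theorem IsTestFunction.const_mul {φ : ℝ × Space k → ℝ} (hφ : IsTestFunction φ) (c : ℝ) :
    IsTestFunction fun p => c * φ p :=
  ⟨contDiff_const.mul hφ.1, hφ.2.mul_left⟩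

theorem IsTestFunction.zero : IsTestFunction fun _ : ℝ × Space k => (0 : ℝ) :=
  ⟨contDiff_const, HasCompactSupport.zero⟩

theorem IsTestFunction.integrable_slice {φ : ℝ × Space k → ℝ} (hφ : IsTestFunction φ) (s : ℝ) :
    Integrable fun y => (φ (s, y) : ℂ) :=
  (slice hφ.toSchwartz s).integrable

theorem IsTestFunction.spaceTransform_add {φ ψ : ℝ × Space k → ℝ} (hφ : IsTestFunction φ)
    (hψ : IsTestFunction ψ) (p : ℝ × Space k) :
    spaceTransform (fun p => ((φ p + ψ p : ℝ) : ℂ)) p =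
      spaceTransform (fun p => (φ p : ℂ)) p + spaceTransform (fun p => (ψ p : ℂ)) p := by
  have hint : ∀ {φ : ℝ × Space k → ℝ}, IsTestFunction φ → Integrable fun y : Space k =>
      Complex.exp (((-2 * Real.pi * inner ℝ y p.2 : ℝ) : ℂ) * Complex.I) • (φ (p.1, y) : ℂ) := by
    intro φ hφ
    simp only [smul_eq_mul]
    refine (hφ.integrable_slice p.1).bdd_mul (c := 1)
      (Continuous.aestronglyMeasurable (by fun_prop)) (Eventually.of_forall fun y => ?_)
    rw [Complex.norm_exp_ofReal_mul_I]
  simp only [spaceTransform, Real.fourier_eq']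
  rw [← integral_add (hint hφ) (hint hψ)]
  simp only [Complex.ofReal_add, smul_add]

theorem spaceTransform_const_mul (φ : ℝ × Space k → ℝ) (c : ℝ) (p : ℝ × Space k) :
    spaceTransform (fun p => ((c * φ p : ℝ) : ℂ)) p =
      c * spaceTransform (fun p => (φ p : ℂ)) p := by
  simp only [spaceTransform, Real.fourier_eq']
  rw [← integral_const_mul]
  congr 1; ext y
  simp only [smul_eq_mul, Complex.ofReal_mul]; ring

/-- The space transform of a real function is Hermitian. -/
theorem spaceTransform_spaceReflection (φ : ℝ × Space k → ℝ) (p : ℝ × Space k) :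
    spaceTransform (fun p => (φ p : ℂ)) (spaceReflection p) =
      (starRingEnd ℂ) (spaceTransform (fun p => (φ p : ℂ)) p) := by
  simp only [spaceTransform, spaceReflection, Real.fourier_eq']
  rw [← integral_conj]
  congr 1; ext y
  simp only [smul_eq_mul, map_mul, Complex.conj_ofReal, ← Complex.exp_conj, Complex.conj_I,
    inner_neg_right]
  congr 2; push_cast; ring

theorem conj_weight (γ : ℝ) (p : ℝ × Space k) :
    (starRingEnd ℂ) (weight γ p) = weight γ p := by
  rw [weight, Complex.conj_ofReal]

theorem kernelTransform_spaceReflection (t : ℝ) (x : Space k) (p : ℝ × Space k) :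
    kernelTransform t x (spaceReflection p) = (starRingEnd ℂ) (kernelTransform t x p) := by
  by_cases hp : p.1 ∈ Set.Ioc 0 t
  · simp only [kernelTransform, spaceReflection, Set.indicator_of_mem hp, map_mul,
      Complex.conj_ofReal, ← Complex.exp_conj, Complex.conj_I, inner_neg_right, norm_neg]
    congr 2; push_cast; ring
  · simp [kernelTransform, spaceReflection, hp]

theorem integral_comp_spaceReflection (f : ℝ × Space k → ℂ) :
    ∫ p, f (spaceReflection p) = ∫ p, f p := by
  have e : MeasurableEmbedding (spaceReflection : ℝ × Space k → ℝ × Space k) :=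
    MeasurableEquiv.measurableEmbedding
      ((MeasurableEquiv.refl ℝ).prodCongr (MeasurableEquiv.neg (Space k)))
  exact measurePreserving_spaceReflection.integral_comp e f

/-- Square integrable Hermitian functions are `L²` limits of weighted space transforms of real test
functions. Over the reals, a function orthogonal to all these transforms has vanishing Hermitian
part, hence is orthogonal to every Hermitian function. -/
theorem exists_test_tendsto (hk : 1 ≤ k) {γ : ℝ} (hγ : 0 < γ) {g : ℝ × Space k → ℂ}
    (hg : MemLp g 2) (hsym : ∀ p, g (spaceReflection p) = (starRingEnd ℂ) (g p)) :
    ∃ φ : ℕ → ℝ × Space k → ℝ, (∀ n, IsTestFunction (φ n)) ∧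
      Tendsto (fun n => eLpNorm (fun p => weight γ p * spaceTransform (fun p => (φ n p : ℂ)) p -
        g p) 2) atTop (𝓝 0) := by
  let S : Submodule ℝ (Lp ℂ 2 (volume : Measure (ℝ × Space k))) :=
    { carrier := {f | ∃ φ : ℝ × Space k → ℝ, IsTestFunction φ ∧
        f =ᵐ[volume] fun p => weight γ p * spaceTransform (fun p => (φ p : ℂ)) p}
      add_mem' := by
        rintro f f' ⟨φ, hφ, h⟩ ⟨φ', hφ', h'⟩
        refine ⟨_, hφ.add hφ', ?_⟩
        filter_upwards [h, h', Lp.coeFn_add f f'] with p hp hp' hs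
        rw [hs, Pi.add_apply, hp, hp', hφ.spaceTransform_add hφ', mul_add]
      zero_mem' := by
        refine ⟨_, IsTestFunction.zero, ?_⟩
        filter_upwards [Lp.coeFn_zero ℂ 2 (volume : Measure (ℝ × Space k))] with p hp
        rw [hp]
        simp [spaceTransform, Real.fourier_eq']
      smul_mem' := by
        rintro c f ⟨φ, hφ, h⟩
        refine ⟨_, hφ.const_mul c, ?_⟩
        filter_upwards [h, Lp.coeFn_smul c f] with p hp hs
        rw [hs, Pi.smul_apply, hp, spaceTransform_const_mul, Complex.real_smul]
        ring }
  have hcl : hg.toLp g ∈ S.topologicalClosure := by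
    rw [← Submodule.orthogonal_orthogonal_eq_closure, Submodule.mem_orthogonal]
    intro h hh
    rw [Submodule.mem_orthogonal'] at hh
    have hmem : MemLp (h : ℝ × Space k → ℂ) 2 := Lp.memLp h
    have hrefl : MemLp (fun p => h (spaceReflection p)) 2 :=
      hmem.comp_measurePreserving measurePreserving_spaceReflection
    have hpart : MemLp (fun p => (starRingEnd ℂ) (h p) + h (spaceReflection p)) 2 :=
      hmem.star.add hrefl
    -- for Hermitian `f`, twice the real inner product with `h` only sees the Hermitian part of `h`
    have key : ∀ f : ℝ × Space k → ℂ, MemLp f 2 →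
        (∀ p, f (spaceReflection p) = (starRingEnd ℂ) (f p)) →
        ∫ p, ((starRingEnd ℂ) (h p) + h (spaceReflection p)) * f p =
          ((2 * ∫ p, inner ℝ (h p) (f p) : ℝ) : ℂ) := by
      intro f hf hfs
      have i1 : Integrable fun p => (starRingEnd ℂ) (h p) * f p := hmem.star.integrable_mul hf
      have i2 : Integrable fun p => h (spaceReflection p) * f p := hrefl.integrable_mul hf
      have e2 : ∫ p, h (spaceReflection p) * f p =
          (starRingEnd ℂ) (∫ p, (starRingEnd ℂ) (h p) * f p) := by
        rw [← integral_conj, ← integral_comp_spaceReflection (fun p =>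
          (starRingEnd ℂ) ((starRingEnd ℂ) (h p) * f p))]
        simp only [hfs, map_mul, Complex.conj_conj]
      have e3 : ∫ p, inner ℝ (h p) (f p) = (∫ p, (starRingEnd ℂ) (h p) * f p).re := by
        rw [← RCLike.re_eq_complex_re, ← integral_re i1]
        congr 1; ext p
        rw [Complex.inner, mul_comm]; rfl
      simp only [add_mul]
      rw [integral_add i1 i2, e2, Complex.add_conj, e3]
    have hzero : ∀ᵐ p : ℝ × Space k, p.1 ∈ Set.univ →
        (starRingEnd ℂ) (h p) + h (spaceReflection p) = 0 := by
      refine ae_eq_zero_of_forall_test hk hγ isOpen_univ hpart fun φ hφ _ => ?_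
      have hm := hφ.memLp_weight_mul hk hγ
      have h0 := hh (hm.toLp _) ⟨φ, hφ, hm.coeFn_toLp⟩
      rw [L2.inner_def] at h0
      rw [key _ hm (fun p => by
        rw [weight_spaceReflection, spaceTransform_spaceReflection, map_mul, conj_weight])]
      have h1 : ∫ p, inner ℝ (h p) (weight γ p * spaceTransform (fun p => (φ p : ℂ)) p) = 0 := by
        rw [← h0]
        refine integral_congr_ae ?_
        filter_upwards [hm.coeFn_toLp] with p hp
        rw [hp]
      rw [h1, mul_zero, Complex.ofReal_zero]
    have hfin := key g hg hsym
    rw [integral_eq_zero_of_ae (by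
      filter_upwards [hzero] with p hp
      rw [hp (Set.mem_univ _), zero_mul]; rfl)] at hfin
    have : ∫ p, inner ℝ (h p) (g p) = 0 := by
      have := Complex.ofReal_eq_zero.1 hfin.symm
      linarith
    rw [L2.inner_def, ← this]
    refine integral_congr_ae ?_
    filter_upwards [hg.coeFn_toLp] with p hp
    rw [hp]
  obtain ⟨f, hfS, hf⟩ := mem_closure_iff_seq_limit.1 hcl
  choose φ hφ hfφ using hfS
  refine ⟨φ, hφ, ?_⟩
  rw [Lp.tendsto_Lp_iff_tendsto_eLpNorm'] at hf
  refine hf.congr fun n => eLpNorm_congr_ae ?_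
  filter_upwards [hfφ n, hg.coeFn_toLp] with p hp hp'
  simp only [Pi.sub_apply]
  rw [hp, hp']

end Density

/-! ### The harmonizable field is a mild solution -/

section MildSolution

variable {k d : ℕ} {Ω : Type*} [MeasurableSpace Ω] {P : Measure Ω}
  {W : Fin d → Set (ℝ × Space k) → Ω → ℂ}

theorem integral_norm_sq_weight_mul_timeTransform (β : ℝ) {H : ℝ × Space k → ℂ}
    (h : IsTimeBounded H) (hH : MemLp (fun p => weight β p * H p) 2) :
    ∫ p, ‖weight β p * timeTransform H p‖ ^ 2 =
      (2 * Real.pi) ^ (β + 1) * ∫ p, ‖weight β p * H p‖ ^ 2 := by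
  have h1 := eLpNorm_weight_mul_timeTransform β h
  rw [eLpNorm_two_sq_eq hH, eLpNorm_two_sq_eq (memLp_weight_mul_timeTransform β h hH),
    ← ENNReal.ofReal_mul (by positivity)] at h1
  exact (ENNReal.ofReal_eq_ofReal_iff (integral_nonneg fun _ => by positivity)
    (mul_nonneg (by positivity) (integral_nonneg fun _ => by positivity))).1 h1

theorem integral_inner_eq_polarization {α : Type*} [MeasurableSpace α] {μ : Measure α}
    {f g : α → ℂ} (hf : MemLp f 2 μ) (hg : MemLp g 2 μ) :
    ∫ a, inner ℝ (f a) (g a) ∂μ =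
      (∫ a, ‖f a + g a‖ ^ 2 ∂μ - ∫ a, ‖f a‖ ^ 2 ∂μ - ∫ a, ‖g a‖ ^ 2 ∂μ) / 2 := by
  have i1 : Integrable (fun a => ‖f a + g a‖ ^ 2) μ := (hf.add hg).integrable_norm_pow (by norm_num)
  have i2 : Integrable (fun a => ‖f a‖ ^ 2) μ := hf.integrable_norm_pow (by norm_num)
  have i3 : Integrable (fun a => ‖g a‖ ^ 2) μ := hg.integrable_norm_pow (by norm_num)
  have i12 : Integrable (fun a => ‖f a + g a‖ ^ 2 - ‖f a‖ ^ 2) μ := i1.sub i2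
  rw [← integral_sub i1 i2, ← integral_sub i12 i3, ← integral_div]
  refine integral_congr_ae (Eventually.of_forall fun a => ?_)
  simp only [norm_add_sq_real]
  ring

theorem integral_inner_weight_mul_timeTransform (β : ℝ) {H H' : ℝ × Space k → ℂ}
    (h : IsTimeBounded H) (h' : IsTimeBounded H') (hH : MemLp (fun p => weight β p * H p) 2)
    (hH' : MemLp (fun p => weight β p * H' p) 2) :
    ∫ p, inner ℝ (weight β p * timeTransform H p) (weight β p * timeTransform H' p) =
      (2 * Real.pi) ^ (β + 1) * ∫ p, inner ℝ (weight β p * H p) (weight β p * H' p) := by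
  have hadd := integral_norm_sq_weight_mul_timeTransform β (h.add h')
    (by simp only [mul_add]; exact hH.add hH')
  simp only [timeTransform_add h h', mul_add] at hadd
  rw [integral_inner_eq_polarization hH hH', integral_inner_eq_polarization
    (memLp_weight_mul_timeTransform β h hH) (memLp_weight_mul_timeTransform β h' hH'),
    hadd, integral_norm_sq_weight_mul_timeTransform β h hH,
    integral_norm_sq_weight_mul_timeTransform β h' hH']
  ring

theorem waveF_zero (x : Space k) (p : ℝ × Space k) : waveF 0 x p = 0 := by
  simp [waveF]

theorem IsComplexWhiteNoise.isWienerIntegral_tildeNoise (hW : IsComplexWhiteNoise W P)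
    (hk : 1 ≤ k) {β : ℝ} (hβ : 0 < β) (j : Fin d) {φ : ℝ × Space k → ℝ} (hφ : IsTestFunction φ) :
    IsWienerIntegral (W j) P (fun p => weight β p * fourierST φ p) (tildeNoise β W P j φ) :=
  hW.isWienerIntegral_wienerIntegral j (memLp_weight_mul_fourierST hk hβ hφ)

theorem IsComplexWhiteNoise.isWienerIntegral_harmonizableField (hW : IsComplexWhiteNoise W P)
    (hk : 1 ≤ k) {β : ℝ} (hβ : 0 < β) (hβ2 : β < 2) {t : ℝ} (ht : 0 ≤ t) (x : Space k) (j : Fin d) :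
    IsWienerIntegral (W j) P (fun p => weight β p * waveF t x p)
      (fun ω => harmonizableField β W P t x ω j) :=
  hW.isWienerIntegral_wienerIntegral j (memLp_weight_mul_waveF hk hβ hβ2 ht x)

theorem tendsto_eLpNorm_weight_mul_timeTransform (β : ℝ) {H : ℕ → ℝ × Space k → ℂ}
    {H' : ℝ × Space k → ℂ} (h : ∀ n, IsTimeBounded (H n)) (h' : IsTimeBounded H')
    (hlim : Tendsto (fun n => eLpNorm (fun p => weight β p * H n p - weight β p * H' p) 2) atTop
      (𝓝 0)) :
    Tendsto (fun n => eLpNorm (fun p => weight β p * timeTransform (H n) p -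
      weight β p * timeTransform H' p) 2) atTop (𝓝 0) := by
  have hsq : Tendsto (fun n => eLpNorm (fun p => weight β p * timeTransform (H n) p -
      weight β p * timeTransform H' p) 2 ^ 2) atTop (𝓝 0) := by
    have e : ∀ n, eLpNorm (fun p => weight β p * timeTransform (H n) p -
        weight β p * timeTransform H' p) 2 ^ 2 = ENNReal.ofReal ((2 * Real.pi) ^ (β + 1)) *
        eLpNorm (fun p => weight β p * H n p - weight β p * H' p) 2 ^ 2 := fun n => by
      have := eLpNorm_weight_mul_timeTransform β ((h n).sub h')
      simpa only [timeTransform_sub (h n) h', mul_sub] using this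
    simp only [e]
    have := ENNReal.Tendsto.const_mul (a := ENNReal.ofReal ((2 * Real.pi) ^ (β + 1)))
      (ENNReal.Tendsto.pow (n := 2) hlim) (Or.inr ENNReal.ofReal_ne_top)
    simpa using this
  have h3 := hsq.ennrpow_const (2⁻¹ : ℝ)
  rw [ENNReal.zero_rpow_of_pos (by norm_num)] at h3
  refine h3.congr fun n => ?_
  rw [← ENNReal.rpow_natCast, ← ENNReal.rpow_mul]
  norm_num

/-- The weighted transform of the wave kernel is a limit of those of real test functions. By
Plancherel in time their images under the noise converge to the field, and the test functions
converge to the kernel as distributions. -/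
theorem IsComplexWhiteNoise.isMildWaveSolution (hW : IsComplexWhiteNoise W P)
    (hk : 1 ≤ k) {β : ℝ} (hβ : 0 < β) (hβ2 : β < 2) (hβk : β ≤ k) :
    IsMildWaveSolution (tildeNoise β W P) P (harmonizableField β W P) where
  initial x j := by
    have h0 : IsWienerIntegral (W j) P (fun _ => 0) (fun _ => 0) := by
      refine ⟨MemLp.zero', MemLp.zero', fun _ => 0, fun _ => MemLp.zero', ?_, ?_⟩
      · simp
      · simp [simpleIntegral]
    have h1 := hW.isWienerIntegral_harmonizableField hk hβ hβ2 le_rfl x j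
    simp only [waveF_zero, mul_zero] at h1
    have h2 := hW.eLpNorm_sub_le j h1 h0
    simp only [sub_zero] at h2
    have h3 : eLpNorm (fun ω => harmonizableField β W P 0 x ω j) 2 P = 0 := by simpa using h2
    exact (eLpNorm_eq_zero_iff h1.2.1.1 (by norm_num)).1 h3
  mild t ht x j := by
    have hX := hW.isWienerIntegral_harmonizableField hk hβ hβ2 ht x j
    obtain ⟨φ, hφ, hlim⟩ := exists_test_tendsto hk hβ
      (memLp_weight_mul_kernelTransform hk hβ hβ2 t x) (fun p => by
        rw [weight_spaceReflection, kernelTransform_spaceReflection, map_mul, conj_weight])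
    refine ⟨hX.2.1, φ, hφ, tendsto_integral_truncatedKernel hk hβ hβ2 hβk ht x hφ hlim, ?_⟩
    have h1 := tendsto_eLpNorm_weight_mul_timeTransform β (fun n => (hφ n).isTimeBounded)
      (isTimeBounded_kernelTransform t x) hlim
    have h2 := ENNReal.Tendsto.const_mul (a := (NNReal.sqrt 2 : ℝ≥0∞)) h1
      (Or.inr ENNReal.coe_ne_top)
    rw [mul_zero] at h2
    refine tendsto_of_tendsto_of_tendsto_of_le_of_le tendsto_const_nhds h2 (fun _ => zero_le)
      fun n => (hW.eLpNorm_sub_le j (hW.isWienerIntegral_tildeNoise hk hβ j (hφ n)) hX).trans ?_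
    refine le_of_eq (congrArg _ (eLpNorm_congr_ae ?_))
    filter_upwards [waveF_ae_eq hk ht x] with p hp
    rw [hp, fourierST_eq_timeTransform (hφ n)]

end MildSolution

/-! ### The Fourier transform of the Riesz kernel -/

section Riesz

variable {k : ℕ}

theorem integral_rpow_mul_exp_gaussian {a r : ℝ} (ha : 0 < a) (hr : 0 < r) :
    ∫ u in Set.Ioi (0 : ℝ), u ^ (a - 1) * Real.exp (-(Real.pi * u * r ^ 2)) =
      Real.Gamma a * Real.pi ^ (-a) * r ^ (-(2 * a)) := by
  have h := Real.integral_rpow_mul_exp_neg_mul_Ioi ha (r := Real.pi * r ^ 2) (by positivity)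
  have e : ∀ u : ℝ, Real.pi * u * r ^ 2 = Real.pi * r ^ 2 * u := fun u => by ring
  simp only [e]
  rw [h, one_div, Real.inv_rpow (by positivity), ← Real.rpow_neg (by positivity),
    Real.mul_rpow Real.pi_pos.le (by positivity), ← Real.rpow_natCast, ← Real.rpow_mul hr.le]
  push_cast
  ring_nf

theorem integrableOn_rpow_mul_exp_gaussian {a r : ℝ} (ha : 0 < a) (hr : 0 < r) :
    IntegrableOn (fun u => u ^ (a - 1) * Real.exp (-(Real.pi * u * r ^ 2))) (Set.Ioi 0) := by
  refine Integrable.of_integral_ne_zero ?_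
  rw [integral_rpow_mul_exp_gaussian ha hr]
  have := Real.Gamma_pos_of_pos ha
  positivity

theorem exists_norm_mul_one_add_norm_pow_le (h : 𝓢(Space k, ℂ)) (n : ℕ) :
    ∃ C, ∀ x, ‖h x‖ * (1 + ‖x‖) ^ n ≤ C := by
  refine ⟨2 ^ n * ((Finset.Iic (n, 0)).sup fun m => SchwartzMap.seminorm ℂ m.1 m.2) h, fun x => ?_⟩
  have h2 := SchwartzMap.one_add_le_sup_seminorm_apply (𝕜 := ℂ) (m := (n, 0)) le_rfl le_rfl h x
  rwa [norm_iteratedFDeriv_zero, mul_comm] at h2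

theorem integrable_norm_rpow_mul_schwartz (hk : 1 ≤ k) {a : ℝ} (hak : a < k)
    (h : 𝓢(Space k, ℂ)) : Integrable fun x => ((‖x‖ ^ (-a) : ℝ) : ℂ) * h x := by
  obtain ⟨n, hn⟩ := exists_nat_gt (k - a)
  obtain ⟨C, hC⟩ := exists_norm_mul_one_add_norm_pow_le h n
  have h1 := (integrable_norm_rpow_mul_one_add_norm_rpow hk (γ := k - a) (by linarith)
    hn).mul_const C
  refine h1.mono' ?_ (Eventually.of_forall fun x => ?_)
  · exact Measurable.aestronglyMeasurable (by have := h.continuous.measurable; fun_prop)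
  · have h2 := hC x
    have e : (k : ℝ) - a - k = -a := by ring
    rw [e, norm_mul, Complex.norm_real, Real.norm_of_nonneg (by positivity), mul_assoc,
      Real.rpow_neg (by positivity : (0 : ℝ) ≤ 1 + ‖x‖), Real.rpow_natCast]
    gcongr
    rwa [inv_mul_eq_div, le_div_iff₀ (by positivity)]

/-- A power of the norm as a superposition of Gaussians. -/
theorem integral_norm_rpow_mul_eq_integral_gaussian (hk : 1 ≤ k) {a : ℝ} (ha : 0 < a)
    (hak : 2 * a < k) (h : 𝓢(Space k, ℂ)) :
    ((Real.Gamma a * Real.pi ^ (-a) : ℝ) : ℂ) * ∫ x : Space k, ((‖x‖ ^ (-(2 * a)) : ℝ) : ℂ) * h x =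
      ∫ u in Set.Ioi (0 : ℝ), ((u ^ (a - 1) : ℝ) : ℂ) *
        ∫ x : Space k, ((Real.exp (-(Real.pi * u * ‖x‖ ^ 2)) : ℝ) : ℂ) * h x := by
  have : Nonempty (Fin k) := ⟨⟨0, hk⟩⟩
  have hne : ∀ᵐ x : Space k, x ≠ 0 := Measure.ae_ne volume 0
  have hsec : ∀ x : Space k, x ≠ 0 → ∫ u in Set.Ioi (0 : ℝ),
      ((u ^ (a - 1) * Real.exp (-(Real.pi * u * ‖x‖ ^ 2)) : ℝ) : ℂ) * h x =
      ((Real.Gamma a * Real.pi ^ (-a) : ℝ) : ℂ) * (((‖x‖ ^ (-(2 * a)) : ℝ) : ℂ) * h x) := by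
    intro x hx
    rw [integral_mul_const, integral_complex_ofReal,
      integral_rpow_mul_exp_gaussian ha (norm_pos_iff.2 hx)]
    push_cast
    ring
  have hint : Integrable (Function.uncurry fun (x : Space k) (u : ℝ) =>
      ((u ^ (a - 1) * Real.exp (-(Real.pi * u * ‖x‖ ^ 2)) : ℝ) : ℂ) * h x)
      (volume.prod (volume.restrict (Set.Ioi 0))) := by
    have hm : AEStronglyMeasurable (Function.uncurry fun (x : Space k) (u : ℝ) =>
      ((u ^ (a - 1) * Real.exp (-(Real.pi * u * ‖x‖ ^ 2)) : ℝ) : ℂ) * h x)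
      (volume.prod (volume.restrict (Set.Ioi 0))) := by
      apply Measurable.aestronglyMeasurable
      have := h.continuous.measurable
      unfold Function.uncurry
      fun_prop
    rw [integrable_prod_iff hm]
    constructor
    · filter_upwards [hne] with x hx
      exact (integrableOn_rpow_mul_exp_gaussian ha (norm_pos_iff.2 hx)).ofReal.mul_const (h x)
    · refine ((integrable_norm_rpow_mul_schwartz hk hak h).norm.const_mul
        (Real.Gamma a * Real.pi ^ (-a))).congr ?_
      filter_upwards [hne] with x hx
      have e : ∀ u ∈ Set.Ioi (0 : ℝ), ‖Function.uncurry (fun (x : Space k) (u : ℝ) =>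
          ((u ^ (a - 1) * Real.exp (-(Real.pi * u * ‖x‖ ^ 2)) : ℝ) : ℂ) * h x) (x, u)‖ =
          u ^ (a - 1) * Real.exp (-(Real.pi * u * ‖x‖ ^ 2)) * ‖h x‖ := fun u hu => by
        have hu' : (0 : ℝ) < u := hu
        simp only [Function.uncurry]
        rw [norm_mul, Complex.norm_real, Real.norm_of_nonneg (by positivity)]
      rw [setIntegral_congr_fun measurableSet_Ioi e, integral_mul_const,
        integral_rpow_mul_exp_gaussian ha (norm_pos_iff.2 hx), norm_mul, Complex.norm_real,
        Real.norm_of_nonneg (by positivity)]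
      ring
  have hswap := integral_integral_swap hint
  rw [← integral_const_mul]
  rw [← integral_congr_ae (hne.mono hsec), hswap]
  congr 1; ext u
  rw [← integral_const_mul]
  congr 1; ext x
  push_cast
  ring

theorem integral_gaussian_mul_fourier {u : ℝ} (hu : 0 < u) (h : 𝓢(Space k, ℂ)) :
    ∫ x : Space k, ((Real.exp (-(Real.pi * u * ‖x‖ ^ 2)) : ℝ) : ℂ) * h x =
      ((u ^ (-((k : ℝ) / 2)) : ℝ) : ℂ) *
        ∫ η : Space k, ((Real.exp (-(Real.pi * u⁻¹ * ‖η‖ ^ 2)) : ℝ) : ℂ) * 𝓕 h η := by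
  have hb : 0 < ((Real.pi * u⁻¹ : ℝ) : ℂ).re := by
    rw [Complex.ofReal_re]; have := Real.pi_pos; positivity
  have hG : Integrable fun η : Space k => Complex.exp (-((Real.pi * u⁻¹ : ℝ) : ℂ) * ‖η‖ ^ 2) := by
    simpa using GaussianFourier.integrable_cexp_neg_mul_sq_norm_add hb 0 (0 : Space k)
  have h1 := integral_fourier_mul_eq_of_integrable h.integrable hG
  have e1 : ∀ η : Space k, Complex.exp (-((Real.pi * u⁻¹ : ℝ) : ℂ) * ‖η‖ ^ 2) =
      ((Real.exp (-(Real.pi * u⁻¹ * ‖η‖ ^ 2)) : ℝ) : ℂ) := fun η => by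
    push_cast; congr 1; ring
  have e2 : ∀ x : Space k, 𝓕 (fun η : Space k =>
      Complex.exp (-((Real.pi * u⁻¹ : ℝ) : ℂ) * ‖η‖ ^ 2)) x =
      ((u ^ ((k : ℝ) / 2) : ℝ) : ℂ) * ((Real.exp (-(Real.pi * u * ‖x‖ ^ 2)) : ℝ) : ℂ) := fun x => by
    rw [fourier_gaussian_innerProductSpace hb]
    have hpi : (Real.pi : ℂ) ≠ 0 := by exact_mod_cast Real.pi_ne_zero
    have huc : (u : ℂ) ≠ 0 := by exact_mod_cast hu.ne'
    congr 1
    · rw [Complex.ofReal_cpow hu.le]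
      simp only [finrank_euclideanSpace, Fintype.card_fin]
      congr 1
      · push_cast; field_simp
      · push_cast; rfl
    · push_cast
      congr 1
      field_simp
  simp only [e2] at h1
  simp only [e1] at h1
  rw [SchwartzMap.fourier_coe]
  have h2 : ∫ η : Space k,
      ((Real.exp (-(Real.pi * u⁻¹ * ‖η‖ ^ 2)) : ℝ) : ℂ) * 𝓕 (h : Space k → ℂ) η =
      ((u ^ ((k : ℝ) / 2) : ℝ) : ℂ) *
        ∫ x : Space k, ((Real.exp (-(Real.pi * u * ‖x‖ ^ 2)) : ℝ) : ℂ) * h x := by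
    rw [← integral_const_mul]
    convert h1 using 1
    · congr 1; ext η; ring
    · congr 1; ext η; ring
  rw [h2, ← mul_assoc, ← Complex.ofReal_mul, ← Real.rpow_add hu]
  simp

/-- The Fourier transform of `‖x‖^{-β}` is a multiple of `‖η‖^{β-k}`: write both powers as
superpositions of Gaussians, which correspond to each other under the transform with the parameter
`u` replaced by `u⁻¹`. -/
theorem integral_norm_rpow_mul_eq_integral_fourier (hk : 1 ≤ k) {β : ℝ} (hβ : 0 < β) (hβk : β < k)
    (h : 𝓢(Space k, ℂ)) :
    ((Real.Gamma (β / 2) * Real.pi ^ (-(β / 2)) : ℝ) : ℂ) *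
        ∫ x : Space k, ((‖x‖ ^ (-β) : ℝ) : ℂ) * h x =
      ((Real.Gamma ((k - β) / 2) * Real.pi ^ (-((k - β) / 2)) : ℝ) : ℂ) *
        ∫ η : Space k, ((‖η‖ ^ (β - k) : ℝ) : ℂ) * 𝓕 h η := by
  have h1 := integral_norm_rpow_mul_eq_integral_gaussian hk (a := β / 2) (by linarith)
    (by linarith) h
  have h2 := integral_norm_rpow_mul_eq_integral_gaussian hk (a := (k - β) / 2) (by linarith)
    (by linarith) (𝓕 h)
  have e1 : -(2 * (β / 2)) = -β := by ring
  have e2 : -(2 * ((k - β) / 2)) = β - k := by ring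
  rw [e1] at h1
  rw [e2] at h2
  have h3 := integral_comp_rpow_Ioi (fun u : ℝ => ((u ^ ((k - β) / 2 - 1) : ℝ) : ℂ) *
    ∫ η : Space k, ((Real.exp (-(Real.pi * u * ‖η‖ ^ 2)) : ℝ) : ℂ) * 𝓕 h η) (p := -1) (by norm_num)
  rw [h1, h2, ← h3]
  refine setIntegral_congr_fun measurableSet_Ioi fun u hu => ?_
  have hu' : (0 : ℝ) < u := hu
  rw [integral_gaussian_mul_fourier hu' h, Real.rpow_neg_one, Complex.real_smul, ← mul_assoc,
    ← mul_assoc, ← Complex.ofReal_mul, ← Complex.ofReal_mul, Real.inv_rpow hu'.le,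
    ← Real.rpow_neg hu'.le, abs_neg, abs_one, one_mul, ← Real.rpow_add hu', ← Real.rpow_add hu']
  congr 3
  ring

end Riesz

/-! ### The covariance of the homogeneous noise in Fourier variables -/

section Covariance

variable {k : ℕ}

theorem integrable_riesz_correlation (hk : 1 ≤ k) {β : ℝ} (hβk : β < k)
    (f g : 𝓢(Space k, ℂ)) :
    Integrable (Function.uncurry fun x y : Space k =>
      ((‖x‖ ^ (-β) : ℝ) : ℂ) * (f y * g (y - x))) (volume.prod volume) := by
  obtain ⟨m, hm⟩ := exists_nat_gt (k - β)
  obtain ⟨Cg, hg⟩ := exists_norm_mul_one_add_norm_pow_le g m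
  obtain ⟨Cf, hf⟩ := exists_norm_mul_one_add_norm_pow_le f (m + (k + 1))
  have h1 := (integrable_norm_rpow_mul_one_add_norm_rpow hk (γ := k - β) (by linarith) hm).mul_prod
    (integrable_one_add_norm (E := Space k) (μ := volume) (r := k + 1) (by simp))
  refine (h1.const_mul (Cf * Cg)).mono' ?_ (Eventually.of_forall fun q => ?_)
  · apply Measurable.aestronglyMeasurable
    have := f.continuous.measurable
    have := g.continuous.measurable
    unfold Function.uncurry
    fun_prop
  · obtain ⟨x, y⟩ := q
    have e : (k : ℝ) - β - k = -β := by ring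
    have e1 : (-((k : ℝ) + 1)) = -((k + 1 : ℕ) : ℝ) := by push_cast; ring
    simp only [Function.uncurry]
    rw [e, e1, norm_mul, norm_mul, Complex.norm_real, Real.norm_of_nonneg (by positivity),
      Real.rpow_neg (by positivity : (0 : ℝ) ≤ 1 + ‖x‖),
      Real.rpow_neg (by positivity : (0 : ℝ) ≤ 1 + ‖y‖), Real.rpow_natCast, Real.rpow_natCast]
    -- Peetre's inequality turns decay in `y` and `y - x` into decay in `x` and `y`
    have hxy : 1 + ‖x‖ ≤ (1 + ‖y‖) * (1 + ‖y - x‖) := by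
      have h2 : ‖x‖ ≤ ‖y‖ + ‖y - x‖ := by
        have := norm_sub_le y (y - x)
        simpa using this
      nlinarith [norm_nonneg y, norm_nonneg (y - x)]
    have hkey : ‖f y‖ * ‖g (y - x)‖ * ((1 + ‖x‖) ^ m * (1 + ‖y‖) ^ (k + 1)) ≤ Cf * Cg := by
      calc ‖f y‖ * ‖g (y - x)‖ * ((1 + ‖x‖) ^ m * (1 + ‖y‖) ^ (k + 1))
          ≤ ‖f y‖ * ‖g (y - x)‖ * (((1 + ‖y‖) * (1 + ‖y - x‖)) ^ m * (1 + ‖y‖) ^ (k + 1)) := by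
            gcongr
        _ = (‖f y‖ * (1 + ‖y‖) ^ (m + (k + 1))) * (‖g (y - x)‖ * (1 + ‖y - x‖) ^ m) := by
            rw [mul_pow, pow_add]; ring
        _ ≤ Cf * Cg := mul_le_mul (hf y) (hg _) (by positivity)
            ((by positivity : (0 : ℝ) ≤ _).trans (hf y))
    have h3 : ‖f y‖ * ‖g (y - x)‖ ≤ Cf * Cg * (((1 + ‖x‖) ^ m)⁻¹ * ((1 + ‖y‖) ^ (k + 1))⁻¹) := by
      rw [← mul_inv, ← div_eq_mul_inv, le_div_iff₀ (by positivity)]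
      exact hkey
    calc ‖x‖ ^ (-β) * (‖f y‖ * ‖g (y - x)‖)
        ≤ ‖x‖ ^ (-β) * (Cf * Cg * (((1 + ‖x‖) ^ m)⁻¹ * ((1 + ‖y‖) ^ (k + 1))⁻¹)) := by gcongr
      _ = _ := by ring

/-- The energy of the Riesz kernel: apply the Fourier transform of the kernel to the correlation
of `f` and `g`, which is a convolution. -/
theorem integral_riesz_energy (hk : 1 ≤ k) {β : ℝ} (hβ : 0 < β) (hβk : β < k)
    (f g : 𝓢(Space k, ℂ)) :
    ((Real.Gamma (β / 2) * Real.pi ^ (-(β / 2)) : ℝ) : ℂ) *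
        ∫ y : Space k, ∫ z : Space k, f y * ((‖y - z‖ ^ (-β) : ℝ) : ℂ) * g z =
      ((Real.Gamma ((k - β) / 2) * Real.pi ^ (-((k - β) / 2)) : ℝ) : ℂ) *
        ∫ η : Space k, ((‖η‖ ^ (β - k) : ℝ) : ℂ) * (𝓕 f η * 𝓕 g (-η)) ∧
    Integrable fun η : Space k => ((‖η‖ ^ (β - k) : ℝ) : ℂ) * (𝓕 f η * 𝓕 g (-η)) := by
  let g' : 𝓢(Space k, ℂ) := SchwartzMap.compCLMOfContinuousLinearEquiv ℂ
    (ContinuousLinearEquiv.neg ℝ : Space k ≃L[ℝ] Space k) g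
  have hg' : ∀ x, g' x = g (-x) := fun x => rfl
  -- the correlation of `f` and `g`
  let h := SchwartzMap.convolution (ContinuousLinearMap.mul ℂ ℂ) f g'
  have hh : ∀ x, h x = ∫ y, f y * g (y - x) := fun x => by
    simp only [h]
    rw [SchwartzMap.convolution_apply, convolution_def]
    simp [hg']
  have hF : ∀ η, 𝓕 h η = 𝓕 f η * 𝓕 g (-η) := fun η => by
    have e : 𝓕 g' η = 𝓕 g (-η) := by
      rw [SchwartzMap.fourier_coe, SchwartzMap.fourier_coe, Real.fourier_eq', Real.fourier_eq',
        ← integral_neg_eq_self]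
      congr 1; ext y
      simp [hg']
    simp only [h]
    rw [SchwartzMap.fourier_convolution, SchwartzMap.pairing_apply_apply, e]
    rfl
  have h1 := integral_norm_rpow_mul_eq_integral_fourier hk hβ hβk h
  have h2 : ∫ y : Space k, ∫ z : Space k, f y * ((‖y - z‖ ^ (-β) : ℝ) : ℂ) * g z =
      ∫ x : Space k, ((‖x‖ ^ (-β) : ℝ) : ℂ) * h x := by
    have h3 := integral_integral_swap (integrable_riesz_correlation hk hβk f g)
    simp only [hh, ← integral_const_mul]
    rw [h3]
    congr 1; ext y
    rw [← integral_sub_left_eq_self _ volume y]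
    congr 1; ext x
    rw [sub_sub_cancel]
    ring
  constructor
  · rw [h2, h1]
    simp only [hF]
  · have h4 := integrable_norm_rpow_mul_schwartz hk (a := k - β) (by linarith) (𝓕 h)
    simpa only [hF, neg_sub] using h4

theorem inner_weight_mul (γ : ℝ) (p : ℝ × Space k) (z w : ℂ) :
    inner ℝ (weight γ p * z) (weight γ p * w) = ‖p.2‖ ^ (γ - k) * inner ℝ z w := by
  have h : ‖p.2‖ ^ (γ - k) = ‖p.2‖ ^ ((γ - k) / 2) * ‖p.2‖ ^ ((γ - k) / 2) := by
    rw [← sq_norm_weight, norm_weight, sq]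
  rw [h, weight, ← Complex.real_smul, ← Complex.real_smul, real_inner_smul_left,
    real_inner_smul_right]
  ring

theorem fourier_neg_eq_conj (φ : ℝ × Space k → ℝ) (r : ℝ) (η : Space k) :
    𝓕 (fun y => (φ (r, y) : ℂ)) (-η) = (starRingEnd ℂ) (𝓕 (fun y => (φ (r, y) : ℂ)) η) :=
  spaceTransform_spaceReflection φ (r, η)

theorem integral_riesz_energy_test (hk : 1 ≤ k) {β : ℝ} (hβ : 0 < β) (hβk : β < k)
    {φ ψ : ℝ × Space k → ℝ} (hφ : IsTestFunction φ) (hψ : IsTestFunction ψ) (r : ℝ) :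
    Real.Gamma (β / 2) * Real.pi ^ (-(β / 2)) *
        ∫ y : Space k, ∫ z : Space k, φ (r, y) * ‖y - z‖ ^ (-β) * ψ (r, z) =
      Real.Gamma ((k - β) / 2) * Real.pi ^ (-((k - β) / 2)) *
        ∫ η : Space k, inner ℝ (weight β (r, η) * spaceTransform (fun p => (φ p : ℂ)) (r, η))
          (weight β (r, η) * spaceTransform (fun p => (ψ p : ℂ)) (r, η)) := by
  obtain ⟨h1, h2⟩ := integral_riesz_energy hk hβ hβk (slice hφ.toSchwartz r) (slice hψ.toSchwartz r)
  have eφ : ∀ η, 𝓕 (slice hφ.toSchwartz r) η = spaceTransform (fun p => (φ p : ℂ)) (r, η) :=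
    fun η => rfl
  have eψ : ∀ η, 𝓕 (slice hψ.toSchwartz r) (-η) =
      (starRingEnd ℂ) (spaceTransform (fun p => (ψ p : ℂ)) (r, η)) :=
    fun η => fourier_neg_eq_conj ψ r η
  simp only [eφ, eψ, slice_apply, IsTestFunction.toSchwartz_apply] at h1 h2
  have e1 : ∫ y : Space k, ∫ z : Space k, (φ (r, y) : ℂ) * ((‖y - z‖ ^ (-β) : ℝ) : ℂ) * ψ (r, z) =
      ((∫ y : Space k, ∫ z : Space k, φ (r, y) * ‖y - z‖ ^ (-β) * ψ (r, z) : ℝ) : ℂ) := by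
    simp only [← Complex.ofReal_mul, integral_complex_ofReal]
  have e2 : ∫ η : Space k, inner ℝ (weight β (r, η) * spaceTransform (fun p => (φ p : ℂ)) (r, η))
      (weight β (r, η) * spaceTransform (fun p => (ψ p : ℂ)) (r, η)) =
      (∫ η : Space k, ((‖η‖ ^ (β - k) : ℝ) : ℂ) * (spaceTransform (fun p => (φ p : ℂ)) (r, η) *
        (starRingEnd ℂ) (spaceTransform (fun p => (ψ p : ℂ)) (r, η)))).re := by
    rw [← RCLike.re_eq_complex_re, ← integral_re h2]
    congr 1; ext η
    rw [inner_weight_mul, RCLike.re_eq_complex_re, Complex.re_ofReal_mul, real_inner_comm,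
      Complex.inner]
  rw [e2, ← Complex.re_ofReal_mul, ← h1, e1, ← Complex.ofReal_mul, Complex.ofReal_re]

theorem setIntegral_time_eq (f : ℝ × Space k → ℝ) (hf : Integrable f) :
    ∫ p in {p : ℝ × Space k | 0 < p.1}, f p = ∫ r in Set.Ioi (0 : ℝ), ∫ η, f (r, η) := by
  have e : {p : ℝ × Space k | 0 < p.1} = Set.Ioi (0 : ℝ) ×ˢ Set.univ := by ext; simp
  rw [e, Measure.volume_eq_prod, setIntegral_prod _ (by
    rw [← Measure.volume_eq_prod]; exact hf.integrableOn)]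
  simp

/-- The covariance functional of the noise is `c` times the inner product of the weighted space
transforms on positive times. -/
def HasSpectralCovariance (k : ℕ) (β c : ℝ) : Prop :=
  ∀ φ ψ : ℝ × Space k → ℝ, IsTestFunction φ → IsTestFunction ψ →
    noiseCovariance k β φ ψ = c * ∫ p in {p : ℝ × Space k | 0 < p.1},
      inner ℝ (weight β p * spaceTransform (fun p => (φ p : ℂ)) p)
        (weight β p * spaceTransform (fun p => (ψ p : ℂ)) p)

/-- The covariance of the noise is a multiple of the inner product of the weighted space transforms
on positive times, and the spectral constant is what this multiple and the Plancherel
constant of the time transform require. -/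
theorem exists_hasSpectralCovariance (hk : 1 ≤ k) {β : ℝ}
    (hβ : (0 < β ∧ β < min (k : ℝ) 2) ∨ (k = 1 ∧ β = 1)) :
    ∃ c : ℝ, 0 < c ∧ 0 ≤ spectralConstant k β ∧ spectralConstant k β * c = (2 * Real.pi) ^ (β + 1) ∧
      HasSpectralCovariance k β c := by
  have hβ0 : 0 < β := by rcases hβ with h | h <;> linarith [h.1, h.2]
  by_cases hc : k = 1 ∧ β = 1
  · refine ⟨1, one_pos, ?_, ?_, fun φ ψ hφ hψ => ?_⟩
    · rw [spectralConstant, if_pos hc]; positivity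
    · rw [spectralConstant, if_pos hc, hc.2, ← Real.rpow_natCast]; norm_num
    rw [noiseCovariance, if_pos hc, one_mul, setIntegral_time_eq _
      (integrable_inner_of_memLp ℝ (hφ.memLp_weight_mul hk hβ0) (hψ.memLp_weight_mul hk hβ0))]
    congr 1; ext r
    have hm : ∀ {φ : ℝ × Space k → ℝ} (hφ : IsTestFunction φ),
        MemLp (fun y => (φ (r, y) : ℂ)) 2 := by
      intro φ hφ
      exact (slice hφ.toSchwartz r).memLp 2 volume
    have h1 := integral_inner_fourier_eq_of_integrable (hφ.integrable_slice r) (hm hφ)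
      (hψ.integrable_slice r) (hm hψ)
    have h2 := congrArg Complex.re h1
    have hm' : ∀ {φ : ℝ × Space k → ℝ} (hφ : IsTestFunction φ),
        MemLp (𝓕 (fun y => (φ (r, y) : ℂ))) 2 := by
      intro φ hφ
      exact (𝓕 (slice hφ.toSchwartz r)).memLp 2 volume
    rw [← RCLike.re_eq_complex_re, ← integral_re (integrable_inner_of_memLp ℂ (hm' hφ) (hm' hψ)),
      ← integral_re (integrable_inner_of_memLp ℂ (hm hφ) (hm hψ))] at h2
    have e1 : ∀ y, φ (r, y) * ψ (r, y) =
        RCLike.re (inner ℂ (φ (r, y) : ℂ) (ψ (r, y) : ℂ)) := fun y => by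
      simp [mul_comm]
    simp only [e1]
    rw [← h2]
    congr 1; ext η
    have e2 : β - (k : ℝ) = 0 := by rw [hc.1, hc.2]; simp
    rw [inner_weight_mul, e2, Real.rpow_zero, one_mul]
    rfl
  · have hβ' : 0 < β ∧ β < min (k : ℝ) 2 := hβ.resolve_right hc
    have hβk : β < k := hβ'.2.trans_le (min_le_left _ _)
    have g1 := Real.Gamma_pos_of_pos (s := β / 2) (by linarith)
    have g2 := Real.Gamma_pos_of_pos (s := (k - β) / 2) (by linarith)
    have hpi := Real.pi_pos
    refine ⟨(Real.Gamma ((k - β) / 2) * Real.pi ^ (-((k - β) / 2))) /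
      (Real.Gamma (β / 2) * Real.pi ^ (-(β / 2))), by positivity, ?_, ?_, fun φ ψ hφ hψ => ?_⟩
    · rw [spectralConstant, if_neg hc]; positivity
    · rw [spectralConstant, if_neg hc]
      have e1 : Real.pi ^ (-((k - β) / 2)) = Real.pi ^ (-(β / 2)) * Real.pi ^ β *
          (Real.pi ^ ((k : ℝ) / 2))⁻¹ := by
        rw [← Real.rpow_neg hpi.le, ← Real.rpow_add hpi, ← Real.rpow_add hpi]
        congr 1; ring
      have e2 : (2 * Real.pi) ^ (k + 1) = (2 : ℝ) ^ ((k : ℝ) - β) * Real.pi ^ ((k : ℝ) / 2) *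
          Real.pi ^ ((k : ℝ) / 2) * (Real.pi ^ β)⁻¹ * (2 * Real.pi) ^ (β + 1) := by
        rw [← Real.rpow_natCast, Real.mul_rpow two_pos.le hpi.le, Real.mul_rpow two_pos.le hpi.le,
          ← Real.rpow_neg hpi.le]
        have a1 : (2 : ℝ) ^ (((k + 1 : ℕ)) : ℝ) = (2 : ℝ) ^ ((k : ℝ) - β) * 2 ^ (β + 1) := by
          rw [← Real.rpow_add two_pos]; congr 1; push_cast; ring
        have a2 : Real.pi ^ (((k + 1 : ℕ)) : ℝ) = Real.pi ^ ((k : ℝ) / 2) *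
            Real.pi ^ ((k : ℝ) / 2) * Real.pi ^ (-β) * Real.pi ^ (β + 1) := by
          rw [← Real.rpow_add hpi, ← Real.rpow_add hpi, ← Real.rpow_add hpi]
          congr 1; push_cast; ring
        rw [a1, a2]; ring
      rw [e1, e2]
      field_simp
    · rw [noiseCovariance, if_neg hc, setIntegral_time_eq _
        (integrable_inner_of_memLp ℝ (hφ.memLp_weight_mul hk hβ0) (hψ.memLp_weight_mul hk hβ0)),
        ← integral_const_mul]
      congr 1; ext r
      have h := integral_riesz_energy_test hk hβ0 hβk hφ hψ r
      rw [div_mul_eq_mul_div, eq_div_iff (by positivity), ← h]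
      ring

end Covariance

/-! ### Solutions driven by the homogeneous noise -/

section HomogeneousNoise

variable {k d : ℕ} {Ω : Type*} [MeasurableSpace Ω] {P : Measure Ω}
  {N : Fin d → (ℝ × Space k → ℝ) → Ω → ℝ} {β : ℝ}

theorem IsTestFunction.comp_spaceReflection {φ : ℝ × Space k → ℝ} (hφ : IsTestFunction φ) :
    IsTestFunction fun p => φ (spaceReflection p) :=
  ⟨hφ.1.comp (contDiff_fst.prodMk contDiff_snd.neg),
    hφ.2.comp_homeomorph ((Homeomorph.refl ℝ).prodCongr (Homeomorph.neg (Space k)))⟩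

theorem spaceTransform_comp_spaceReflection (φ : ℝ × Space k → ℝ) (p : ℝ × Space k) :
    spaceTransform (fun p => (φ (spaceReflection p) : ℂ)) (spaceReflection p) =
      spaceTransform (fun p => (φ p : ℂ)) p := by
  simp only [spaceTransform, spaceReflection, Real.fourier_eq']
  rw [← integral_neg_eq_self]
  congr 1; ext y
  simp

theorem measurableSet_pos_time : MeasurableSet {p : ℝ × Space k | 0 < p.1} :=
  measurableSet_lt measurable_const measurable_fst

theorem IsHomogeneousNoise.memLp (hN : IsHomogeneousNoise β N P) {φ : ℝ × Space k → ℝ}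
    (hφ : IsTestFunction φ) (j : Fin d) : MemLp (N j φ) 2 P :=
  (hN.gaussian.hasGaussianLaw_eval (⟨φ, hφ⟩, j)).memLp_two

theorem integral_norm_sub_sq {α E : Type*} [NormedAddCommGroup E] [InnerProductSpace ℝ E]
    [MeasurableSpace α] {μ : Measure α} {f g : α → E} (hf : MemLp f 2 μ) (hg : MemLp g 2 μ) :
    ∫ a, ‖f a - g a‖ ^ 2 ∂μ = ∫ a, inner ℝ (f a) (f a) ∂μ - 2 * ∫ a, inner ℝ (f a) (g a) ∂μ +
      ∫ a, inner ℝ (g a) (g a) ∂μ := by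
  have e : ∀ a, ‖f a - g a‖ ^ 2 =
      inner ℝ (f a) (f a) - 2 * inner ℝ (f a) (g a) + inner ℝ (g a) (g a) := fun a => by
    rw [norm_sub_sq_real, real_inner_self_eq_norm_sq, real_inner_self_eq_norm_sq]
  have i1 := integrable_inner_of_memLp ℝ hf hf
  have i2 := (integrable_inner_of_memLp ℝ hf hg).const_mul 2
  have i3 : Integrable (fun a => inner ℝ (f a) (f a) - 2 * inner ℝ (f a) (g a)) μ := i1.sub i2
  simp only [e]
  rw [integral_add i3 (integrable_inner_of_memLp ℝ hg hg), integral_sub i1 i2, integral_const_mul]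

/-- Up to a constant, the noise is an isometry for the norm of the weighted space transform on
positive times. -/
theorem IsHomogeneousNoise.integral_sq_sub (hN : IsHomogeneousNoise β N P) (hk : 1 ≤ k)
    (hβ : 0 < β) {c : ℝ}
    (hcov : HasSpectralCovariance k β c)
    {φ ψ : ℝ × Space k → ℝ} (hφ : IsTestFunction φ) (hψ : IsTestFunction ψ) (j : Fin d) :
    ∫ ω, ‖N j φ ω - N j ψ ω‖ ^ 2 ∂P = c * ∫ p in {p : ℝ × Space k | 0 < p.1},
      ‖weight β p * spaceTransform (fun p => (φ p : ℂ)) p -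
        weight β p * spaceTransform (fun p => (ψ p : ℂ)) p‖ ^ 2 := by
  have mφ := hN.memLp hφ j
  have mψ := hN.memLp hψ j
  have sφ := (hφ.memLp_weight_mul hk hβ).restrict {p : ℝ × Space k | 0 < p.1}
  have sψ := (hψ.memLp_weight_mul hk hβ).restrict {p : ℝ × Space k | 0 < p.1}
  have e : ∀ a b : ℝ, inner ℝ a b = a * b := fun a b => by simp [mul_comm]
  rw [integral_norm_sub_sq mφ mψ, integral_norm_sub_sq sφ sψ]
  simp only [e]
  rw [hN.covariance φ φ hφ hφ, hN.covariance φ ψ hφ hψ, hN.covariance ψ ψ hψ hψ,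
    hcov φ φ hφ hφ, hcov φ ψ hφ hψ, hcov ψ ψ hψ hψ]
  simp only [if_true]
  ring

theorem IsHomogeneousNoise.eLpNorm_sub_le (hN : IsHomogeneousNoise β N P) (hk : 1 ≤ k)
    (hβ : 0 < β) {c : ℝ} (hc : 0 < c)
    (hcov : HasSpectralCovariance k β c)
    {φ ψ : ℝ × Space k → ℝ} (hφ : IsTestFunction φ) (hψ : IsTestFunction ψ) (j : Fin d) :
    eLpNorm (fun p => weight β p * spaceTransform (fun p => (φ p : ℂ)) p -
        weight β p * spaceTransform (fun p => (ψ p : ℂ)) p) 2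
        (volume.restrict {p : ℝ × Space k | 0 < p.1}) ≤
      (Real.toNNReal (√c⁻¹) : ℝ≥0) * eLpNorm (fun ω => N j φ ω - N j ψ ω) 2 P := by
  have h := hN.integral_sq_sub hk hβ hcov hφ hψ j
  have sφ := (hφ.memLp_weight_mul hk hβ).restrict {p : ℝ × Space k | 0 < p.1}
  have sψ := (hψ.memLp_weight_mul hk hβ).restrict {p : ℝ × Space k | 0 < p.1}
  refine (ENNReal.pow_le_pow_left_iff two_ne_zero).1 ?_
  have sφψ : MemLp (fun p => weight β p * spaceTransform (fun p => (φ p : ℂ)) p -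
      weight β p * spaceTransform (fun p => (ψ p : ℂ)) p) 2
      (volume.restrict {p : ℝ × Space k | 0 < p.1}) := sφ.sub sψ
  have nφψ : MemLp (fun ω => N j φ ω - N j ψ ω) 2 P := (hN.memLp hφ j).sub (hN.memLp hψ j)
  rw [mul_pow, eLpNorm_two_sq_eq sφψ, eLpNorm_two_sq_eq nφψ]
  have e : ((Real.toNNReal (√c⁻¹) : ℝ≥0) : ℝ≥0∞) ^ 2 = ENNReal.ofReal c⁻¹ := by
    rw [← ENNReal.ofReal, ← ENNReal.ofReal_pow (Real.sqrt_nonneg _), Real.sq_sqrt (by positivity)]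
  rw [e, ← ENNReal.ofReal_mul (by positivity), h, inv_mul_cancel_left₀ hc.ne']

/-- A stochastic integral of the truncated wave kernel determines the limit of the weighted space
transforms: on positive times they converge to that of the kernel. -/
theorem IsNoiseIntegral.exists_tendsto (hN : IsHomogeneousNoise β N P) (hk : 1 ≤ k)
    (hβ : 0 < β) (hβ2 : β < 2) (hβk : β ≤ k) {c : ℝ} (hc : 0 < c)
    (hcov : HasSpectralCovariance k β c)
    {t : ℝ} (ht : 0 ≤ t) {x : Space k} {j : Fin d} {X : Ω → ℝ}
    (h : IsNoiseIntegral (N j) P (truncatedKernel t x) X) :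
    ∃ φ : ℕ → ℝ × Space k → ℝ, (∀ n, IsTestFunction (φ n)) ∧
      Tendsto (fun n => eLpNorm (fun ω => N j (φ n) ω - X ω) 2 P) atTop (𝓝 0) ∧
      Tendsto (fun n => eLpNorm (fun p => weight β p * spaceTransform (fun p => (φ n p : ℂ)) p -
        weight β p * kernelTransform t x p) 2 (volume.restrict {p : ℝ × Space k | 0 < p.1}))
        atTop (𝓝 0) := by
  obtain ⟨hX, φ, hφ, hT, hlim⟩ := h
  have hk0 : (1 : ℝ) ≤ k := by exact_mod_cast hk
  set S : Set (ℝ × Space k) := {p | 0 < p.1} with hS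
  have hSm : MeasurableSet S := measurableSet_pos_time
  refine ⟨φ, hφ, hlim, ?_⟩
  have hφS := fun n => ((hφ n).memLp_weight_mul hk hβ).restrict S
  obtain ⟨L, hL, hLlim⟩ := exists_tendsto_eLpNorm_of_dominated (μ := volume.restrict S) hφS
    (fun n => hN.memLp (hφ n) j) hX hlim _
    (fun n m => hN.eLpNorm_sub_le hk hβ hc hcov (hφ n) (hφ m) j)
  have hLi : MemLp (S.indicator L) 2 := (memLp_indicator_iff_restrict hSm).2 hL
  have hG := memLp_weight_mul_kernelTransform hk hβ hβ2 t x
  -- convergence of the test functions as distributions identifies `L`: pair with test functions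
  -- supported in positive times, reflected in space
  have hzero : ∀ᵐ p : ℝ × Space k, p.1 ∈ Set.Ioi (0 : ℝ) →
      S.indicator L p - weight β p * kernelTransform t x p = 0 := by
    have hγ : 0 < 2 * k - β := by linarith
    refine ae_eq_zero_of_forall_test hk hγ isOpen_Ioi (hLi.sub hG)
      fun ψ hψ hψ0 => ?_
    have hψm := hψ.memLp_weight_mul hk hγ
    have hψr := hψ.comp_spaceReflection
    have hAψ : ∀ p : ℝ × Space k, p ∉ S → spaceTransform (fun p => (ψ p : ℂ)) p = 0 := by
      intro p hp
      have : ∀ y, ψ (p.1, y) = 0 := fun y => hψ0 (p.1, y) hp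
      simp [spaceTransform, this, Real.fourier_eq']
    have hA : ∀ p, spaceTransform hψr.toSchwartz (spaceReflection p) =
        spaceTransform (fun p => (ψ p : ℂ)) p := spaceTransform_comp_spaceReflection ψ
    have h1 : Tendsto (fun n => ∫ p, (φ n p : ℂ) * hψr.toSchwartz p) atTop
        (𝓝 (∫ p in S, L p * (weight (2 * k - β) p * spaceTransform (fun p => (ψ p : ℂ)) p))) := by
      refine (tendsto_integral_mul_of_tendsto_eLpNorm hφS hL (hψm.restrict S) hLlim).congr
        fun n => ?_
      rw [integral_mul_eq_integral_spaceTransform hk (hφ n)]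
      simp only [hA]
      rw [← integral_weighted_pairing hk β]
      refine setIntegral_eq_integral_of_forall_compl_eq_zero fun p hp => ?_
      rw [hAψ p hp, mul_zero, mul_zero]
    have h2 := tendsto_nhds_unique h1 (hT hψr.toSchwartz)
    rw [truncatedKernel_eq_integral hk ht x] at h2
    simp only [hA] at h2
    rw [← integral_weighted_pairing hk β] at h2
    have i1 : Integrable fun p => S.indicator L p *
        (weight (2 * k - β) p * spaceTransform (fun p => (ψ p : ℂ)) p) := hLi.integrable_mul hψm
    have i2 : Integrable fun p => weight β p * kernelTransform t x p *
        (weight (2 * k - β) p * spaceTransform (fun p => (ψ p : ℂ)) p) := hG.integrable_mul hψm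
    simp only [sub_mul]
    rw [integral_sub i1 i2, ← h2, sub_eq_zero, ← integral_indicator hSm]
    congr 1; ext p
    by_cases hp : p ∈ S <;> simp [hp]
  refine hLlim.congr fun n => eLpNorm_congr_ae ?_
  filter_upwards [ae_restrict_of_ae hzero, ae_restrict_mem hSm] with p hp hpS
  have := hp hpS
  rw [Set.indicator_of_mem hpS] at this
  rw [sub_eq_zero.1 this]

theorem setIntegral_inner_kernelTransform (β t t' : ℝ) (x x' : Space k) :
    ∫ p in {p : ℝ × Space k | 0 < p.1}, inner ℝ (weight β p * kernelTransform t x p)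
      (weight β p * kernelTransform t' x' p) =
    ∫ p, inner ℝ (weight β p * kernelTransform t x p) (weight β p * kernelTransform t' x' p) := by
  refine setIntegral_eq_integral_of_forall_compl_eq_zero fun p hp => ?_
  have : kernelTransform t x p = 0 := by
    rw [kernelTransform, Set.indicator_of_notMem fun h => hp h.1]
  rw [this, mul_zero, inner_zero_left]

/-- The covariance of two stochastic integrals of wave kernels. -/
theorem IsHomogeneousNoise.integral_mul_of_tendsto (hN : IsHomogeneousNoise β N P) (hk : 1 ≤ k)
    (hβ : 0 < β) (hβ2 : β < 2) {c : ℝ}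
    (hcov : HasSpectralCovariance k β c)
    {t t' : ℝ} {x x' : Space k} {j l : Fin d} {X X' : Ω → ℝ} (hX : MemLp X 2 P) (hX' : MemLp X' 2 P)
    {φ φ' : ℕ → ℝ × Space k → ℝ} (hφ : ∀ n, IsTestFunction (φ n)) (hφ' : ∀ n, IsTestFunction (φ' n))
    (h : Tendsto (fun n => eLpNorm (fun ω => N j (φ n) ω - X ω) 2 P) atTop (𝓝 0))
    (h' : Tendsto (fun n => eLpNorm (fun ω => N l (φ' n) ω - X' ω) 2 P) atTop (𝓝 0))
    (hG : Tendsto (fun n => eLpNorm (fun p => weight β p * spaceTransform (fun p => (φ n p : ℂ)) p -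
      weight β p * kernelTransform t x p) 2 (volume.restrict {p : ℝ × Space k | 0 < p.1}))
      atTop (𝓝 0))
    (hG' : Tendsto (fun n => eLpNorm (fun p => weight β p *
      spaceTransform (fun p => (φ' n p : ℂ)) p - weight β p * kernelTransform t' x' p) 2
      (volume.restrict {p : ℝ × Space k | 0 < p.1})) atTop (𝓝 0)) :
    ∫ ω, X ω * X' ω ∂P = if j = l then c * ∫ p, inner ℝ (weight β p * kernelTransform t x p)
      (weight β p * kernelTransform t' x' p) else 0 := by
  have h1 := tendsto_integral_inner_of_tendsto_eLpNorm ℝ (fun n => hN.memLp (hφ n) j)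
    (fun n => hN.memLp (hφ' n) l) hX hX' h h'
  have h2 := (tendsto_integral_inner_of_tendsto_eLpNorm ℝ
    (fun n => ((hφ n).memLp_weight_mul hk hβ).restrict {p : ℝ × Space k | 0 < p.1})
    (fun n => ((hφ' n).memLp_weight_mul hk hβ).restrict {p : ℝ × Space k | 0 < p.1})
    ((memLp_weight_mul_kernelTransform hk hβ hβ2 t x).restrict _)
    ((memLp_weight_mul_kernelTransform hk hβ hβ2 t' x').restrict _) hG hG').const_mul c
  rw [setIntegral_inner_kernelTransform] at h2
  have e : ∀ a b : ℝ, inner ℝ a b = a * b := fun a b => by simp [mul_comm]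
  simp only [e] at h1
  have e2 : ∀ n, ∫ ω, N j (φ n) ω * N l (φ' n) ω ∂P =
      if j = l then c * ∫ p in {p : ℝ × Space k | 0 < p.1},
          inner ℝ (weight β p * spaceTransform (fun p => (φ n p : ℂ)) p)
            (weight β p * spaceTransform (fun p => (φ' n p : ℂ)) p) else 0 := fun n => by
    rw [hN.covariance _ _ (hφ n) (hφ' n), hcov _ _ (hφ n) (hφ' n)]
  simp only [e2] at h1
  by_cases hjl : j = l
  · simp only [if_pos hjl] at h1 ⊢
    exact tendsto_nhds_unique h1 h2
  · simp only [if_neg hjl] at h1 ⊢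
    exact tendsto_nhds_unique h1 tendsto_const_nhds

end HomogeneousNoise

/-! ### Equality in law -/

section EqualityInLaw

variable {k d : ℕ} {Ω Ω' : Type*} [MeasurableSpace Ω] [MeasurableSpace Ω'] {P : Measure Ω}
  {P' : Measure Ω'} {W : Fin d → Set (ℝ × Space k) → Ω → ℂ}
  {N : Fin d → (ℝ × Space k → ℝ) → Ω' → ℝ} {β : ℝ}

/-- The covariance of the real part of the field, by Plancherel in time. -/
theorem IsComplexWhiteNoise.integral_re_harmonizableField_mul (hW : IsComplexWhiteNoise W P)
    (hk : 1 ≤ k) (hβ : 0 < β) (hβ2 : β < 2) {t t' : ℝ} (ht : 0 ≤ t) (ht' : 0 ≤ t') (x x' : Space k)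
    (j l : Fin d) :
    ∫ ω, (harmonizableField β W P t x ω j).re * (harmonizableField β W P t' x' ω l).re ∂P =
      if j = l then (2 * Real.pi) ^ (β + 1) * ∫ p, inner ℝ (weight β p * kernelTransform t x p)
        (weight β p * kernelTransform t' x' p) else 0 := by
  rw [hW.integral_re_mul_re j l (hW.isWienerIntegral_harmonizableField hk hβ hβ2 ht x j)
    (hW.isWienerIntegral_harmonizableField hk hβ hβ2 ht' x' l),
    ← integral_inner_weight_mul_timeTransform β (isTimeBounded_kernelTransform t x)
      (isTimeBounded_kernelTransform t' x') (memLp_weight_mul_kernelTransform hk hβ hβ2 t x)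
      (memLp_weight_mul_kernelTransform hk hβ hβ2 t' x')]
  congr 1
  refine integral_congr_ae ?_
  filter_upwards [waveF_ae_eq hk ht x, waveF_ae_eq hk ht' x'] with p hp hp'
  rw [hp, hp']

/-- Both fields are limits of centered Gaussian vectors, with the same covariances. -/
theorem identDistrib_re_harmonizableField [IsProbabilityMeasure P] [IsProbabilityMeasure P']
    (hW : IsComplexWhiteNoise W P) (hN : IsHomogeneousNoise β N P') (hk : 1 ≤ k) (hβ : 0 < β)
    (hβ2 : β < 2) (hβk : β ≤ k) {c κ : ℝ} (hc : 0 < c) (hκ : 0 ≤ κ)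
    (hκc : κ * c = (2 * Real.pi) ^ (β + 1)) (hcov : HasSpectralCovariance k β c)
    {u : ℝ → Space k → Ω' → Fin d → ℝ} (hu : IsMildWaveSolution N P' u) {ι : Type*} [Fintype ι]
    (t : ι → ℝ) (ht : ∀ i, 0 ≤ t i) (x : ι → Space k) (j : ι → Fin d) :
    IdentDistrib (fun ω i => (harmonizableField β W P (t i) (x i) ω (j i)).re)
      (fun ω i => √κ * u (t i) (x i) ω (j i)) P P' := by
  choose φ hφ hlim hG using fun i => (hu.mild (t i) (ht i) (x i) (j i)).exists_tendsto
    hN hk hβ hβ2 hβk hc hcov (ht i)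
  have hm := fun i => (hu.mild (t i) (ht i) (x i) (j i)).1
  refine (hW.isCenteredGaussianLimit_re j fun i =>
    hW.isWienerIntegral_harmonizableField hk hβ hβ2 (ht i) (x i) (j i)).identDistrib
    (X' := fun i ω => √κ * u (t i) (x i) ω (j i))
    ⟨fun i => (hm i).const_mul _, fun n i ω => √κ * N (j i) (φ i n) ω, fun n => ?_, fun n i => ?_,
      fun i => ?_⟩ fun i i' => ?_
  · have := hasGaussianLaw_linear_combination hN.gaussian (ι := ι) (κ := fun _ => Unit)
      (fun _ _ => √κ) (fun i _ => (⟨φ i n, hφ i n⟩, j i))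
    simpa using this
  · rw [integral_const_mul, hN.centered _ (hφ i n), mul_zero]
  · have h := ENNReal.Tendsto.const_mul (a := ‖√κ‖ₑ) (hlim i) (Or.inr (by simp))
    rw [mul_zero] at h
    refine h.congr fun n => ?_
    rw [← eLpNorm_const_smul]
    congr 1; ext ω
    simp [mul_sub]
  · rw [hW.integral_re_harmonizableField_mul hk hβ hβ2 (ht i) (ht i')]
    have e : ∀ ω, √κ * u (t i) (x i) ω (j i) * (√κ * u (t i') (x i') ω (j i')) =
        κ * (u (t i) (x i) ω (j i) * u (t i') (x i') ω (j i')) := fun ω => by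
      rw [mul_mul_mul_comm, Real.mul_self_sqrt hκ]
    simp only [e]
    rw [integral_const_mul, hN.integral_mul_of_tendsto hk hβ hβ2 hcov (hm i) (hm i') (hφ i) (hφ i')
      (hlim i) (hlim i') (hG i) (hG i'), ← hκc]
    split_ifs <;> ring

end EqualityInLaw

end

end StochasticWave

theorem proposition8p2 (k d : ℕ) (hk : 1 ≤ k) (β : ℝ)
    (hβ : (0 < β ∧ β < min (k : ℝ) 2) ∨ (k = 1 ∧ β = 1))
    {Ω : Type*} [MeasurableSpace Ω] (P : Measure Ω) [IsProbabilityMeasure P]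
    (W : Fin d → Set (ℝ × Space k) → Ω → ℂ) (hW : IsComplexWhiteNoise W P) :
    -- the stochastic integrals that define the driving noise and the field exist
    (∀ (j : Fin d) (φ : ℝ × Space k → ℝ), IsTestFunction φ →
      IsWienerIntegral (W j) P (fun p => weight β p * fourierST φ p) (tildeNoise β W P j φ)) ∧
    (∀ (t : ℝ), 0 ≤ t → ∀ (x : Space k) (j : Fin d),
      IsWienerIntegral (W j) P (fun p => weight β p * waveF t x p)
        (fun ω => harmonizableField β W P t x ω j)) ∧
    -- the field solves the stochastic wave system
    IsMildWaveSolution (tildeNoise β W P) P (harmonizableField β W P) ∧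
    -- its real part has the law of the (normalized) solution of the real system
    (∀ {Ω' : Type*} [MeasurableSpace Ω'] (P' : Measure Ω') [IsProbabilityMeasure P']
      (N : Fin d → (ℝ × Space k → ℝ) → Ω' → ℝ) (u : ℝ → Space k → Ω' → Fin d → ℝ),
      IsHomogeneousNoise β N P' → IsMildWaveSolution N P' u →
      ∀ (n : ℕ) (t : Fin n → ℝ) (x : Fin n → Space k), (∀ i, 0 ≤ t i) →
        IdentDistrib
          (fun ω (i : Fin n) (j : Fin d) => (harmonizableField β W P (t i) (x i) ω j).re)
          (fun ω (i : Fin n) (j : Fin d) => √(spectralConstant k β) * u (t i) (x i) ω j)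
          P P') := by
  have hβ0 : 0 < β := by rcases hβ with h | h <;> linarith [h.1, h.2]
  have hβ2 : β < 2 := by
    rcases hβ with h | h
    · exact h.2.trans_le (min_le_right _ _)
    · rw [h.2]; norm_num
  have hβk : β ≤ k := by
    rcases hβ with h | h
    · exact h.2.le.trans (min_le_left _ _)
    · rw [h.1, h.2]; simp
  refine ⟨fun j φ hφ => hW.isWienerIntegral_tildeNoise hk hβ0 j hφ,
    fun t ht x j => hW.isWienerIntegral_harmonizableField hk hβ0 hβ2 ht x j,
    hW.isMildWaveSolution hk hβ0 hβ2 hβk, ?_⟩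
  intro Ω' _ P' _ N u hN hu n t x ht
  obtain ⟨c, hc, hκ, hκc, hcov⟩ := exists_hasSpectralCovariance hk hβ
  have h := identDistrib_re_harmonizableField hW hN hk hβ0 hβ2 hβk hc hκ hκc hcov hu
    (fun i : Fin n × Fin d => t i.1) (fun i => ht i.1) (fun i => x i.1) (fun i => i.2)
  exact h.comp (u := fun (f : Fin n × Fin d → ℝ) i j => f (i, j)) (by fun_prop)
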